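/- Let $\{\xi_k\}_{k\in\mathbb Z}$ be a stationary, centered, (circularly symmetric) complex Gaussian process with covariances $\mathbb E[\xi_k\overline{\xi_l}]=\gamma(l-k)$ and unit variance $\gamma(0)=1$ (circular symmetry: $\mathbb E[\xi_k\xi_l]=0$ for all $k,l$). Put $$f(z)=\sum_{k=0}^\infty \xi_k z^k,\qquad G(z)=\sum_{k=1}^\infty\overline{\gamma(k)}\,z^k,\qquad G_2(z,w)=1+G(z)+\overline{G(w)},$$ and let $N_f(D)=\#\{z\in D: f(z)=0\}$. Write $\mathbb D$ for the open unit disk, $\mathbb D(r)=\{|z|<r\}$, and $dm$ for Lebesgue measure on $\mathbb C$. Almost surely the series $f(z)$ converges for every $z\in\mathbb D$, and $G_2(z,z)\neq 0$ for every $z\in\mathbb D$. Let $D$ be a domain with $\overline D\subset\mathbb D$ whose boundary $\partial D$ consists of finitely many disjoint smooth regular simple closed curves, with $D$ lying locally on exactly one side of each, oriented so that $D$ lies on the left. Then $N_f(D)$ is (a.e.) measurable with finite expectation, and $$\mathbb E N_f(D)=\frac1{2\pi i}\oint_{\partial D}\frac{\overline z}{1-|z|^2}\,dz+\mathcal J(D),$$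 where $\mathcal J(D)$ is given by the two equal expressions $$\mathcal J(D)=\frac1{2\pi i}\oint_{\partial D}\frac{G'(z)}{G_2(z,z)}\,dz=-\frac1\pi\int_D\left(\frac{|G'(z)|}{G_2(z,z)}\right)^2dm(z),$$ the last integral being absolutely convergent. In particular, for $0<r<1$, with $N_f(r)=N_f(\mathbb D(r))$ and $\mathcal J(r)=\mathcal J(\mathbb D(r))$ (both expressions, $\partial\mathbb D(r)$ being the counterclockwise circle), $$\mathbb E N_f(r)=\frac{r^2}{1-r^2}+\mathcal J(r).$$ -/

import Mathlib

open MeasureTheory ProbabilityTheory Filter Topology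
open scoped ComplexConjugate ENNReal

noncomputable section

/-- `ξ` is a stationary centered complex Gaussian process indexed by `ℤ`, of unit variance, with
covariance function `γ`. Complex Gaussian means circularly symmetric, as usual: the process is
jointly Gaussian over `ℝ`, centered, and all pseudo-covariances `𝔼[ξ k * ξ l]` vanish; its law is
then determined by the covariances `𝔼[ξ k * conj (ξ l)] = γ (l - k)`. -/
structure IsStationaryComplexGaussian {Ω : Type*} [MeasurableSpace Ω]
    (P : Measure Ω) (ξ : ℤ → Ω → ℂ) (γ : ℤ → ℂ) : Prop where
  gaussian : IsGaussianProcess ξ P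
  centered : ∀ k, ∫ ω, ξ k ω ∂P = 0
  pseudoCovariance : ∀ k l, ∫ ω, ξ k ω * ξ l ω ∂P = 0
  covariance : ∀ k l, ∫ ω, ξ k ω * conj (ξ l ω) ∂P = γ (l - k)
  unitVariance : γ 0 = 1

/-- The random power series `f(z) = ∑_{k ≥ 0} ξ_k z^k`. -/
def randomSeries {Ω : Type*} (ξ : ℤ → Ω → ℂ) (ω : Ω) (z : ℂ) : ℂ :=
  ∑' k : ℕ, ξ (k : ℤ) ω * z ^ k

/-- The number `N_f(D)` of zeros of `f` in `D`, possibly infinite. -/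
def zeroCount {Ω : Type*} (ξ : ℤ → Ω → ℂ) (D : Set ℂ) (ω : Ω) : ℝ≥0∞ :=
  ({z ∈ D | randomSeries ξ ω z = 0}.encard : ℝ≥0∞)

/-- `G(z) = ∑_{k ≥ 1} conj (γ k) z^k`. -/
def covG (γ : ℤ → ℂ) (z : ℂ) : ℂ :=
  ∑' k : ℕ, conj (γ ((k : ℤ) + 1)) * z ^ (k + 1)

/-- `G₂(z, w) = 1 + G(z) + conj (G(w))`. -/
def covG₂ (γ : ℤ → ℂ) (z w : ℂ) : ℂ :=
  1 + covG γ z + conj (covG γ w)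

/-- A smooth, positively oriented boundary of a planar set `D`: the topological boundary of `D` is
the disjoint union of finitely many smooth regular simple closed curves (each given as a
`1`-periodic map on `ℝ`), such that, at each of its points, `D` lies on the left of the curve and
not on its right. -/
structure SmoothBoundary (D : Set ℂ) where
  /-- the number of boundary curves -/
  n : ℕ
  /-- the boundary curves -/
  curve : Fin n → ℝ → ℂ
  smooth : ∀ i, ContDiff ℝ (⊤ : ℕ∞) (curve i)
  periodic : ∀ i, Function.Periodic (curve i) 1
  regular : ∀ i t, deriv (curve i) t ≠ 0
  simple : ∀ i, Set.InjOn (curve i) (Set.Ico 0 1)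
  disjoint : ∀ i j, i ≠ j → Disjoint (Set.range (curve i)) (Set.range (curve j))
  frontier_eq : frontier D = ⋃ i, Set.range (curve i)
  left_mem : ∀ i t, ∀ᶠ ε : ℝ in 𝓝[>] 0,
    curve i t + (ε : ℂ) * (Complex.I * deriv (curve i) t) ∈ D
  right_notMem : ∀ i t, ∀ᶠ ε : ℝ in 𝓝[>] 0,
    curve i t - (ε : ℂ) * (Complex.I * deriv (curve i) t) ∉ D

/-- The contour integral `∮_{∂D} g(z) dz` over the positively oriented boundary. -/
def SmoothBoundary.contourIntegral {D : Set ℂ} (b : SmoothBoundary D) (g : ℂ → ℂ) : ℂ :=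
  ∑ i, ∫ t in (0 : ℝ)..1, g (b.curve i t) * deriv (b.curve i) t

end

/-! ### The area formula, with multiplicities -/

/-! The argument conditions on all the randomness except one coefficient. Regressing on `ξ 0` gives
`ξ k = conj (γ k) * ξ 0 + x k`, where the residual sequence `x` is independent of `ξ 0`. Hence `f =
ξ 0 * (1 + G) + F` with `F(z) = ∑ x k * z ^ k`. The factor `1 + G` has no zero in the disk: `G₂(z,z)
= 1 + 2 Re G(z)` is `(1 - |z|²)` times the variance of `f(z)`, so it is nonnegative, and the open
mapping theorem makes it positive.

The zeros of `f` in `D` are therefore the solutions of `h(z) = ξ 0`, where `h = -F / (1 + G)` is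
holomorphic and independent of `ξ 0`. With `x` fixed, the area formula for `h` and the density `π⁻¹
exp(-|w|²)` of `ξ 0` turn the mean number of solutions into `π⁻¹ ∫_D |h'|² exp(-|h|²)`. Critical
values form a null set, so multiplicities play no role.

It remains to average over `x` at a fixed `z`. There `(h, h')` is a circular Gaussian pair, and for
such a pair `(X, Y)` one has `E[exp(-|X|²) |Y|²] = E|Y|² / (1 + E|X|²) - |E[Y conj X]|² / (1 +
E|X|²)²`. This equals `∂∂̄ log (1 + E|h|²)`. Stationarity gives the kernel `E[f(z) conj f(w)] =
G₂(z,w) / (1 - z conj w)`, and `1 + E|h(z)|²` is its diagonal divided by `|1 + G(z)|²`. The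
holomorphic factor disappears under `∂∂̄ log`, which leaves `1/(1-|z|²)² - |G'|²/G₂(z,z)²`.

Green's theorem converts both terms into contour integrals, since `∂̄(conj z / (1-|z|²)) =
1/(1-|z|²)²` and `∂̄(G'/G₂(z,z)) = -|G'|²/G₂(z,z)²`. It is proved here for smooth multiply connected
boundaries by horizontal slicing. The one-dimensional area formula applied to the height along a
boundary curve rewrites `∮ F dy` as an integral over heights of signed sums over crossings, and each
such sum is the integral of `∂F/∂x` over the slice of `D`.

The main carriers are `lintegral_abs_det_mul_eq_lintegral_tsum_fiber`,
`SmoothBoundary.contourIntegral_eq`, `covSum_toeplitz_pow_pow`,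
`integral_exp_neg_norm_sq_mul_norm_sq`, `indepFun_residual` and `lintegral_zeroCount`. -/

theorem tsum_fiber_eq_extend {E : Type*} {f : E → E} {s : Set E} (hinj : Set.InjOn f s)
    (g : E → ℝ≥0∞) (y : E) :
    ∑' x, {x ∈ s | f x = y}.indicator g x =
      Function.extend (s.domRestrict f) (fun x => g x) 0 y := by
  by_cases hy : ∃ x : s, s.domRestrict f x = y
  · obtain ⟨x, rfl⟩ := hy
    rw [(Set.injOn_iff_injective.1 hinj).extend_apply, tsum_eq_single (x : E)]
    · simp [x.2]
    · intro x' hx'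
      rw [Set.indicator_of_notMem]
      rintro ⟨h1, h2⟩
      exact hx' (hinj h1 x.2 h2)
  · rw [Function.extend_apply' _ _ _ hy]
    simp only [Pi.zero_apply, ENNReal.tsum_eq_zero]
    intro x
    rw [Set.indicator_of_notMem]
    rintro ⟨h1, h2⟩
    exact hy ⟨⟨x, h1⟩, h2⟩

section AreaFormula

variable {E : Type*} [NormedAddCommGroup E] [NormedSpace ℝ E] [FiniteDimensional ℝ E]
  [MeasurableSpace E] [BorelSpace E] (μ : Measure E) [μ.IsAddHaarMeasure]
  {f : E → E} {s : Set E} {f' : E → E →L[ℝ] E}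

/-- Each fibre has at most one point, so the fibre sum is `g` transported along `f` and extended by
zero. It is measurable because `f` restricted to `s` is a measurable embedding, and the identity is
then the change of variables onto `f '' s`. -/
theorem lintegral_abs_det_mul_of_injOn (hs : MeasurableSet s)
    (hf' : ∀ x ∈ s, HasFDerivWithinAt f (f' x) s x) (hinj : Set.InjOn f s)
    {g : E → ℝ≥0∞} (hg : Measurable g) :
    Measurable (fun y => ∑' x, {x ∈ s | f x = y}.indicator g x) ∧
      ∫⁻ x in s, ENNReal.ofReal |(f' x).det| * g x ∂μ =
        ∫⁻ y, ∑' x, {x ∈ s | f x = y}.indicator g x ∂μ := by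
  have hemb := measurableEmbedding_of_fderivWithin hs hf' hinj
  simp only [tsum_fiber_eq_extend hinj]
  refine ⟨hemb.measurable_extend (hg.comp measurable_subtype_coe) measurable_const, ?_⟩
  have himg : MeasurableSet (f '' s) := measurable_image_of_fderivWithin hs hf' hinj
  rw [← setLIntegral_eq_of_support_subset (s := f '' s) (μ := μ) (f := Function.extend _ _ _),
    lintegral_image_eq_lintegral_abs_det_fderiv_mul μ hs hf' hinj]
  · refine setLIntegral_congr_fun hs fun x hx => ?_
    have := (Set.injOn_iff_injective.1 hinj).extend_apply (fun x : s => g x) 0 ⟨x, hx⟩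
    simp only [Set.domRestrict_apply] at this
    simp only [this]
  · intro y hy
    by_contra hcon
    refine hy (Function.extend_apply' _ _ _ ?_)
    rintro ⟨x, rfl⟩
    exact hcon ⟨x, x.2, rfl⟩

/-- Area formula: almost every value is regular, and integrating a weight against the Jacobian
amounts to integrating its sums over the fibers. -/
theorem lintegral_abs_det_mul_eq_lintegral_tsum_fiber (hs : MeasurableSet s)
    (hs' : MeasurableSet {x ∈ s | (f' x).det ≠ 0})
    (hf' : ∀ x ∈ s, HasFDerivWithinAt f (f' x) s x) {g : E → ℝ≥0∞} (hg : Measurable g) :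
    (∀ᵐ y ∂μ, ∀ x ∈ s, f x = y → (f' x).det ≠ 0) ∧
    AEMeasurable (fun y => ∑' x : {x ∈ s | f x = y}, g x) μ ∧
      ∫⁻ x in s, ENNReal.ofReal |(f' x).det| * g x ∂μ =
        ∫⁻ y, ∑' x : {x ∈ s | f x = y}, g x ∂μ := by
  set s' := {x ∈ s | (f' x).det ≠ 0} with hs'def
  have hsub : s' ⊆ s := fun x hx => hx.1
  -- Sard: the image of the critical set is null.
  have hreg : ∀ᵐ y ∂μ, ∀ x ∈ s, f x = y → (f' x).det ≠ 0 := by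
    have h0 : μ (f '' (s \ s')) = 0 := by
      refine addHaar_image_eq_zero_of_det_fderivWithin_eq_zero μ (f' := f')
        (fun x hx => (hf' x hx.1).mono Set.sdiff_subset) fun x hx => ?_
      by_contra hne
      exact hx.2 ⟨hx.1, hne⟩
    filter_upwards [measure_eq_zero_iff_ae_notMem.1 h0] with y hy x hx hxy hdet
    exact hy ⟨x, ⟨hx, fun h => h.2 hdet⟩, hxy⟩
  refine ⟨hreg, ?_⟩
  have hf'' : ∀ x ∈ s', HasFDerivWithinAt f (f' x) s' x := fun x hx => (hf' x hx.1).mono hsub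
  have hr : ∀ A : E →L[ℝ] E, ∃ δ : NNReal, δ ≠ 0 ∧ (A.det ≠ 0 → ∀ t : Set E,
      ApproximatesLinearOn f A t δ → Set.InjOn f t) := by
    intro A
    by_cases hA : A.det = 0
    · exact ⟨1, one_ne_zero, fun h => absurd hA h⟩
    · let B := A.toContinuousLinearEquivOfDetNeZero hA
      have hB : (B : E →L[ℝ] E) = A := ContinuousLinearMap.coe_toContinuousLinearEquivOfDetNeZero _ _
      rcases subsingleton_or_nontrivial E with hE | hE
      · exact ⟨1, one_ne_zero, fun _ t _ => fun x _ y _ _ => Subsingleton.elim x y⟩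
      · have hpos : 0 < ‖(B.symm : E →L[ℝ] E)‖₊⁻¹ := by
          simpa using B.symm.norm_pos
        refine ⟨‖(B.symm : E →L[ℝ] E)‖₊⁻¹ / 2, (half_pos hpos).ne', fun _ t ht => ?_⟩
        rw [← hB] at ht
        exact ht.injOn (Or.inr (half_lt_self hpos))
  choose r hr0 hrinj using hr
  obtain ⟨t, A, htd, htm, hcov, happ, hA⟩ :=
    exists_partition_approximatesLinearOn_of_hasFDerivWithinAt f s' f' hf'' r hr0
  have hinj : ∀ n, Set.InjOn f (s' ∩ t n) := by
    intro n
    rcases s'.eq_empty_or_nonempty with he | hne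
    · simp [he]
    · obtain ⟨y, hy, hAy⟩ := hA hne n
      exact hrinj (A n) (hAy ▸ hy.2) _ (happ n)
  have key := fun n => lintegral_abs_det_mul_of_injOn μ (hs'.inter (htm n))
    (fun x hx => (hf'' x hx.1).mono Set.inter_subset_left) (hinj n) hg
  -- Over a regular value every fibre point is a regular point, so it lies in exactly one piece of
  -- the partition.
  have hfib : ∀ᵐ y ∂μ, ∑' x : {x ∈ s | f x = y}, g x =
      ∑' n, ∑' x, {x ∈ s' ∩ t n | f x = y}.indicator g x := by
    filter_upwards [hreg] with y hy
    rw [tsum_subtype, ENNReal.tsum_comm]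
    congr 1 with x
    by_cases hx : x ∈ s ∧ f x = y
    · have hx' : x ∈ s' := ⟨hx.1, hy x hx.1 hx.2⟩
      obtain ⟨n, hn⟩ := Set.mem_iUnion.1 (hcov hx')
      rw [tsum_eq_single n, Set.indicator_of_mem (by exact hx),
        Set.indicator_of_mem (by exact ⟨⟨hx', hn⟩, hx.2⟩)]
      intro m hm
      rw [Set.indicator_of_notMem]
      rintro ⟨⟨_, h2⟩, _⟩
      exact (Set.disjoint_left.1 (htd hm) h2) hn
    · rw [Set.indicator_of_notMem (by exact hx)]
      symm
      rw [ENNReal.tsum_eq_zero]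
      intro n
      rw [Set.indicator_of_notMem]
      rintro ⟨⟨h1, _⟩, h2⟩
      exact hx ⟨h1.1, h2⟩
  refine ⟨(AEMeasurable.tsum fun n => (key n).1.aemeasurable).congr
    (hfib.mono fun y hy => hy.symm), ?_⟩
  rw [lintegral_congr_ae hfib, lintegral_tsum fun n => (key n).1.aemeasurable]
  have hunion : s' = ⋃ n, s' ∩ t n := by
    rw [← Set.inter_iUnion, Set.inter_eq_left.2 hcov]
  have h1 : ∫⁻ x in s, ENNReal.ofReal |(f' x).det| * g x ∂μ =
      ∫⁻ x in s', ENNReal.ofReal |(f' x).det| * g x ∂μ := by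
    rw [← lintegral_inter_add_sdiff _ s hs']
    have : ∫⁻ x in s \ s', ENNReal.ofReal |(f' x).det| * g x ∂μ = 0 := by
      rw [setLIntegral_congr_fun (g := fun _ => 0) (hs.diff hs')]
      · simp
      · intro x hx
        have : (f' x).det = 0 := by
          by_contra hne
          exact hx.2 ⟨hx.1, hne⟩
        simp [this]
    rw [this, add_zero, Set.inter_eq_right.2 hsub]
  rw [h1]
  conv_lhs => rw [hunion]
  rw [lintegral_iUnion (fun n => hs'.inter (htm n))
    (fun m n hmn => (htd hmn).mono Set.inter_subset_right Set.inter_subset_right)]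
  exact tsum_congr fun n => (key n).2

end AreaFormula

/-! ### The one-dimensional area formula with signed weights -/

/-- The area formula on the line, made finite: `s` is bounded and both `p` and `y'` are bounded
there, so the extended sums and integrals can be replaced by real ones. -/
theorem integral_mul_abs_deriv_of_nonneg {y y' p : ℝ → ℝ} (hy : ∀ t, HasDerivAt y (y' t) t)
    (hy' : Continuous y') (hp : Measurable p) {C : ℝ} (hpC : ∀ t, p t ≤ C) (hp0 : ∀ t, 0 ≤ p t)
    {s : Set ℝ} (hs : MeasurableSet s) (hsb : s ⊆ Set.Icc 0 1) :
    (∀ᵐ h, {t ∈ s | y t = h}.Finite ∧ ∀ t ∈ s, y t = h → y' t ≠ 0) ∧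
    Integrable (fun h => ∑' t : {t ∈ s | y t = h}, p t) ∧
    Integrable (fun t => p t * |y' t|) (volume.restrict s) ∧
      ∫ t in s, p t * |y' t| = ∫ h, ∑' t : {t ∈ s | y t = h}, p t := by
  have hmain : ∀ g : ℝ → ℝ≥0∞, Measurable g → _ := fun g hg =>
    lintegral_abs_det_mul_eq_lintegral_tsum_fiber volume (f := y)
      (f' := fun t => ContinuousLinearMap.toSpanSingleton ℝ (y' t)) hs
      (by
        simp only [ContinuousLinearMap.det_toSpanSingleton]
        exact hs.inter (hy'.measurable (measurableSet_singleton 0).compl))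
      (fun t _ => (hy t).hasDerivWithinAt.hasFDerivWithinAt) hg
  simp only [ContinuousLinearMap.det_toSpanSingleton] at hmain
  have hint : ∀ q : ℝ → ℝ, Measurable q → (∃ C, ∀ t, |q t| ≤ C) →
      Integrable (fun t => q t * |y' t|) (volume.restrict s) := by
    rintro q hq ⟨B, hB⟩
    have h1 : Integrable (fun t => |y' t|) (volume.restrict s) :=
      (hy'.abs.integrableOn_Icc (a := 0) (b := 1)).mono_set hsb
    exact h1.bdd_mul hq.aestronglyMeasurable (ae_of_all _ hB)
  -- With weight 1 the fibre sum is the cardinality of the fibre. Its integral is the total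
  -- variation of `y` on `s`, which is finite, so almost every fibre is finite.
  have h1 := hmain (fun _ => 1) measurable_const
  have hreg := h1.1
  have hfin : ∀ᵐ h, {t ∈ s | y t = h}.Finite := by
    have hlt : ∫⁻ h, ∑' t : {t ∈ s | y t = h}, (1 : ℝ≥0∞) ≠ ∞ := by
      rw [← h1.2.2]
      have := (hint (fun _ => 1) measurable_const ⟨1, by simp⟩).lintegral_lt_top
      simpa using this.ne
    filter_upwards [ae_lt_top' h1.2.1 hlt] with h hh
    rw [ENNReal.tsum_set_one] at hh
    exact Set.encard_lt_top_iff.1 (by simpa using hh)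
  obtain ⟨-, hm, heq⟩ := hmain (fun t => ENNReal.ofReal (p t)) hp.ennreal_ofReal
  have hpi : Integrable (fun t => p t * |y' t|) (volume.restrict s) :=
    hint p hp ⟨C, fun t => by rw [abs_of_nonneg (hp0 t)]; exact hpC t⟩
  have hlhs : ∫⁻ t in s, ENNReal.ofReal |y' t| * ENNReal.ofReal (p t) =
      ENNReal.ofReal (∫ t in s, p t * |y' t|) := by
    rw [ofReal_integral_eq_lintegral_ofReal hpi
      (ae_of_all _ fun t => mul_nonneg (hp0 t) (abs_nonneg _))]
    refine lintegral_congr fun t => ?_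
    rw [mul_comm, ENNReal.ofReal_mul (hp0 t)]
  have hsum : (fun h => (∑' t : {t ∈ s | y t = h}, ENNReal.ofReal (p t)).toReal) =ᵐ[volume]
      fun h => ∑' t : {t ∈ s | y t = h}, p t := by
    filter_upwards [hfin] with h hh
    have := hh.to_subtype
    have := Fintype.ofFinite {t ∈ s | y t = h}
    rw [tsum_fintype, tsum_fintype, ENNReal.toReal_sum (fun _ _ => ENNReal.ofReal_ne_top)]
    exact Finset.sum_congr rfl fun t _ => ENNReal.toReal_ofReal (hp0 t)
  have hne : ∫⁻ h, ∑' t : {t ∈ s | y t = h}, ENNReal.ofReal (p t) ≠ ∞ := by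
    rw [← heq, hlhs]
    exact ENNReal.ofReal_ne_top
  refine ⟨hfin.and hreg, (integrable_toReal_of_lintegral_ne_top hm hne).congr hsum, hpi, ?_⟩
  rw [← integral_congr_ae hsum, integral_toReal hm (ae_lt_top' hm hne), ← heq, hlhs,
    ENNReal.toReal_ofReal]
  exact integral_nonneg fun t => mul_nonneg (hp0 t) (abs_nonneg _)

/-- Positive and negative parts are treated separately; finiteness of almost every fibre allows the
two sums to be subtracted. -/
theorem integral_mul_abs_deriv {y y' p : ℝ → ℝ} (hy : ∀ t, HasDerivAt y (y' t) t)
    (hy' : Continuous y') (hp : Measurable p) {C : ℝ} (hpC : ∀ t, |p t| ≤ C)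
    {s : Set ℝ} (hs : MeasurableSet s) (hsb : s ⊆ Set.Icc 0 1) :
    (∀ᵐ h, {t ∈ s | y t = h}.Finite ∧ ∀ t ∈ s, y t = h → y' t ≠ 0) ∧
    Integrable (fun h => ∑' t : {t ∈ s | y t = h}, p t) ∧
      ∫ t in s, p t * |y' t| = ∫ h, ∑' t : {t ∈ s | y t = h}, p t := by
  have h1 := integral_mul_abs_deriv_of_nonneg hy hy' (p := fun t => max (p t) 0)
    (hp.max measurable_const)
    (C := C) (fun t => max_le ((le_abs_self _).trans (hpC t)) ((abs_nonneg _).trans (hpC t)))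
    (fun t => le_max_right (p t) 0) hs hsb
  have h2 := integral_mul_abs_deriv_of_nonneg hy hy' (p := fun t => max (-p t) 0)
    (hp.neg.max measurable_const)
    (C := C) (fun t => max_le ((neg_le_abs _).trans (hpC t)) ((abs_nonneg _).trans (hpC t)))
    (fun t => le_max_right (-p t) 0) hs hsb
  have hdec : ∀ t, p t = max (p t) 0 - max (-p t) 0 := fun t => (max_zero_sub_eq_self (p t)).symm
  have hsum : (fun h => ∑' t : {t ∈ s | y t = h}, p t) =ᵐ[volume]
      fun h => ∑' t : {t ∈ s | y t = h}, max (p t) 0 - ∑' t : {t ∈ s | y t = h}, max (-p t) 0 := by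
    filter_upwards [h1.1] with h hh
    have := hh.1.to_subtype
    have := Fintype.ofFinite {t ∈ s | y t = h}
    simp only [tsum_fintype, ← Finset.sum_sub_distrib, ← hdec]
  refine ⟨h1.1, (h1.2.1.sub h2.2.1).congr hsum.symm, ?_⟩
  rw [integral_congr_ae hsum, integral_sub h1.2.1 h2.2.1, ← h1.2.2.2, ← h2.2.2.2,
    ← integral_sub h1.2.2.1 h2.2.2.1]
  congr 1 with t
  rw [← sub_mul, ← hdec]

/-! ### Integration over a set of the line with prescribed jumps -/

/-- Adding to the indicator of `E` a step of height `σ j` at each `X j` cancels every jump. The sum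
`v` vanishes far to the left, so by connectedness it vanishes off the `X j`. Thus the indicator of
`E` is almost everywhere `-∑ σ j 1_{(X j, ∞)}`, and `∫ G'` over `(X j, ∞)` is `-G (X j)`. -/
theorem setIntegral_deriv_eq_sum_jumps {ι : Type*} [Fintype ι] {X : ι → ℝ}
    (hX : Function.Injective X) {σ : ι → ℝ} {E : Set ℝ} (hEm : MeasurableSet E) {R : ℝ}
    (hER : ∀ x ∈ E, R ≤ x) (hoff : ∀ x ∉ Set.range X, ∀ᶠ y in 𝓝 x, (y ∈ E ↔ x ∈ E))
    (hjump : ∀ j, (σ j = 1 ∧ (∀ᶠ y in 𝓝[<] X j, y ∈ E) ∧ ∀ᶠ y in 𝓝[>] X j, y ∉ E) ∨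
      (σ j = -1 ∧ (∀ᶠ y in 𝓝[<] X j, y ∉ E) ∧ ∀ᶠ y in 𝓝[>] X j, y ∈ E))
    {G : ℝ → ℝ} (hG : ContDiff ℝ 1 G) (hGc : HasCompactSupport G) :
    ∫ x in E, deriv G x = ∑ j, σ j * G (X j) := by
  classical
  let S : ι → ℝ → ℝ := fun j => (Set.Ioi (X j)).indicator fun _ => σ j
  let v : ℝ → ℝ := fun x => E.indicator (fun _ => (1 : ℝ)) x + ∑ j, S j x
  have hS : ∀ j x, x ≠ X j → ∀ᶠ y in 𝓝 x, S j y = S j x := by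
    intro j x hx
    rcases lt_or_gt_of_ne hx with h | h
    · filter_upwards [Iio_mem_nhds h] with y hy
      simp [S, h.le, (Set.mem_Iio.1 hy).le]
    · filter_upwards [Ioi_mem_nhds h] with y hy
      have : X j < y := hy
      simp [S, h, this]
  have hoffv : ∀ x ∉ Set.range X, ∀ᶠ y in 𝓝 x, v y = v x := by
    intro x hx
    have h1 : ∀ᶠ y in 𝓝 x, ∀ j, S j y = S j x :=
      eventually_all.2 fun j => hS j x fun h => hx ⟨j, h.symm⟩
    filter_upwards [h1, hoff x hx] with y hy1 hy2
    simp only [v, hy1, Set.indicator, hy2]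
  have hlim : ∀ x, ∃ c, ∀ᶠ y in 𝓝[≠] x, v y = c := by
    intro x
    by_cases hx : x ∈ Set.range X
    · obtain ⟨j, rfl⟩ := hx
      have h1 : ∀ᶠ y in 𝓝 (X j), ∀ k ∈ Finset.univ.erase j, S k y = S k (X j) :=
        (Finset.eventually_all _).2 fun k hk =>
          hS k (X j) fun h => (Finset.ne_of_mem_erase hk) (hX h.symm)
      have hv : ∀ y, v y = E.indicator (fun _ => (1 : ℝ)) y + S j y +
          ∑ k ∈ Finset.univ.erase j, S k y := by
        intro y
        simp only [v]
        rw [add_assoc, Finset.add_sum_erase _ (fun k => S k y) (Finset.mem_univ j)]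
      have hlt : ∀ᶠ y in 𝓝[<] X j, S j y = 0 := by
        filter_upwards [self_mem_nhdsWithin] with y hy
        simp [S, (Set.mem_Iio.1 hy).le]
      have hgt : ∀ᶠ y in 𝓝[>] X j, S j y = σ j := by
        filter_upwards [self_mem_nhdsWithin] with y hy
        have : X j < y := hy
        simp [S, this]
      rcases hjump j with ⟨hσ, hl, hr⟩ | ⟨hσ, hl, hr⟩
      · refine ⟨1 + ∑ k ∈ Finset.univ.erase j, S k (X j), ?_⟩
        rw [punctured_nhds_eq_nhdsWithin_sup_nhdsWithin, eventually_sup]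
        constructor
        · filter_upwards [hl, hlt, nhdsWithin_le_nhds h1] with y h1 h2 h3
          rw [hv, h2, Finset.sum_congr rfl h3]
          simp [h1]
        · filter_upwards [hr, hgt, nhdsWithin_le_nhds h1] with y h1 h2 h3
          rw [hv, h2, Finset.sum_congr rfl h3]
          simp [h1, hσ]
      · refine ⟨∑ k ∈ Finset.univ.erase j, S k (X j), ?_⟩
        rw [punctured_nhds_eq_nhdsWithin_sup_nhdsWithin, eventually_sup]
        constructor
        · filter_upwards [hl, hlt, nhdsWithin_le_nhds h1] with y h1 h2 h3
          rw [hv, h2, Finset.sum_congr rfl h3]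
          simp [h1]
        · filter_upwards [hr, hgt, nhdsWithin_le_nhds h1] with y h1 h2 h3
          rw [hv, h2, Finset.sum_congr rfl h3]
          simp [h1, hσ]
    · exact ⟨v x, nhdsWithin_le_nhds (hoffv x hx)⟩
  have hzero : ∀ x, ∀ᶠ y in 𝓝[≠] x, v y = 0 := by
    -- `v` is constant on a punctured neighbourhood of every point, so this set and its complement
    -- are both open; it contains every point far enough to the left.
    let A : Set ℝ := {x | ∀ᶠ y in 𝓝[≠] x, v y = 0}
    have hopen : ∀ p : ℝ → Prop, IsOpen {x | ∀ᶠ y in 𝓝[≠] x, p (v y)} := by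
      intro p
      rw [isOpen_iff_mem_nhds]
      intro x hx
      have h2 : ∀ᶠ y in 𝓝[≠] x, ∀ᶠ z in 𝓝[≠] y, p (v z) :=
        ((eventually_nhdsWithin_iff.1 hx).eventually_nhds.filter_mono nhdsWithin_le_nhds |>.and
          self_mem_nhdsWithin).mono fun y hy => by
            have := (isOpen_compl_singleton (x := x)).mem_nhds hy.2
            exact nhdsWithin_le_nhds ((hy.1.and this).mono fun z hz => hz.1 hz.2)
      filter_upwards [eventually_nhdsWithin_iff.1 h2] with y hy
      by_cases hyx : y = x
      · rw [hyx]; exact hx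
      · exact hy hyx
    have hcompl : Aᶜ = {x | ∀ᶠ y in 𝓝[≠] x, v y ≠ 0} := by
      ext x
      obtain ⟨c, hc⟩ := hlim x
      constructor
      · intro hx
        refine hc.mono fun y hy h0 => hx ?_
        rw [hy] at h0
        exact hc.mono fun z hz => by rw [hz, h0]
      · intro hx hx'
        obtain ⟨y, h1, h2⟩ := (Filter.Eventually.and (f := 𝓝[≠] x) (p := fun y => v y ≠ 0) hx hx').exists
        exact h1 h2
    have hclopen : IsClopen A :=
      ⟨⟨by rw [hcompl]; exact hopen (· ≠ 0)⟩, hopen (· = 0)⟩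
    have hne : A.Nonempty := by
      obtain ⟨m, hm⟩ := (Set.finite_range X).bddBelow
      refine ⟨min m R - 1, ?_⟩
      refine nhdsWithin_le_nhds ?_
      filter_upwards [Iio_mem_nhds (show min m R - 1 < min m R by linarith)] with y hy
      have hy1 : y < m := lt_of_lt_of_le hy (min_le_left _ _)
      have hy2 : y < R := lt_of_lt_of_le hy (min_le_right _ _)
      have hyE : y ∉ E := fun h => not_le.2 hy2 (hER y h)
      have hyS : ∀ j, S j y = 0 := fun j => by
        have : m ≤ X j := hm ⟨j, rfl⟩
        simp [S, hy1.le.trans this]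
      simp [v, hyE, hyS]
    intro x
    have : x ∈ A := by rw [hclopen.eq_univ hne]; trivial
    exact this
  have hv0 : ∀ x ∉ Set.range X, v x = 0 := by
    intro x hx
    obtain ⟨y, h1, h2⟩ := ((hzero x).and (nhdsWithin_le_nhds (hoffv x hx))).exists
    rw [← h2, h1]
  have hint : Integrable (deriv G) :=
    (hG.continuous_deriv le_rfl).integrable_of_hasCompactSupport hGc.deriv
  have hae : E.indicator (deriv G) =ᵐ[volume]
      fun x => ∑ j, -σ j * (Set.Ioi (X j)).indicator (deriv G) x := by
    have : ∀ᵐ x : ℝ, x ∉ Set.range X :=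
      measure_eq_zero_iff_ae_notMem.1 ((Set.finite_range X).measure_zero _)
    filter_upwards [this] with x hx
    have h0 := hv0 x hx
    have e1 : E.indicator (deriv G) x = E.indicator (fun _ => (1 : ℝ)) x * deriv G x := by
      by_cases h : x ∈ E <;> simp [h]
    have e2 : ∀ j, -σ j * (Set.Ioi (X j)).indicator (deriv G) x = -S j x * deriv G x := by
      intro j
      by_cases h : x ∈ Set.Ioi (X j) <;> simp only [S, h, Set.indicator_of_mem,
        Set.indicator_of_notMem, not_false_eq_true]; ring
    simp only [e1, e2, ← Finset.sum_mul, Finset.sum_neg_distrib]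
    congr 1
    simp only [v] at h0
    linarith
  rw [← integral_indicator hEm, integral_congr_ae hae, integral_finsetSum]
  · refine Finset.sum_congr rfl fun j _ => ?_
    rw [integral_const_mul, integral_indicator measurableSet_Ioi, hGc.integral_Ioi_deriv_eq hG]
    ring
  · exact fun j _ => (hint.indicator measurableSet_Ioi).const_mul _

/-! ### Local geometry of a smooth boundary -/

namespace SmoothBoundary

variable {D : Set ℂ} (b : SmoothBoundary D)

theorem continuous_curve (i : Fin b.n) : Continuous (b.curve i) := (b.smooth i).continuous

theorem hasDerivAt_curve (i : Fin b.n) (t : ℝ) :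
    HasDerivAt (b.curve i) (deriv (b.curve i) t) t :=
  ((b.smooth i).differentiable (by simp) t).hasDerivAt

theorem continuous_deriv_curve (i : Fin b.n) : Continuous (deriv (b.curve i)) :=
  (b.smooth i).continuous_deriv (by simp)

theorem curve_mem_frontier (i : Fin b.n) (t : ℝ) : b.curve i t ∈ frontier D := by
  rw [b.frontier_eq]
  exact Set.mem_iUnion.2 ⟨i, t, rfl⟩

theorem sub_eq_intCast_of_curve_eq {i : Fin b.n} {s t : ℝ} (h : b.curve i s = b.curve i t) :
    ∃ m : ℤ, s - t = m := by
  rw [← Int.fract_eq_fract]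
  have hf : ∀ u, b.curve i (Int.fract u) = b.curve i u := fun u => by
    have := (b.periodic i).sub_zsmul_eq (x := u) ⌊u⌋
    rwa [zsmul_one] at this
  exact b.simple i ⟨Int.fract_nonneg s, Int.fract_lt_one s⟩
    ⟨Int.fract_nonneg t, Int.fract_lt_one t⟩ (by rw [hf, hf, h])

/-- Near a boundary point, the boundary is tangent to the boundary curve. -/
theorem eventually_notMem_frontier (i : Fin b.n) (t₀ : ℝ) {c : ℝ} (hc : 0 < c) :
    ∀ᶠ w in 𝓝 (0 : ℂ), c * ‖w‖ < |(w * conj (deriv (b.curve i) t₀)).im| →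
      b.curve i t₀ + w ∉ frontier D := by
  set d := deriv (b.curve i) t₀ with hd
  have hd0 : 0 < ‖d‖ := norm_pos_iff.2 (b.regular i t₀)
  -- If `w` is a chord of the curve with linearization error at most `κ|t - t₀|`, its component
  -- normal to `d`, times `‖d‖`, is at most `κ‖d‖|t - t₀|`, while `c‖w‖` is at least `c(‖d‖ - κ)|t -
  -- t₀|`. This `κ` makes the two bounds equal.
  set κ := c * ‖d‖ / (c + ‖d‖) with hκ
  have hκ0 : 0 < κ := by positivity
  have hκeq : κ * ‖d‖ = c * (‖d‖ - κ) := by rw [hκ]; field_simp; ring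
  have hder := (hasDerivAt_iff_isLittleO.1 (b.hasDerivAt_curve i t₀)).def hκ0
  obtain ⟨η, hη0, hη⟩ := Metric.eventually_nhds_iff_ball.1 hder
  set η' := min (η / 2) (1 / 4) with hη'
  have hη'0 : 0 < η' := by positivity
  have hη'1 : η' < η := lt_of_le_of_lt (min_le_left _ _) (by linarith)
  have hη'2 : η' ≤ 1 / 4 := min_le_right _ _
  -- The boundary away from the short arc around `t₀` is compact and misses the base point, so only
  -- that arc is seen nearby.
  set K := (⋃ j ∈ {j | j ≠ i}, Set.range (b.curve j)) ∪
    b.curve i '' Set.Icc (t₀ + η') (t₀ + 1 - η') with hK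
  have hKcl : IsClosed K := by
    refine IsClosed.union ?_ (isCompact_Icc.image (b.continuous_curve i)).isClosed
    refine (Set.toFinite _).isClosed_biUnion fun j _ => ?_
    exact ((b.periodic j).compact_of_continuous one_ne_zero (b.continuous_curve j)).isClosed
  have hpK : b.curve i t₀ ∉ K := by
    rintro (h | ⟨s, hs, hst⟩)
    · simp only [Set.mem_iUnion] at h
      obtain ⟨j, hj, s, hs⟩ := h
      exact Set.disjoint_left.1 (b.disjoint j i hj) ⟨s, hs⟩ ⟨t₀, rfl⟩
    · obtain ⟨m, hm⟩ := b.sub_eq_intCast_of_curve_eq hst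
      have h1 : (0 : ℝ) < m := by rw [← hm]; linarith [hs.1]
      have h2 : (m : ℝ) < 1 := by rw [← hm]; linarith [hs.2]
      have h1' : 0 < m := by exact_mod_cast h1
      have h2' : m < 1 := by exact_mod_cast h2
      omega
  have hcont : Tendsto (fun w : ℂ => b.curve i t₀ + w) (𝓝 0) (𝓝 (b.curve i t₀)) := by
    have : Continuous fun w : ℂ => b.curve i t₀ + w := by fun_prop
    simpa using this.tendsto 0
  filter_upwards [hcont.eventually (hKcl.isOpen_compl.mem_nhds hpK)] with w hw hcw hfr
  rw [b.frontier_eq] at hfr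
  obtain ⟨j, s, hs⟩ := Set.mem_iUnion.1 hfr
  by_cases hj : j = i
  swap
  · exact hw (Or.inl (Set.mem_biUnion hj ⟨s, hs⟩))
  subst hj
  obtain ⟨t, ht, hst⟩ := (b.periodic j).exists_mem_Ico one_pos s (t₀ - η')
  rw [hst] at hs
  rcases le_or_gt (t₀ + η') t with h | h
  · exact hw (Or.inr ⟨t, ⟨h, by linarith [ht.2]⟩, hs⟩)
  have hmem : t ∈ Metric.ball t₀ η := by
    rw [Metric.mem_ball, Real.dist_eq, abs_lt]
    constructor <;> linarith [ht.1]
  have hlin := hη t hmem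
  have hw' : w = (w - (t - t₀) • d) + (t - t₀) • d := by ring
  set e := w - (t - t₀) • d with he
  have hee : ‖e‖ ≤ κ * |t - t₀| := by
    have : b.curve j t - b.curve j t₀ = w := by rw [hs]; ring
    rw [this] at hlin
    simpa [he, hd] using hlin
  have him : (w * conj d).im = (e * conj d).im := by
    rw [hw', add_mul, Complex.add_im]
    have : ((t - t₀) • d * conj d).im = 0 := by
      simp [Complex.mul_im]; ring
    rw [this, add_zero]
  have h1 : |(w * conj d).im| ≤ κ * |t - t₀| * ‖d‖ := by
    rw [him]
    refine (Complex.abs_im_le_norm _).trans ?_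
    rw [norm_mul, Complex.norm_conj]
    gcongr
  have h2 : (‖d‖ - κ) * |t - t₀| ≤ ‖w‖ := by
    have : ‖(t - t₀) • d‖ ≤ ‖w‖ + ‖e‖ := by
      have : (t - t₀) • d = w - e := by rw [he]; ring
      rw [this]; exact norm_sub_le _ _
    rw [norm_smul, Real.norm_eq_abs] at this
    linarith
  have h3 : c * ((‖d‖ - κ) * |t - t₀|) ≤ c * ‖w‖ := by gcongr
  have h4 : κ * |t - t₀| * ‖d‖ = c * ((‖d‖ - κ) * |t - t₀|) := by
    rw [← mul_assoc c, ← hκeq]; ring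
  linarith

theorem convex_cone (d : ℂ) {c : ℝ} (hc : 0 < c) :
    Convex ℝ {w : ℂ | c * ‖w‖ < (w * conj d).im} := by
  intro x hx y hy α β hα hβ hαβ
  simp only [Set.mem_ofPred_eq] at hx hy ⊢
  have h1 : ‖α • x + β • y‖ ≤ α * ‖x‖ + β * ‖y‖ := by
    refine (norm_add_le _ _).trans ?_
    rw [norm_smul, norm_smul, Real.norm_of_nonneg hα, Real.norm_of_nonneg hβ]
  have h2 : ((α • x + β • y) * conj d).im = α * (x * conj d).im + β * (y * conj d).im := by
    simp [Complex.mul_im, Complex.add_im]; ring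
  rw [h2]
  have h3 := mul_le_mul_of_nonneg_left h1 hc.le
  rcases hα.eq_or_lt with h | h
  · subst h
    have : β = 1 := by linarith
    subst this
    simpa using hy
  · nlinarith [mul_lt_mul_of_pos_left hx h, mul_le_mul_of_nonneg_left hy.le hβ]

/-- Near the base point the open cone around the inner normal avoids the frontier. The cone is
convex, hence connected, so a small truncation of it lies entirely in `D` or entirely in the
exterior, and the one ray provided by `left_mem` decides which. The opposite cone is decided by
`right_notMem`. This extends the normal condition to every transversal direction. -/
theorem eventually_smul_mem (hD : IsOpen D) (i : Fin b.n) (t₀ : ℝ) {v : ℂ}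
    (hv : 0 < (v * conj (deriv (b.curve i) t₀)).im) :
    (∀ᶠ ε : ℝ in 𝓝[>] 0, b.curve i t₀ + ε * v ∈ D) ∧
      ∀ᶠ ε : ℝ in 𝓝[>] 0, b.curve i t₀ - ε * v ∉ D := by
  set d := deriv (b.curve i) t₀ with hd
  have hd0 : 0 < ‖d‖ := norm_pos_iff.2 (b.regular i t₀)
  have hv0 : 0 < ‖v‖ := norm_pos_iff.2 fun h => by simp [h] at hv
  -- Half of the largest aperture constant allowed by `v`: the cone then contains `v`, and also the
  -- normal `I * d`, because `c ≤ ‖d‖ / 2`.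
  set c := (v * conj d).im / (2 * ‖v‖) with hc
  have hc0 : 0 < c := by positivity
  have hcd : c * ‖d‖ < ‖d‖ * ‖d‖ := by
    have : (v * conj d).im ≤ ‖v‖ * ‖d‖ := by
      refine (Complex.im_le_norm _).trans ?_
      rw [norm_mul, Complex.norm_conj]
    have : c ≤ ‖d‖ / 2 := by
      rw [hc, div_le_div_iff₀ (by positivity) (by positivity)]; nlinarith
    nlinarith
  obtain ⟨δ, hδ0, hδ⟩ := Metric.eventually_nhds_iff_ball.1
    (b.eventually_notMem_frontier i t₀ hc0)
  set S := {w : ℂ | c * ‖w‖ < (w * conj d).im} ∩ Metric.ball 0 δ with hS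
  have hSc : Convex ℝ S := (convex_cone d hc0).inter (convex_ball 0 δ)
  have hmemS : ∀ u : ℂ, c * ‖u‖ < (u * conj d).im → ∀ᶠ ε : ℝ in 𝓝[>] 0, (ε : ℂ) * u ∈ S := by
    intro u hu
    have hcont : Tendsto (fun ε : ℝ => (ε : ℂ) * u) (𝓝 0) (𝓝 0) := by
      have : Continuous fun ε : ℝ => (ε : ℂ) * u := by fun_prop
      simpa using this.tendsto 0
    filter_upwards [self_mem_nhdsWithin,
      nhdsWithin_le_nhds (hcont.eventually (Metric.ball_mem_nhds 0 hδ0))] with ε hε hε'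
    refine ⟨?_, hε'⟩
    have hε0 : 0 < ε := hε
    have h1 : ((ε : ℂ) * u * conj d).im = ε * (u * conj d).im := by
      rw [mul_assoc, Complex.im_ofReal_mul]
    simp only [Set.mem_ofPred_eq, norm_mul, h1, Complex.norm_real, Real.norm_eq_abs, abs_of_pos hε0]
    nlinarith
  have hvS := hmemS v (by
    have : c * ‖v‖ = (v * conj d).im / 2 := by rw [hc]; field_simp
    rw [this]; linarith)
  have hnS := hmemS (Complex.I * d) (by
    have : (Complex.I * d * conj d).im = ‖d‖ * ‖d‖ := by
      rw [mul_assoc, Complex.mul_conj, Complex.normSq_eq_norm_sq]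
      simp only [Complex.I_mul_im, Complex.ofReal_re]; ring
    rw [this]; simpa using hcd)
  have huniv : ∀ A : Set ℂ, A ∩ frontier D = ∅ → A ⊆ D ∪ (closure D)ᶜ := by
    intro A hA x hx
    by_cases hxD : x ∈ closure D
    · left
      by_contra hxD'
      have : x ∈ A ∩ frontier D := ⟨hx, hxD, by rwa [hD.interior_eq]⟩
      rw [hA] at this; exact this
    · exact Or.inr hxD
  have hdisj : Disjoint D (closure D)ᶜ :=
    Set.disjoint_left.2 fun x hx hx' => hx' (subset_closure hx)
  constructor
  · have hA : (fun w => b.curve i t₀ + w) '' S ∩ frontier D = ∅ := by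
      rw [Set.eq_empty_iff_forall_notMem]
      rintro x ⟨⟨w, hw, rfl⟩, hx⟩
      exact hδ w hw.2 (lt_of_lt_of_le hw.1 (le_abs_self _)) hx
    have hpre : IsPreconnected ((fun w => b.curve i t₀ + w) '' S) :=
      hSc.isPreconnected.image _ (by fun_prop)
    obtain ⟨ε, h1, h2⟩ := (hnS.and (b.left_mem i t₀)).exists
    have hsub := hpre.subset_left_of_subset_union hD isClosed_closure.isOpen_compl hdisj
      (huniv _ hA) ⟨_, ⟨_, h1, rfl⟩, h2⟩
    exact hvS.mono fun ε hε => hsub ⟨_, hε, rfl⟩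
  · have hA : (fun w => b.curve i t₀ - w) '' S ∩ frontier D = ∅ := by
      rw [Set.eq_empty_iff_forall_notMem]
      rintro x ⟨⟨w, hw, rfl⟩, hx⟩
      refine hδ (-w) (by simpa using hw.2) ?_ (by simpa [sub_eq_add_neg] using hx)
      refine lt_of_lt_of_le ?_ (neg_le_abs _)
      simpa using hw.1
    have hpre : IsPreconnected ((fun w => b.curve i t₀ - w) '' S) :=
      hSc.isPreconnected.image _ (by fun_prop)
    obtain ⟨ε, h1, h2⟩ := (hnS.and (b.right_notMem i t₀)).exists
    have h2' := (huniv _ hA ⟨_, h1, rfl⟩).resolve_left h2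
    have hsub := hpre.subset_right_of_subset_union hD isClosed_closure.isOpen_compl hdisj
      (huniv _ hA) ⟨_, ⟨_, h1, rfl⟩, h2'⟩
    exact hvS.mono fun ε hε hmem => hsub ⟨_, hε, rfl⟩ (subset_closure hmem)

end SmoothBoundary

/-! ### Green's theorem -/

namespace SmoothBoundary

variable {D : Set ℂ} (b : SmoothBoundary D)

theorem hasDerivAt_im_curve (i : Fin b.n) (t : ℝ) :
    HasDerivAt (fun t => (b.curve i t).im) (deriv (b.curve i) t).im t :=
  Complex.imCLM.hasFDerivAt.comp_hasDerivAt t (b.hasDerivAt_curve i t)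

theorem exists_mem_Ico_curve_eq {z : ℂ} (hz : z ∈ frontier D) :
    ∃ i, ∃ t ∈ Set.Ico (0 : ℝ) 1, b.curve i t = z := by
  rw [b.frontier_eq] at hz
  obtain ⟨i, s, rfl⟩ := Set.mem_iUnion.1 hz
  obtain ⟨t, ht, hst⟩ := (b.periodic i).exists_mem_Ico₀ one_pos s
  exact ⟨i, t, ht, hst.symm⟩

/-- The integral of a derivative along a horizontal slice of `D` at a regular height. -/
theorem integral_slice (hD : IsOpen D) (hbd : Bornology.IsBounded D) {F : ℂ → ℝ}
    (hF : ContDiff ℝ 1 F) (hFc : HasCompactSupport F) {h : ℝ}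
    (hfin : ∀ i, {t ∈ Set.Ico (0 : ℝ) 1 | (b.curve i t).im = h}.Finite)
    (hreg : ∀ i, ∀ t ∈ Set.Ico (0 : ℝ) 1, (b.curve i t).im = h → (deriv (b.curve i) t).im ≠ 0) :
    ∫ x : ℝ, D.indicator (fun z => fderiv ℝ F z 1) ⟨x, h⟩ =
      ∑ i, ∑' t : {t ∈ Set.Ico (0 : ℝ) 1 | (b.curve i t).im = h},
        F (b.curve i t) * ((SignType.sign (deriv (b.curve i) t).im : SignType) : ℝ) := by
  have : ∀ i, Finite {t ∈ Set.Ico (0 : ℝ) 1 | (b.curve i t).im = h} := fun i => (hfin i).to_subtype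
  have : ∀ i, Fintype {t ∈ Set.Ico (0 : ℝ) 1 | (b.curve i t).im = h} := fun i => Fintype.ofFinite _
  let ι := Σ i, {t ∈ Set.Ico (0 : ℝ) 1 | (b.curve i t).im = h}
  let X : ι → ℝ := fun j => (b.curve j.1 j.2).re
  let σ : ι → ℝ := fun j => ((SignType.sign (deriv (b.curve j.1) j.2).im : SignType) : ℝ)
  let E : Set ℝ := {x | (⟨x, h⟩ : ℂ) ∈ D}
  have hcont : Continuous fun x : ℝ => (⟨x, h⟩ : ℂ) := by
    have : (fun x : ℝ => (⟨x, h⟩ : ℂ)) = fun x : ℝ => (x : ℂ) + (h : ℂ) * Complex.I := by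
      ext x; exact Complex.mk_eq_add_mul_I x h
    rw [this]; fun_prop
  have hpt : ∀ j : ι, (⟨X j, h⟩ : ℂ) = b.curve j.1 j.2 := fun j =>
    Complex.ext rfl j.2.2.2.symm
  -- All crossings have height `h`, so equal abscissas mean equal boundary points; simplicity and
  -- disjointness of the curves then identify the parameters.
  have hX : Function.Injective X := by
    intro j k hjk
    have hc : b.curve j.1 j.2 = b.curve k.1 k.2 := by rw [← hpt j, ← hpt k, hjk]
    obtain ⟨i, t, ht⟩ := j
    obtain ⟨i', t', ht'⟩ := k
    by_cases hi : i = i'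
    · subst hi
      have : t = t' := b.simple i ht.1 ht'.1 hc
      subst this
      rfl
    · exact absurd (show b.curve i' t' = b.curve i t from hc.symm) fun hcc =>
        Set.disjoint_left.1 (b.disjoint i i' hi) ⟨t, rfl⟩ ⟨t', hcc⟩
  have hE : IsOpen E := hD.preimage hcont
  obtain ⟨R, hR⟩ := hbd.subset_ball 0
  have hER : ∀ x ∈ E, -R ≤ x := by
    intro x hx
    have h1 : ‖(⟨x, h⟩ : ℂ)‖ < R := by simpa using hR hx
    have h2 := (Complex.abs_re_le_norm (⟨x, h⟩ : ℂ))
    have h3 : |x| ≤ R := h2.trans h1.le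
    exact (abs_le.1 h3).1
  have hoff : ∀ x ∉ Set.range X, ∀ᶠ y in 𝓝 x, (y ∈ E ↔ x ∈ E) := by
    intro x hx
    have hnf : (⟨x, h⟩ : ℂ) ∉ frontier D := by
      intro hfr
      obtain ⟨i, t, ht, hti⟩ := b.exists_mem_Ico_curve_eq hfr
      exact hx ⟨⟨i, t, ht, by rw [hti]⟩, by simp only [X, hti]⟩
    by_cases hxD : (⟨x, h⟩ : ℂ) ∈ D
    · filter_upwards [hE.mem_nhds hxD] with y hy
      exact ⟨fun _ => hxD, fun _ => hy⟩
    · have hcl : (⟨x, h⟩ : ℂ) ∈ (closure D)ᶜ := fun hcl =>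
        hnf ⟨hcl, by rwa [hD.interior_eq]⟩
      filter_upwards [(isClosed_closure.isOpen_compl.preimage hcont).mem_nhds hcl] with y hy
      exact ⟨fun hyE => absurd (subset_closure (show (⟨y, h⟩ : ℂ) ∈ D from hyE)) hy, fun hxE => absurd hxE hxD⟩
  have hR1 : ∀ (x₀ : ℝ) (p : ℝ → Prop), (∀ᶠ ε : ℝ in 𝓝[>] 0, p (x₀ + ε)) →
      ∀ᶠ y in 𝓝[>] x₀, p y := by
    intro x₀ p hp
    have ht : Tendsto (fun y => y - x₀) (𝓝[>] x₀) (𝓝[>] 0) := by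
      refine tendsto_nhdsWithin_iff.2 ⟨?_, ?_⟩
      · have : Continuous fun y : ℝ => y - x₀ := by fun_prop
        simpa using (this.tendsto x₀).mono_left nhdsWithin_le_nhds
      · filter_upwards [self_mem_nhdsWithin] with y hy
        simpa using hy
    filter_upwards [ht.eventually hp] with y hy
    simpa using hy
  have hL1 : ∀ (x₀ : ℝ) (p : ℝ → Prop), (∀ᶠ ε : ℝ in 𝓝[>] 0, p (x₀ - ε)) →
      ∀ᶠ y in 𝓝[<] x₀, p y := by
    intro x₀ p hp
    have ht : Tendsto (fun y => x₀ - y) (𝓝[<] x₀) (𝓝[>] 0) := by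
      refine tendsto_nhdsWithin_iff.2 ⟨?_, ?_⟩
      · have : Continuous fun y : ℝ => x₀ - y := by fun_prop
        simpa using (this.tendsto x₀).mono_left nhdsWithin_le_nhds
      · filter_upwards [self_mem_nhdsWithin] with y hy
        simpa using hy
    filter_upwards [ht.eventually hp] with y hy
    simpa using hy
  have hadd : ∀ (j : ι) (ε : ℝ), (⟨X j + ε, h⟩ : ℂ) = b.curve j.1 j.2 + ε := by
    intro j ε
    rw [← hpt j]
    apply Complex.ext <;> simp
  have hsub : ∀ (j : ι) (ε : ℝ), (⟨X j - ε, h⟩ : ℂ) = b.curve j.1 j.2 - ε := by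
    intro j ε
    rw [← hpt j]
    apply Complex.ext <;> simp
  -- The direction `1` points to the left of a tangent `d` exactly when `d.im < 0`. Hence a
  -- horizontal line run from left to right leaves `D` at an upward crossing and enters it at a
  -- downward one.
  have hjump : ∀ j, (σ j = 1 ∧ (∀ᶠ y in 𝓝[<] X j, y ∈ E) ∧ ∀ᶠ y in 𝓝[>] X j, y ∉ E) ∨
      (σ j = -1 ∧ (∀ᶠ y in 𝓝[<] X j, y ∉ E) ∧ ∀ᶠ y in 𝓝[>] X j, y ∈ E) := by
    intro j
    rcases lt_or_gt_of_ne (hreg j.1 j.2 j.2.2.1 j.2.2.2) with hneg | hpos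
    · right
      obtain ⟨h1, h2⟩ := b.eventually_smul_mem hD j.1 j.2 (v := 1) (by simpa using hneg)
      refine ⟨by simp [σ, sign_neg hneg], hL1 _ _ (h2.mono fun ε hε => ?_),
        hR1 _ _ (h1.mono fun ε hε => ?_)⟩
      · simp only [E, Set.mem_ofPred_eq, hsub]; simpa using hε
      · simp only [E, Set.mem_ofPred_eq, hadd]; simpa using hε
    · left
      obtain ⟨h1, h2⟩ := b.eventually_smul_mem hD j.1 j.2 (v := -1) (by simpa using hpos)
      refine ⟨by simp [σ, sign_pos hpos], hL1 _ _ (h1.mono fun ε hε => ?_),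
        hR1 _ _ (h2.mono fun ε hε => ?_)⟩
      · simp only [E, Set.mem_ofPred_eq, hsub]; simpa [sub_eq_add_neg] using hε
      · simp only [E, Set.mem_ofPred_eq, hadd]; simpa using hε
  have hline : ∀ x : ℝ, HasDerivAt (fun x : ℝ => (⟨x, h⟩ : ℂ)) 1 x := by
    intro x
    have : (fun x : ℝ => (⟨x, h⟩ : ℂ)) = fun x : ℝ => (x : ℂ) + (h : ℂ) * Complex.I := by
      ext x; exact Complex.mk_eq_add_mul_I x h
    rw [this]
    exact (Complex.ofRealCLM.hasDerivAt (x := x)).add_const _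
  let G : ℝ → ℝ := fun x => F ⟨x, h⟩
  have hGd : ∀ x, deriv G x = fderiv ℝ F ⟨x, h⟩ 1 := fun x =>
    ((hF.differentiable one_ne_zero _).hasFDerivAt.comp_hasDerivAt x (hline x)).deriv
  have hG : ContDiff ℝ 1 G := by
    refine hF.comp ?_
    have : (fun x : ℝ => (⟨x, h⟩ : ℂ)) = fun x : ℝ => Complex.ofRealCLM x + (h : ℂ) * Complex.I := by
      ext x; exact Complex.mk_eq_add_mul_I x h
    rw [this]
    fun_prop
  have hGc : HasCompactSupport G := by
    obtain ⟨B, hB⟩ := hFc.isBounded.subset_ball 0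
    refine HasCompactSupport.of_support_subset_isCompact (isCompact_Icc (a := -B) (b := B)) ?_
    intro x hx
    have h1 : ‖(⟨x, h⟩ : ℂ)‖ < B := by simpa using hB (subset_tsupport _ hx)
    exact abs_le.1 ((Complex.abs_re_le_norm (⟨x, h⟩ : ℂ)).trans h1.le)
  have hkey := setIntegral_deriv_eq_sum_jumps hX hE.measurableSet hER hoff hjump hG hGc
  rw [← integral_indicator hE.measurableSet] at hkey
  have e1 : ∫ x : ℝ, D.indicator (fun z => fderiv ℝ F z 1) ⟨x, h⟩ =
      ∫ x, E.indicator (deriv G) x := by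
    refine integral_congr_ae (ae_of_all _ fun x => ?_)
    by_cases hx : (⟨x, h⟩ : ℂ) ∈ D
    · have hx' : x ∈ E := hx
      simp [hx, hx', hGd]
    · have hx' : x ∉ E := hx
      simp [hx, hx']
  rw [e1, hkey, Fintype.sum_sigma]
  refine Finset.sum_congr rfl fun i _ => ?_
  rw [tsum_fintype]
  refine Finset.sum_congr rfl fun t _ => ?_
  rw [mul_comm]
  simp only [G, hpt, σ]

/-- The `dy` half of Green's theorem. Writing `F y' = (F sign y') |y'|`, the area formula for the
height function turns each curve integral into an integral over heights of signed crossing sums.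
`integral_slice` evaluates these at almost every height, and Fubini reassembles the area integral.
-/
theorem sum_integral_mul_im_deriv (hD : IsOpen D) (hbd : Bornology.IsBounded D) {F : ℂ → ℝ}
    (hF : ContDiff ℝ 1 F) (hFc : HasCompactSupport F) :
    ∑ i, ∫ t in (0 : ℝ)..1, F (b.curve i t) * (deriv (b.curve i) t).im =
      ∫ z in D, fderiv ℝ F z 1 := by
  obtain ⟨C, hC⟩ := hFc.exists_bound_of_continuous hF.continuous
  let p : Fin b.n → ℝ → ℝ := fun i t =>
    F (b.curve i t) * ((SignType.sign (deriv (b.curve i) t).im : SignType) : ℝ)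
  have hpm : ∀ i, Measurable (p i) := by
    intro i
    refine ((hF.continuous.comp (b.continuous_curve i)).measurable).mul ?_
    have h1 : Measurable fun t => (deriv (b.curve i) t).im :=
      Complex.measurable_im.comp (b.continuous_deriv_curve i).measurable
    have h2 : (fun t => ((SignType.sign (deriv (b.curve i) t).im : SignType) : ℝ)) = fun t =>
        if 0 < (deriv (b.curve i) t).im then (1 : ℝ) else
          if (deriv (b.curve i) t).im < 0 then -1 else 0 := by
      ext t
      rw [sign_apply]
      split_ifs <;> simp
    rw [h2]
    exact Measurable.ite (measurableSet_lt measurable_const h1) measurable_const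
      (Measurable.ite (measurableSet_lt h1 measurable_const) measurable_const measurable_const)
  have hpC : ∀ i t, |p i t| ≤ C := by
    intro i t
    have h1 : |((SignType.sign (deriv (b.curve i) t).im : SignType) : ℝ)| ≤ 1 := by
      rcases SignType.sign (deriv (b.curve i) t).im with _ | _ | _ <;> simp
    simp only [p, abs_mul]
    calc _ ≤ |F (b.curve i t)| * 1 := by gcongr
      _ ≤ C := by simpa using hC _
  have key := fun i => integral_mul_abs_deriv (b.hasDerivAt_im_curve i)
    (Complex.continuous_im.comp (b.continuous_deriv_curve i)) (hpm i) (hpC i)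
    (s := Set.Ico 0 1) measurableSet_Ico Set.Ico_subset_Icc_self
  have hL : ∀ i, ∫ t in (0 : ℝ)..1, F (b.curve i t) * (deriv (b.curve i) t).im =
      ∫ h, ∑' t : {t ∈ Set.Ico (0 : ℝ) 1 | (b.curve i t).im = h}, p i t := by
    intro i
    rw [← (key i).2.2, intervalIntegral.integral_of_le zero_le_one, integral_Ico_eq_integral_Ioc]
    refine integral_congr_ae (ae_of_all _ fun t => ?_)
    simp only [p, mul_assoc, sign_mul_abs]
  have hdc : Continuous fun z => fderiv ℝ F z 1 :=
    (hF.continuous_fderiv one_ne_zero).clm_apply continuous_const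
  have hint : Integrable (D.indicator fun z => fderiv ℝ F z 1) := by
    refine Integrable.indicator (hdc.integrable_of_hasCompactSupport ?_) hD.measurableSet
    exact (hFc.fderiv ℝ).comp_left (g := fun L : ℂ →L[ℝ] ℝ => L 1) (by simp)
  have hmp := Complex.volume_preserving_equiv_real_prod.symm Complex.measurableEquivRealProd
  rw [Finset.sum_congr rfl fun i _ => hL i, ← integral_finsetSum _ fun i _ => (key i).2.1,
    ← integral_indicator hD.measurableSet,
    ← hmp.integral_comp' (g := D.indicator fun z => fderiv ℝ F z 1)]
  rw [show (volume : Measure (ℝ × ℝ)) = volume.prod volume from rfl, integral_prod_symm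
    (fun x => D.indicator (fun z => fderiv ℝ F z 1) (Complex.measurableEquivRealProd.symm x))
    ((hmp.integrable_comp_emb Complex.measurableEquivRealProd.symm.measurableEmbedding).2 hint)]
  refine integral_congr_ae ?_
  have hae : ∀ᵐ h : ℝ, ∀ i, {t ∈ Set.Ico (0 : ℝ) 1 | (b.curve i t).im = h}.Finite ∧
      ∀ t ∈ Set.Ico (0 : ℝ) 1, (b.curve i t).im = h → (deriv (b.curve i) t).im ≠ 0 :=
    ae_all_iff.2 fun i => (key i).1
  filter_upwards [hae] with h hh
  simp only [Complex.measurableEquivRealProd_symm_apply]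
  rw [b.integral_slice hD hbd hF hFc (fun i => (hh i).1) fun i => (hh i).2]

/-- The boundary of `D`, rotated by a quarter turn clockwise. -/
def rotate : SmoothBoundary {w : ℂ | Complex.I * w ∈ D} where
  n := b.n
  curve i t := -Complex.I * b.curve i t
  smooth i := contDiff_const.mul (b.smooth i)
  periodic i t := by simp only [b.periodic i t]
  regular i t := by
    rw [deriv_const_mul _ (b.hasDerivAt_curve i t).differentiableAt]
    exact mul_ne_zero (by simp) (b.regular i t)
  simple i s hs t ht hst := b.simple i hs ht (mul_left_cancel₀ (by simp) hst)
  disjoint i j hij := by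
    rw [Set.disjoint_left]
    rintro _ ⟨s, rfl⟩ ⟨t, ht⟩
    exact Set.disjoint_left.1 (b.disjoint i j hij) ⟨s, rfl⟩
      ⟨t, mul_left_cancel₀ (by simp) ht⟩
  frontier_eq := by
    have h1 : {w : ℂ | Complex.I * w ∈ D} = Homeomorph.mulLeft₀ Complex.I Complex.I_ne_zero ⁻¹' D :=
      rfl
    rw [h1, ← Homeomorph.preimage_frontier, b.frontier_eq]
    ext w
    simp only [Set.mem_preimage, Set.mem_iUnion, Set.mem_range, Homeomorph.coe_mulLeft₀]
    refine exists_congr fun i => exists_congr fun t => ?_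
    constructor
    · intro h; rw [h, ← mul_assoc]; simp
    · intro h; rw [← h, ← mul_assoc]; simp
  left_mem i t := by
    rw [deriv_const_mul _ (b.hasDerivAt_curve i t).differentiableAt]
    filter_upwards [b.left_mem i t] with ε hε
    convert hε using 1
    linear_combination (-b.curve i t - ε * Complex.I * deriv (b.curve i) t) * Complex.I_mul_I
  right_notMem i t := by
    rw [deriv_const_mul _ (b.hasDerivAt_curve i t).differentiableAt]
    filter_upwards [b.right_notMem i t] with ε hε
    convert hε using 2
    linear_combination (-b.curve i t + ε * Complex.I * deriv (b.curve i) t) * Complex.I_mul_I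

/-- The `dx` half is the `dy` half for `w ↦ F (I * w)` on the rotated domain: the rotated tangent
`-I * d` has imaginary part `-d.re`, and rotation preserves area. -/
theorem sum_integral_mul_re_deriv (hD : IsOpen D) (hbd : Bornology.IsBounded D) {F : ℂ → ℝ}
    (hF : ContDiff ℝ 1 F) (hFc : HasCompactSupport F) :
    ∑ i, ∫ t in (0 : ℝ)..1, F (b.curve i t) * (deriv (b.curve i) t).re =
      -∫ z in D, fderiv ℝ F z Complex.I := by
  let e : ℂ ≃ₜ ℂ := Homeomorph.mulLeft₀ Complex.I Complex.I_ne_zero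
  have hlin : ∀ z, HasFDerivAt (𝕜 := ℝ) (fun w : ℂ => Complex.I * w)
      (Complex.I • (ContinuousLinearMap.id ℝ ℂ)) z := fun z =>
    (hasFDerivAt_id z).const_mul Complex.I
  have hbd' : Bornology.IsBounded {w : ℂ | Complex.I * w ∈ D} := by
    obtain ⟨R, hR⟩ := hbd.subset_ball 0
    refine Metric.isBounded_ball (x := (0 : ℂ)) (r := R) |>.subset fun w hw => ?_
    simpa using hR hw
  have hmul : ContDiff ℝ 1 fun w : ℂ => Complex.I * w := contDiff_const.mul contDiff_id
  have key := b.rotate.sum_integral_mul_im_deriv (hD.preimage e.continuous) hbd'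
    (hF.comp hmul) (hFc.comp_homeomorph e)
  have h1 : ∀ i t, deriv (b.rotate.curve i) t = -Complex.I * deriv (b.curve i) t := fun i t =>
    deriv_const_mul _ (b.hasDerivAt_curve i t).differentiableAt
  have h2 : ∀ i t, Complex.I * b.rotate.curve i t = b.curve i t := fun i t => by
    change Complex.I * (-Complex.I * b.curve i t) = _
    rw [← mul_assoc]; simp
  have hmp : MeasurePreserving (fun w : ℂ => Complex.I * w) := by
    let R : ℂ ≃ₗᵢ[ℝ] ℂ := rotation ⟨Complex.I, mem_sphere_zero_iff_norm.2 (by simp)⟩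
    exact R.measurePreserving
  have h3 : ∫ w in {w : ℂ | Complex.I * w ∈ D}, fderiv ℝ (F ∘ fun w : ℂ => Complex.I * w) w 1 =
      ∫ z in D, fderiv ℝ F z Complex.I := by
    refine Eq.trans ?_ (hmp.setIntegral_preimage_emb e.measurableEmbedding
      (fun z => fderiv ℝ F z Complex.I) D)
    refine integral_congr_ae (ae_of_all _ fun w => ?_)
    have h4 : HasFDerivAt F (fderiv ℝ F (Complex.I * w)) (Complex.I * w) :=
      (hF.differentiable one_ne_zero _).hasFDerivAt
    have h5 := (h4.comp w (hlin w)).fderiv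
    simp [h5]
  rw [h3] at key
  rw [← key, ← Finset.sum_neg_distrib]
  refine Finset.sum_congr rfl fun i _ => ?_
  rw [← intervalIntegral.integral_neg]
  refine intervalIntegral.integral_congr fun t _ => ?_
  have e1 : deriv (b.rotate.curve i) t = -Complex.I * deriv (b.curve i) t := h1 i t
  have e2 : Complex.I * b.rotate.curve i t = b.curve i t := h2 i t
  simp only [Function.comp_apply]
  erw [e1, e2]
  simp

/-- Green's theorem for continuously differentiable functions of compact support. -/
theorem contourIntegral_eq_of_hasCompactSupport (hD : IsOpen D) (hbd : Bornology.IsBounded D)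
    {F : ℂ → ℂ} (hF : ContDiff ℝ 1 F) (hFc : HasCompactSupport F) :
    b.contourIntegral F = ∫ z in D, (Complex.I * fderiv ℝ F z 1 - fderiv ℝ F z Complex.I) := by
  have hU : ContDiff ℝ 1 fun z => (F z).re := Complex.reCLM.contDiff.comp hF
  have hV : ContDiff ℝ 1 fun z => (F z).im := Complex.imCLM.contDiff.comp hF
  have hUc : HasCompactSupport fun z => (F z).re := hFc.comp_left (g := Complex.re) rfl
  have hVc : HasCompactSupport fun z => (F z).im := hFc.comp_left (g := Complex.im) rfl
  have hdU : ∀ z v, fderiv ℝ (fun z => (F z).re) z v = (fderiv ℝ F z v).re := fun z v => by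
    exact congrArg (fun L : ℂ →L[ℝ] ℝ => L v)
      (Complex.reCLM.hasFDerivAt.comp z (hF.differentiable one_ne_zero z).hasFDerivAt).fderiv
  have hdV : ∀ z v, fderiv ℝ (fun z => (F z).im) z v = (fderiv ℝ F z v).im := fun z v => by
    exact congrArg (fun L : ℂ →L[ℝ] ℝ => L v)
      (Complex.imCLM.hasFDerivAt.comp z (hF.differentiable one_ne_zero z).hasFDerivAt).fderiv
  have a1 := b.sum_integral_mul_im_deriv hD hbd hU hUc
  have a2 := b.sum_integral_mul_im_deriv hD hbd hV hVc
  have a3 := b.sum_integral_mul_re_deriv hD hbd hU hUc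
  have a4 := b.sum_integral_mul_re_deriv hD hbd hV hVc
  simp only [hdU, hdV] at a1 a2 a3 a4
  have hint : ∀ v, Integrable (fun z => fderiv ℝ F z v) (volume.restrict D) := fun v => by
    refine (((hF.continuous_fderiv one_ne_zero).clm_apply
      continuous_const).integrable_of_hasCompactSupport ?_).integrableOn
    exact (hFc.fderiv ℝ).comp_left (g := fun L : ℂ →L[ℝ] ℂ => L v) (by simp)
  have hintre : ∀ v, Integrable (fun z => (fderiv ℝ F z v).re) (volume.restrict D) :=
    fun v => (hint v).re
  have hintim : ∀ v, Integrable (fun z => (fderiv ℝ F z v).im) (volume.restrict D) :=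
    fun v => (hint v).im
  have hcF : ∀ i, Continuous fun t => F (b.curve i t) := fun i =>
    hF.continuous.comp (b.continuous_curve i)
  have hci : ∀ i, Continuous fun t => F (b.curve i t) * deriv (b.curve i) t := fun i =>
    (hcF i).mul (b.continuous_deriv_curve i)
  have hre : ∀ i, Continuous fun t => (deriv (b.curve i) t).re := fun i =>
    Complex.continuous_re.comp (b.continuous_deriv_curve i)
  have him : ∀ i, Continuous fun t => (deriv (b.curve i) t).im := fun i =>
    Complex.continuous_im.comp (b.continuous_deriv_curve i)
  have hFre : ∀ i, Continuous fun t => (F (b.curve i t)).re := fun i =>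
    Complex.continuous_re.comp (hcF i)
  have hFim : ∀ i, Continuous fun t => (F (b.curve i t)).im := fun i =>
    Complex.continuous_im.comp (hcF i)
  have hintR : Integrable (fun z => Complex.I * fderiv ℝ F z 1 - fderiv ℝ F z Complex.I)
    (volume.restrict D) := ((hint 1).const_mul _).sub (hint _)
  have hmulint : ∀ f g : ℝ → ℝ, Continuous f → Continuous g →
      IntervalIntegrable (fun t => f t * g t) volume 0 1 := fun f g hf hg =>
    (hf.mul hg).intervalIntegrable 0 1
  have lre : ∀ f : ℝ → ℂ, Continuous f →
      (∫ t in (0 : ℝ)..1, f t).re = ∫ t in (0 : ℝ)..1, (f t).re := fun f hf =>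
    (Complex.reCLM.intervalIntegral_comp_comm (hf.intervalIntegrable 0 1)).symm
  have lim : ∀ f : ℝ → ℂ, Continuous f →
      (∫ t in (0 : ℝ)..1, f t).im = ∫ t in (0 : ℝ)..1, (f t).im := fun f hf =>
    (Complex.imCLM.intervalIntegral_comp_comm (hf.intervalIntegrable 0 1)).symm
  have rre : ∀ f : ℂ → ℂ, Integrable f (volume.restrict D) →
      (∫ z in D, f z).re = ∫ z in D, (f z).re := fun f hf =>
    (Complex.reCLM.integral_comp_comm hf).symm
  have rim : ∀ f : ℂ → ℂ, Integrable f (volume.restrict D) →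
      (∫ z in D, f z).im = ∫ z in D, (f z).im := fun f hf =>
    (Complex.imCLM.integral_comp_comm hf).symm
  apply Complex.ext
  · rw [contourIntegral, Complex.re_sum, rre _ hintR]
    simp only [lre _ (hci _), Complex.mul_re, Complex.sub_re, Complex.I_re, Complex.I_im, zero_mul,
      one_mul, zero_sub]
    rw [integral_sub (hintim 1).fun_neg (hintre _), integral_neg, ← a2, ← neg_eq_iff_eq_neg.2 a3,
      sub_neg_eq_add, ← Finset.sum_neg_distrib, ← Finset.sum_add_distrib]
    refine Finset.sum_congr rfl fun i _ => ?_
    rw [intervalIntegral.integral_sub (hmulint _ _ (hFre i) (hre i))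
      (hmulint _ _ (hFim i) (him i))]
    ring
  · rw [contourIntegral, Complex.im_sum, rim _ hintR]
    simp only [lim _ (hci _), Complex.mul_im, Complex.sub_im, Complex.I_re, Complex.I_im, zero_mul,
      one_mul, zero_add]
    rw [integral_sub (hintre 1) (hintim _), ← a1, ← neg_eq_iff_eq_neg.2 a4, sub_neg_eq_add,
      ← Finset.sum_add_distrib]
    refine Finset.sum_congr rfl fun i _ => ?_
    rw [intervalIntegral.integral_add (hmulint _ _ (hFre i) (him i))
      (hmulint _ _ (hFim i) (hre i))]

/-- Green's theorem on a domain whose closure lies in the open unit disk. -/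
theorem contourIntegral_eq (hD : IsOpen D) (hcl : closure D ⊆ Metric.ball 0 1)
    {F : ℂ → ℂ} (hF : ContDiffOn ℝ 1 F (Metric.ball 0 1)) :
    b.contourIntegral F = ∫ z in D, (Complex.I * fderiv ℝ F z 1 - fderiv ℝ F z Complex.I) := by
  have hbd : Bornology.IsBounded D :=
    Metric.isBounded_ball.subset (subset_closure.trans hcl)
  obtain ⟨ρ, hρ1, hρ⟩ : ∃ ρ < 1, closure D ⊆ Metric.closedBall 0 ρ := by
    have hc : IsCompact (closure D) := hbd.isCompact_closure
    obtain ⟨r, hr, hr'⟩ := exists_lt_subset_ball isClosed_closure hcl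
    exact ⟨r, hr, hr'.trans Metric.ball_subset_closedBall⟩
  -- The radius `ρ` may fail to be positive; the maximum keeps the bump radii below positive and
  -- smaller than 1.
  set r₁ := max ρ (1 / 2) with hr₁
  have hr₁1 : r₁ < 1 := max_lt hρ1 (by norm_num)
  have hr₁0 : 0 < r₁ := lt_of_lt_of_le (by norm_num) (le_max_right _ _)
  -- A cutoff equal to 1 near `closure D` and supported inside the disk. It makes `F` globally `C¹`
  -- with compact support and changes neither side of the identity.
  let χ : ContDiffBump (0 : ℂ) := ⟨(1 + r₁) / 2, (3 + r₁) / 4, by linarith, by linarith⟩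
  have hχ1 : ∀ z ∈ closure D, χ =ᶠ[𝓝 z] 1 := by
    intro z hz
    refine χ.eventuallyEq_one_of_mem_ball ?_
    have h1 := hρ hz
    have h2 : ρ ≤ r₁ := le_max_left _ _
    simp only [Metric.mem_closedBall, Metric.mem_ball] at h1 ⊢
    change dist z 0 < (1 + r₁) / 2
    linarith
  let Fχ : ℂ → ℂ := fun z => χ z • F z
  have hEq : ∀ z ∈ closure D, Fχ =ᶠ[𝓝 z] F := fun z hz =>
    (hχ1 z hz).mono fun w hw => by simp [Fχ, hw]
  have hsm : ContDiff ℝ 1 Fχ := by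
    rw [contDiff_iff_contDiffAt]
    intro z
    by_cases hz : z ∈ Metric.ball (0 : ℂ) 1
    · exact (χ.contDiff.contDiffAt).smul (hF.contDiffAt (Metric.isOpen_ball.mem_nhds hz))
    · have hz' : z ∉ tsupport χ := by
        rw [χ.tsupport_eq]
        intro h
        have h1 : dist z 0 ≤ (3 + r₁) / 4 := h
        exact hz (by simp only [Metric.mem_ball]; linarith)
      have : Fχ =ᶠ[𝓝 z] fun _ => 0 := by
        filter_upwards [notMem_tsupport_iff_eventuallyEq.1 hz'] with w hw
        simp [Fχ, hw]
      exact contDiffAt_const.congr_of_eventuallyEq this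
  have hc : HasCompactSupport Fχ := χ.hasCompactSupport.smul_right
  have key := b.contourIntegral_eq_of_hasCompactSupport hD hbd hsm hc
  have e1 : b.contourIntegral Fχ = b.contourIntegral F := by
    refine Finset.sum_congr rfl fun i _ => ?_
    refine intervalIntegral.integral_congr fun t _ => ?_
    have := (hEq _ (frontier_subset_closure (b.curve_mem_frontier i t))).eq_of_nhds
    simp only [this]
  rw [← e1, key]
  refine setIntegral_congr_fun hD.measurableSet fun z hz => ?_
  simp only [(hEq z (subset_closure hz)).fderiv_eq]

end SmoothBoundary

/-! ### Power series on the unit disk -/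

theorem summable_norm_mul_pow {a : ℕ → ℂ}
    (ha : ∀ z ∈ Metric.ball (0 : ℂ) 1, Summable fun k => a k * z ^ k) {r : ℝ} (hr0 : 0 ≤ r)
    (hr : r < 1) : Summable fun k => ‖a k‖ * r ^ k := by
  have := (ha (r : ℂ) (by simpa [abs_of_nonneg hr0] using hr)).norm
  simpa [abs_of_nonneg hr0] using this

theorem hasDerivAt_tsum_mul_pow {a : ℕ → ℂ}
    (ha : ∀ z ∈ Metric.ball (0 : ℂ) 1, Summable fun k => a k * z ^ k) {z : ℂ}
    (hz : z ∈ Metric.ball (0 : ℂ) 1) :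
    Summable (fun k : ℕ => a k * (k * z ^ (k - 1))) ∧
      HasDerivAt (fun z => ∑' k, a k * z ^ k) (∑' k : ℕ, a k * (k * z ^ (k - 1))) z := by
  have hz1 : ‖z‖ < 1 := by simpa using hz
  set r := (1 + ‖z‖) / 2 with hr
  have hr1 : r < 1 := by rw [hr]; linarith
  have hr0 : 0 ≤ r := by positivity
  have hzr : z ∈ Metric.ball (0 : ℂ) r := by simp only [mem_ball_zero_iff, hr]; linarith
  have hu := summable_norm_mul_pow ha hr0 hr1
  have hd : ∀ (k : ℕ) (w : ℂ), HasDerivAt (fun w => a k * w ^ k) (a k * (k * w ^ (k - 1))) w :=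
    fun k w => (hasDerivAt_pow k w).const_mul _
  have hF : ∀ k : ℕ, DifferentiableOn ℂ (fun w => a k * w ^ k) (Metric.ball 0 r) := fun k w _ =>
    (hd k w).differentiableAt.differentiableWithinAt
  have hb : ∀ (k : ℕ) (w : ℂ), w ∈ Metric.ball (0 : ℂ) r → ‖a k * w ^ k‖ ≤ ‖a k‖ * r ^ k := by
    intro k w hw
    rw [norm_mul, norm_pow]
    have : ‖w‖ ≤ r := by simpa using (Metric.mem_ball.1 hw).le
    gcongr
  have h1 := Complex.hasSum_deriv_of_summable_norm hu hF Metric.isOpen_ball hb hzr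
  have h2 := Complex.differentiableOn_tsum_of_summable_norm hu hF Metric.isOpen_ball hb
  simp only [(hd _ z).deriv] at h1
  refine ⟨h1.summable, ?_⟩
  rw [h1.tsum_eq]
  exact (h2.differentiableAt (Metric.isOpen_ball.mem_nhds hzr)).hasDerivAt

theorem summable_mul_pow_of_bounded {a : ℕ → ℂ} {C : ℝ} (ha : ∀ k, ‖a k‖ ≤ C) {z : ℂ}
    (hz : z ∈ Metric.ball (0 : ℂ) 1) : Summable fun k => a k * z ^ k := by
  have hz1 : ‖z‖ < 1 := by simpa using hz
  refine Summable.of_norm_bounded (g := fun k => C * ‖z‖ ^ k)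
    ((summable_geometric_of_lt_one (norm_nonneg z) hz1).mul_left C) fun k => ?_
  rw [norm_mul, norm_pow]
  gcongr
  exact ha k

theorem summable_norm_pow {z : ℂ} (hz : z ∈ Metric.ball (0 : ℂ) 1) :
    Summable fun k : ℕ => ‖z ^ k‖ := by
  simpa using (summable_mul_pow_of_bounded (a := fun _ => 1) (C := 1) (by simp) hz).norm

theorem summable_norm_deriv_pow {z : ℂ} (hz : z ∈ Metric.ball (0 : ℂ) 1) :
    Summable fun k : ℕ => ‖(k * z ^ (k - 1) : ℂ)‖ := by
  simpa using ((hasDerivAt_tsum_mul_pow (a := fun _ => 1) (fun z hz =>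
    summable_mul_pow_of_bounded (C := 1) (by simp) hz) hz).1).norm

/-! ### Covariances of linear functionals of a sequence -/

/-- The sesquilinear form `∑ u_k conj(v_l) Γ(k,l)`. -/
noncomputable def covSum (Γ : ℕ → ℕ → ℂ) (u v : ℕ → ℂ) : ℂ :=
  ∑' p : ℕ × ℕ, u p.1 * conj (v p.2) * Γ p.1 p.2

section CovSum

variable {Γ : ℕ → ℕ → ℂ} {C : ℝ}

theorem summable_covSum (hΓ : ∀ k l, ‖Γ k l‖ ≤ C) {u v : ℕ → ℂ} (hu : Summable fun k => ‖u k‖)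
    (hv : Summable fun k => ‖v k‖) :
    Summable fun p : ℕ × ℕ => u p.1 * conj (v p.2) * Γ p.1 p.2 := by
  have h := hu.mul_of_nonneg hv (fun _ => norm_nonneg _) fun _ => norm_nonneg _
  refine Summable.of_norm_bounded (h.mul_right C) fun p => ?_
  rw [norm_mul, norm_mul, Complex.norm_conj]
  exact mul_le_mul_of_nonneg_left (hΓ _ _) (by positivity)

theorem covSum_eq_tsum_tsum (hΓ : ∀ k l, ‖Γ k l‖ ≤ C) {u v : ℕ → ℂ}
    (hu : Summable fun k => ‖u k‖) (hv : Summable fun k => ‖v k‖) :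
    covSum Γ u v = ∑' k, (∑' l, conj (v l) * Γ k l) * u k := by
  rw [covSum, (summable_covSum hΓ hu hv).tsum_prod]
  refine tsum_congr fun k => ?_
  rw [mul_comm, ← tsum_mul_left]
  exact tsum_congr fun l => by ring

theorem norm_tsum_le_of_bounded (hΓ : ∀ k l, ‖Γ k l‖ ≤ C) {v : ℕ → ℂ}
    (hv : Summable fun k => ‖v k‖) (k : ℕ) :
    ‖∑' l, conj (v l) * Γ k l‖ ≤ (∑' l, ‖v l‖) * C := by
  rw [← tsum_mul_right]
  refine tsum_of_norm_bounded (hv.mul_right C).hasSum fun l => ?_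
  rw [norm_mul, Complex.norm_conj]
  exact mul_le_mul_of_nonneg_left (hΓ _ _) (norm_nonneg _)

/-- Differentiation of the covariance of a power series with a fixed functional. -/
theorem hasDerivAt_covSum_pow (hΓ : ∀ k l, ‖Γ k l‖ ≤ C) {v : ℕ → ℂ}
    (hv : Summable fun k => ‖v k‖) {z : ℂ} (hz : z ∈ Metric.ball (0 : ℂ) 1) :
    HasDerivAt (fun z => covSum Γ (fun k => z ^ k) v)
      (covSum Γ (fun k => k * z ^ (k - 1)) v) z := by
  have h := (hasDerivAt_tsum_mul_pow (a := fun k => ∑' l, conj (v l) * Γ k l) (fun w hw =>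
    summable_mul_pow_of_bounded (norm_tsum_le_of_bounded hΓ hv) hw) hz).2
  rw [covSum_eq_tsum_tsum hΓ (summable_norm_deriv_pow hz) hv]
  refine h.congr_of_eventuallyEq ?_
  filter_upwards [Metric.isOpen_ball.mem_nhds hz] with w hw
  exact covSum_eq_tsum_tsum hΓ (summable_norm_pow hw) hv

theorem covSum_conj_symm (hsym : ∀ k l, conj (Γ k l) = Γ l k) (u v : ℕ → ℂ) :
    conj (covSum Γ u v) = covSum Γ v u := by
  rw [covSum, covSum, Complex.conj_tsum, ← (Equiv.prodComm ℕ ℕ).tsum_eq]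
  refine tsum_congr fun p => ?_
  simp only [Equiv.prodComm_apply, Prod.fst_swap, Prod.snd_swap, map_mul, hsym, Complex.conj_conj]
  ring

theorem covSum_linear_left (hΓ : ∀ k l, ‖Γ k l‖ ≤ C) {u u' v : ℕ → ℂ}
    (hu : Summable fun k => ‖u k‖) (hu' : Summable fun k => ‖u' k‖)
    (hv : Summable fun k => ‖v k‖) (α β : ℂ) :
    covSum Γ (fun k => α * u k + β * u' k) v = α * covSum Γ u v + β * covSum Γ u' v := by
  rw [covSum, covSum, covSum, ← tsum_mul_left, ← tsum_mul_left,
    ← ((summable_covSum hΓ hu hv).mul_left α).tsum_add ((summable_covSum hΓ hu' hv).mul_left β)]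
  exact tsum_congr fun p => by ring

theorem covSum_linear_right (hΓ : ∀ k l, ‖Γ k l‖ ≤ C) {u u' v : ℕ → ℂ}
    (hu : Summable fun k => ‖u k‖) (hu' : Summable fun k => ‖u' k‖)
    (hv : Summable fun k => ‖v k‖) (α β : ℂ) :
    covSum Γ v (fun k => α * u k + β * u' k) =
      conj α * covSum Γ v u + conj β * covSum Γ v u' := by
  rw [covSum, covSum, covSum, ← tsum_mul_left, ← tsum_mul_left,
    ← ((summable_covSum hΓ hv hu).mul_left _).tsum_add ((summable_covSum hΓ hv hu').mul_left _)]
  exact tsum_congr fun p => by simp only [map_add, map_mul]; ring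

/-- Subtracting a rank one part from the covariance. -/
theorem covSum_sub_rankOne (hΓ : ∀ k l, ‖Γ k l‖ ≤ C) {c : ℕ → ℂ} {C' : ℝ} (hc : ∀ k, ‖c k‖ ≤ C')
    {u v : ℕ → ℂ} (hu : Summable fun k => ‖u k‖) (hv : Summable fun k => ‖v k‖) :
    covSum (fun k l => Γ k l - c k * conj (c l)) u v =
      covSum Γ u v - (∑' k, c k * u k) * conj (∑' k, c k * v k) := by
  have hcu : ∀ w : ℕ → ℂ, Summable (fun k => ‖w k‖) → Summable fun k => ‖c k * w k‖ :=
    fun w hw => Summable.of_nonneg_of_le (fun _ => norm_nonneg _)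
      (fun k => by rw [norm_mul]; exact mul_le_mul_of_nonneg_right (hc k) (norm_nonneg _))
      (hw.mul_left C')
  have hcv : Summable fun k => ‖conj (c k * v k)‖ := by simpa using hcu v hv
  rw [Complex.conj_tsum, tsum_mul_tsum_of_summable_norm (hcu u hu) hcv, covSum, covSum,
    ← (summable_covSum hΓ hu hv).tsum_sub (summable_mul_of_summable_norm (hcu u hu) hcv)]
  exact tsum_congr fun p => by simp only [map_mul]; ring

end CovSum

/-! ### The covariance kernel of the random power series -/

section Kernel

variable {γ : ℤ → ℂ}

theorem one_add_covG_eq_tsum (h0 : γ 0 = 1) (hb : ∀ k, ‖γ k‖ ≤ 1) {z : ℂ}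
    (hz : z ∈ Metric.ball (0 : ℂ) 1) :
    1 + covG γ z = ∑' k : ℕ, conj (γ k) * z ^ k := by
  rw [(summable_mul_pow_of_bounded (C := 1) (fun k => by simpa using hb _) hz).tsum_eq_zero_add]
  simp [covG, h0]

theorem differentiableOn_covG (h0 : γ 0 = 1) (hb : ∀ k, ‖γ k‖ ≤ 1) :
    DifferentiableOn ℂ (covG γ) (Metric.ball 0 1) := by
  have h : DifferentiableOn ℂ (fun z => (∑' k : ℕ, conj (γ k) * z ^ k) - 1) (Metric.ball 0 1) :=
    fun z hz => ((hasDerivAt_tsum_mul_pow (fun w hw => summable_mul_pow_of_bounded (C := 1)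
      (fun k => by simpa using hb _) hw) hz).2.differentiableAt.sub_const 1).differentiableWithinAt
  exact h.congr fun z hz => by rw [← one_add_covG_eq_tsum h0 hb hz]; ring

theorem deriv_covG_eq_tsum (h0 : γ 0 = 1) (hb : ∀ k, ‖γ k‖ ≤ 1) {z : ℂ}
    (hz : z ∈ Metric.ball (0 : ℂ) 1) :
    deriv (covG γ) z = ∑' k : ℕ, conj (γ k) * (k * z ^ (k - 1)) := by
  have h := (hasDerivAt_tsum_mul_pow (a := fun k : ℕ => conj (γ k)) (fun w hw =>
    summable_mul_pow_of_bounded (C := 1) (fun k => by simpa using hb _) hw) hz).2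
  rw [← h.deriv, ← deriv_const_add (1 : ℂ)]
  refine Filter.EventuallyEq.deriv_eq ?_
  filter_upwards [Metric.isOpen_ball.mem_nhds hz] with w hw
  exact one_add_covG_eq_tsum h0 hb hw

theorem hasDerivAt_covG (h0 : γ 0 = 1) (hb : ∀ k, ‖γ k‖ ≤ 1) {z : ℂ}
    (hz : z ∈ Metric.ball (0 : ℂ) 1) : HasDerivAt (covG γ) (deriv (covG γ) z) z :=
  ((differentiableOn_covG h0 hb).differentiableAt (Metric.isOpen_ball.mem_nhds hz)).hasDerivAt

/-- The covariance matrix of a stationary sequence. -/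
def toeplitz (γ : ℤ → ℂ) (k l : ℕ) : ℂ := γ ((l : ℤ) - k)

theorem one_sub_mul_conj_ne_zero {z w : ℂ} (hz : z ∈ Metric.ball (0 : ℂ) 1)
    (hw : w ∈ Metric.ball (0 : ℂ) 1) : 1 - z * conj w ≠ 0 := by
  intro h
  have h1 : z * conj w = 1 := (sub_eq_zero.1 h).symm
  have h2 : ‖z‖ * ‖w‖ = 1 := by rw [← Complex.norm_conj w, ← norm_mul, h1, norm_one]
  have hz1 : ‖z‖ < 1 := by simpa using hz
  have hw1 : ‖w‖ < 1 := by simpa using hw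
  nlinarith [norm_nonneg z, norm_nonneg w]

/-- The Toeplitz structure makes the inner sums satisfy `c (k + 1) = conj (γ (k + 1)) + conj w * c
k`, with `c 0 = 1 + conj G(w)`. Their generating function `T` therefore satisfies `T = G₂(z,w) + z
conj(w) T`, and this is solved for `T`. -/
theorem covSum_toeplitz_pow_pow (h0 : γ 0 = 1) (hb : ∀ k, ‖γ k‖ ≤ 1)
    (hsym : ∀ k, γ (-k) = conj (γ k)) {z w : ℂ} (hz : z ∈ Metric.ball (0 : ℂ) 1)
    (hw : w ∈ Metric.ball (0 : ℂ) 1) :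
    covSum (toeplitz γ) (fun k => z ^ k) (fun k => w ^ k) = covG₂ γ z w / (1 - z * conj w) := by
  have hΓ : ∀ k l, ‖toeplitz γ k l‖ ≤ 1 := fun k l => hb _
  set c : ℕ → ℂ := fun k => ∑' l : ℕ, conj (w ^ l) * toeplitz γ k l with hc
  have hcb := norm_tsum_le_of_bounded hΓ (summable_norm_pow hw)
  have hsumm : ∀ k, Summable fun l : ℕ => conj (w ^ l) * toeplitz γ k l := fun k => by
    refine Summable.of_norm_bounded (summable_norm_pow hw) fun l => ?_
    rw [norm_mul, Complex.norm_conj]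
    exact mul_le_of_le_one_right (norm_nonneg _) (hΓ _ _)
  have hc0 : c 0 = 1 + conj (covG γ w) := by
    rw [← map_one (starRingEnd ℂ), ← map_add, one_add_covG_eq_tsum h0 hb hw, Complex.conj_tsum]
    refine tsum_congr fun l => ?_
    simp [toeplitz, mul_comm]
  have hcs : ∀ k, c (k + 1) = conj (γ ((k : ℤ) + 1)) + conj w * c k := by
    intro k
    simp only [hc]
    rw [(hsumm (k + 1)).tsum_eq_zero_add, ← tsum_mul_left]
    congr 1
    · simp only [pow_zero, map_one, one_mul, toeplitz, ← hsym]
      congr 1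
    · refine tsum_congr fun l => ?_
      rw [pow_succ, map_mul, toeplitz, toeplitz]
      rw [show ((l + 1 : ℕ) : ℤ) - ((k + 1 : ℕ) : ℤ) = (l : ℤ) - k by push_cast; ring]
      ring
  have hT := covSum_eq_tsum_tsum hΓ (summable_norm_pow hz) (summable_norm_pow hw)
  have hcz : Summable fun k => c k * z ^ k := summable_mul_pow_of_bounded hcb hz
  have hgz : Summable fun k : ℕ => conj (γ ((k : ℤ) + 1)) * z ^ (k + 1) := by
    have := (summable_nat_add_iff 1).2 (summable_mul_pow_of_bounded (a := fun k : ℕ => conj (γ k))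
      (C := 1) (fun k => by simpa using hb _) hz)
    simpa using this
  have hrec : ∑' k, c k * z ^ k = 1 + conj (covG γ w) + (covG γ z +
      z * conj w * ∑' k, c k * z ^ k) := by
    conv_lhs => rw [hcz.tsum_eq_zero_add]
    rw [hc0, pow_zero, mul_one,
      show covG γ z = ∑' k : ℕ, conj (γ ((k : ℤ) + 1)) * z ^ (k + 1) from rfl, ← tsum_mul_left, ← hgz.tsum_add (hcz.mul_left _)]
    congr 1
    refine tsum_congr fun k => ?_
    rw [hcs]; ring
  rw [hT, eq_div_iff (one_sub_mul_conj_ne_zero hz hw), covG₂]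
  linear_combination hrec

theorem covSum_toeplitz_deriv_pow (h0 : γ 0 = 1) (hb : ∀ k, ‖γ k‖ ≤ 1)
    (hsym : ∀ k, γ (-k) = conj (γ k)) {z w : ℂ} (hz : z ∈ Metric.ball (0 : ℂ) 1)
    (hw : w ∈ Metric.ball (0 : ℂ) 1) :
    covSum (toeplitz γ) (fun k => k * z ^ (k - 1)) (fun k => w ^ k) =
      deriv (covG γ) z / (1 - z * conj w) + conj w * covG₂ γ z w / (1 - z * conj w) ^ 2 := by
  have hne := one_sub_mul_conj_ne_zero hz hw
  have h1 := hasDerivAt_covSum_pow (Γ := toeplitz γ) (fun k l => hb _) (summable_norm_pow hw) hz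
  have h2 : HasDerivAt (fun z => covG₂ γ z w / (1 - z * conj w))
      ((deriv (covG γ) z * (1 - z * conj w) - covG₂ γ z w * (-(1 * conj w))) /
        (1 - z * conj w) ^ 2) z := by
    refine HasDerivAt.div ?_ (((hasDerivAt_id z).mul_const _).const_sub 1) hne
    exact ((hasDerivAt_covG h0 hb hz).const_add 1).add_const _
  have h3 := h1.unique (h2.congr_of_eventuallyEq (by
    filter_upwards [Metric.isOpen_ball.mem_nhds hz] with z' hz'
    exact covSum_toeplitz_pow_pow h0 hb hsym hz' hw))
  rw [h3]
  field_simp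
  ring

/-- By Hermitian symmetry the conjugate of the mixed formula is holomorphic in the first variable
when the second is frozen at `z`; it is differentiated there and evaluated on the diagonal. -/
theorem covSum_toeplitz_deriv_deriv (h0 : γ 0 = 1) (hb : ∀ k, ‖γ k‖ ≤ 1)
    (hsym : ∀ k, γ (-k) = conj (γ k)) {z : ℂ} (hz : z ∈ Metric.ball (0 : ℂ) 1) :
    covSum (toeplitz γ) (fun k => k * z ^ (k - 1)) (fun k => k * z ^ (k - 1)) =
      (conj z * conj (deriv (covG γ) z) + z * deriv (covG γ) z + covG₂ γ z z) /
        (1 - z * conj z) ^ 2 + 2 * z * conj z * covG₂ γ z z / (1 - z * conj z) ^ 3 := by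
  have hs : ∀ k l, conj (toeplitz γ k l) = toeplitz γ l k := fun k l => by
    rw [toeplitz, toeplitz, ← hsym, neg_sub]
  have hne := one_sub_mul_conj_ne_zero hz hz
  have h1 := hasDerivAt_covSum_pow (Γ := toeplitz γ) (fun k l => hb _)
    (summable_norm_deriv_pow hz) hz
  have hq : HasDerivAt (fun w => 1 - w * conj z) (-(1 * conj z)) z :=
    ((hasDerivAt_id z).mul_const _).const_sub 1
  have hS : HasDerivAt (fun w => 1 + covG γ w + conj (covG γ z)) (deriv (covG γ) z) z :=
    ((hasDerivAt_covG h0 hb hz).const_add 1).add_const _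
  have h2 := ((hasDerivAt_const z (conj (deriv (covG γ) z))).div hq hne).add
    (((hasDerivAt_id z).mul hS).div (hq.pow 2) (pow_ne_zero 2 hne))
  have h3 := h1.unique (h2.congr_of_eventuallyEq (by
    filter_upwards [Metric.isOpen_ball.mem_nhds hz] with w hw
    rw [← covSum_conj_symm hs, covSum_toeplitz_deriv_pow h0 hb hsym hz hw]
    simp only [covG₂, map_add, map_div₀, map_mul, map_sub, map_one, map_pow, Complex.conj_conj,
      Pi.add_apply, Pi.div_apply, Pi.mul_apply, Pi.pow_apply, id]
    ring))
  rw [h3]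
  simp only [covG₂, Pi.mul_apply, Pi.pow_apply, id]
  field_simp
  ring

end Kernel

/-! ### Circularly symmetric complex Gaussian variables -/

section Circular

variable {Ω : Type*} [MeasurableSpace Ω] {P : Measure Ω}

theorem integrable_mul_conj {X Y : Ω → ℂ} (hX : MemLp X 2 P) (hY : MemLp Y 2 P) :
    Integrable (fun ω => X ω * conj (Y ω)) P :=
  hX.integrable_mul hY.star

/-- A product of real linear functionals of `X` and `Y` is the real part of a combination of `X Y`
and `X conj Y`. Vanishing covariance and pseudo-covariance therefore kill every real covariance,
which for jointly Gaussian variables means independence. -/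
theorem covariance_inner_eq_zero [IsProbabilityMeasure P] {X Y : Ω → ℂ} (hX : MemLp X 2 P)
    (hY : MemLp Y 2 P) (hX0 : ∫ ω, X ω ∂P = 0) (hXY : ∫ ω, X ω * Y ω ∂P = 0)
    (hXY' : ∫ ω, X ω * conj (Y ω) ∂P = 0) (x y : ℂ) :
    cov[fun ω => inner ℝ x (X ω), fun ω => inner ℝ y (Y ω); P] = 0 := by
  have hiX : Integrable X P := hX.integrable (by norm_num)
  have i1 : Integrable (fun ω => X ω * Y ω) P := hX.integrable_mul hY
  have i2 := integrable_mul_conj hX hY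
  have e0 : ∫ ω, inner ℝ x (X ω) ∂P = 0 := by
    rw [integral_inner hiX, hX0, inner_zero_right]
  have e1 : ∀ ω, inner ℝ x (X ω) * inner ℝ y (Y ω) =
      ((conj x * conj y / 2) * (X ω * Y ω) + (conj x * y / 2) * (X ω * conj (Y ω))).re := by
    intro ω
    simp only [Complex.inner, Complex.mul_re, Complex.mul_im, Complex.add_re, Complex.conj_re,
      Complex.conj_im, Complex.div_ofNat_re, Complex.div_ofNat_im]
    ring
  rw [covariance_eq_sub (hX.const_inner x) (hY.const_inner y), e0, zero_mul, sub_zero]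
  simp only [Pi.mul_apply, e1]
  have := Complex.reCLM.integral_comp_comm ((i1.const_mul (conj x * conj y / 2)).add
    (i2.const_mul (conj x * y / 2)))
  simp only [Pi.add_apply, Complex.reCLM_apply] at this
  rw [this, integral_add (i1.const_mul _) (i2.const_mul _), integral_const_mul, integral_const_mul,
    hXY, hXY']
  simp

theorem indepFun_of_circular {X Y : Ω → ℂ} (h : HasGaussianLaw (fun ω => (X ω, Y ω)) P)
    (hX0 : ∫ ω, X ω ∂P = 0) (hXY : ∫ ω, X ω * Y ω ∂P = 0)
    (hXY' : ∫ ω, X ω * conj (Y ω) ∂P = 0) : IndepFun X Y P := by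
  have := h.isProbabilityMeasure
  exact h.indepFun_of_covariance_inner
    (covariance_inner_eq_zero h.fst.memLp_two h.snd.memLp_two hX0 hXY hXY')

/-- The density of a circularly symmetric complex Gaussian variable of variance `a`. -/
noncomputable def complexGaussianDensity (a : ℝ) (w : ℂ) : ℝ :=
  (Real.pi * a)⁻¹ * Real.exp (-‖w‖ ^ 2 / a)

theorem integral_mul_conj_self {X : Ω → ℂ} :
    ∫ ω, X ω * conj (X ω) ∂P = ((∫ ω, ‖X ω‖ ^ 2 ∂P : ℝ) : ℂ) := by
  rw [← integral_complex_ofReal]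
  congr 1 with ω
  rw [Complex.mul_conj, Complex.normSq_eq_norm_sq]

/-- The real part of `E[X²] = 0` says that `Re X` and `Im X` have equal variances, hence `a / 2`
each; the imaginary part says that they are uncorrelated, hence independent. The density is the
product of the two real ones. -/
theorem map_eq_withDensity_of_circular {X : Ω → ℂ} (hX : HasGaussianLaw X P)
    (hX0 : ∫ ω, X ω ∂P = 0) (hXX : ∫ ω, X ω * X ω ∂P = 0) {a : ℝ} (ha : 0 < a)
    (hXa : ∫ ω, ‖X ω‖ ^ 2 ∂P = a) :
    P.map X = volume.withDensity fun w => ENNReal.ofReal (complexGaussianDensity a w) := by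
  have := hX.isProbabilityMeasure
  have hL2 := hX.memLp_two
  have hR : HasGaussianLaw (fun ω => (X ω).re) P := hX.map_fun Complex.reCLM
  have hI : HasGaussianLaw (fun ω => (X ω).im) P := hX.map_fun Complex.imCLM
  have hRI : HasGaussianLaw (fun ω => ((X ω).re, (X ω).im)) P :=
    hX.map_fun (Complex.reCLM.prod Complex.imCLM)
  have hR2 : MemLp (fun ω => (X ω).re) 2 P := hR.memLp_two
  have hI2 : MemLp (fun ω => (X ω).im) 2 P := hI.memLp_two
  have hR0 : ∫ ω, (X ω).re ∂P = 0 := by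
    have := Complex.reCLM.integral_comp_comm hX.integrable
    simp only [Complex.reCLM_apply] at this
    rw [this, hX0]; rfl
  have hI0 : ∫ ω, (X ω).im ∂P = 0 := by
    have := Complex.imCLM.integral_comp_comm hX.integrable
    simp only [Complex.imCLM_apply] at this
    rw [this, hX0]; rfl
  have hXXi : Integrable (fun ω => X ω * X ω) P := hL2.integrable_mul hL2
  have e1 : ∫ ω, (X ω).re ^ 2 ∂P - ∫ ω, (X ω).im ^ 2 ∂P = 0 := by
    rw [← integral_sub hR2.integrable_sq hI2.integrable_sq]
    have := Complex.reCLM.integral_comp_comm hXXi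
    simp only [Complex.reCLM_apply, hXX, Complex.zero_re] at this
    rw [← this]
    congr 1 with ω
    rw [Complex.mul_re]; ring
  have e2 : ∫ ω, (X ω).re * (X ω).im ∂P = 0 := by
    have := Complex.imCLM.integral_comp_comm hXXi
    simp only [Complex.imCLM_apply, hXX, Complex.zero_im] at this
    have h2 : ∫ ω, (X ω * X ω).im ∂P = 2 * ∫ ω, (X ω).re * (X ω).im ∂P := by
      rw [← integral_const_mul]
      congr 1 with ω
      rw [Complex.mul_im]; ring
    linarith
  have e3 : ∫ ω, (X ω).re ^ 2 ∂P + ∫ ω, (X ω).im ^ 2 ∂P = a := by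
    rw [← integral_add hR2.integrable_sq hI2.integrable_sq, ← hXa]
    congr 1 with ω
    rw [← Complex.normSq_eq_norm_sq, Complex.normSq_apply]; ring
  have vR : Var[fun ω => (X ω).re; P] = a / 2 := by
    rw [variance_of_integral_eq_zero hR.aemeasurable hR0]; linarith
  have vI : Var[fun ω => (X ω).im; P] = a / 2 := by
    rw [variance_of_integral_eq_zero hI.aemeasurable hI0]; linarith
  have hind : IndepFun (fun ω => (X ω).re) (fun ω => (X ω).im) P := by
    refine hRI.indepFun_of_covariance_eq_zero ?_
    rw [covariance_eq_sub hR2 hI2, hR0, hI0]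
    simpa using e2
  set v : NNReal := (a / 2).toNNReal with hv
  have hva : (v : ℝ) = a / 2 := Real.coe_toNNReal _ (by positivity)
  have hv0 : v ≠ 0 := fun h => by rw [h] at hva; simp at hva; linarith
  have hmap := (indepFun_iff_map_prod_eq_prod_map_map hR.aemeasurable hI.aemeasurable).1 hind
  rw [hR.map_eq_gaussianReal, hI.map_eq_gaussianReal, hR0, hI0, vR, vI, ← hv,
    gaussianReal_of_var_ne_zero _ hv0,
    prod_withDensity (measurable_gaussianPDF _ _) (measurable_gaussianPDF _ _)] at hmap
  have hpdf : ∀ w : ℂ, gaussianPDF 0 v w.re * gaussianPDF 0 v w.im =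
      ENNReal.ofReal (complexGaussianDensity a w) := by
    intro w
    rw [gaussianPDF, gaussianPDF, ← ENNReal.ofReal_mul (gaussianPDFReal_nonneg _ _ _)]
    congr 1
    rw [gaussianPDFReal, gaussianPDFReal, complexGaussianDensity, hva, ← Complex.normSq_eq_norm_sq,
      Complex.normSq_apply]
    have h1 : (√(2 * Real.pi * (a / 2)))⁻¹ * (√(2 * Real.pi * (a / 2)))⁻¹ = (Real.pi * a)⁻¹ := by
      rw [← mul_inv, Real.mul_self_sqrt (by positivity)]; ring_nf
    rw [mul_mul_mul_comm, h1, ← Real.exp_add]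
    congr 2
    field_simp; ring
  have hmeas : Measurable fun w => ENNReal.ofReal (complexGaussianDensity a w) := by
    unfold complexGaussianDensity
    fun_prop
  refine Measure.ext_of_lintegral _ fun φ hφ => ?_
  rw [lintegral_map' hφ.aemeasurable hX.aemeasurable,
    lintegral_withDensity_eq_lintegral_mul _ hmeas hφ,
    ← Complex.volume_preserving_equiv_real_prod.symm.lintegral_comp_emb
      Complex.measurableEquivRealProd.symm.measurableEmbedding]
  have hφ' : Measurable fun p : ℝ × ℝ => φ (Complex.measurableEquivRealProd.symm p) :=
    hφ.comp Complex.measurableEquivRealProd.symm.measurable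
  have h1 : ∫⁻ ω, φ (X ω) ∂P =
      ∫⁻ p, φ (Complex.measurableEquivRealProd.symm p) ∂(P.map fun ω => ((X ω).re, (X ω).im)) := by
    rw [lintegral_map' hφ'.aemeasurable hRI.aemeasurable]
    rfl
  rw [h1, hmap, lintegral_withDensity_eq_lintegral_mul _ (by fun_prop) hφ']
  refine lintegral_congr fun p => ?_
  simp only [Pi.mul_apply, ← hpdf]
  rfl

/-- Multiplying the density by `exp(-|w|²)` gives again a Gaussian profile, with rate `1 + 1/a`, and
its moments of order 0 and 2 are explicit. -/
theorem integral_exp_neg_norm_sq_of_circular {X : Ω → ℂ} (hX : HasGaussianLaw X P)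
    (hX0 : ∫ ω, X ω ∂P = 0) (hXX : ∫ ω, X ω * X ω ∂P = 0) {a : ℝ} (ha : 0 < a)
    (hXa : ∫ ω, ‖X ω‖ ^ 2 ∂P = a) :
    ∫ ω, Real.exp (-‖X ω‖ ^ 2) ∂P = 1 / (1 + a) ∧
      ∫ ω, Real.exp (-‖X ω‖ ^ 2) * ‖X ω‖ ^ 2 ∂P = a / (1 + a) ^ 2 := by
  have hmap := map_eq_withDensity_of_circular hX hX0 hXX ha hXa
  have hmeas : Measurable fun w => ENNReal.ofReal (complexGaussianDensity a w) := by
    unfold complexGaussianDensity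
    fun_prop
  have hred : ∀ g : ℂ → ℝ, Measurable g →
      ∫ ω, g (X ω) ∂P = ∫ w, complexGaussianDensity a w * g w := by
    intro g hg
    rw [← integral_map (φ := X) hX.aemeasurable hg.aestronglyMeasurable, hmap,
      integral_withDensity_eq_integral_toReal_smul hmeas (by simp)]
    refine integral_congr_ae (ae_of_all _ fun w => ?_)
    have : 0 ≤ complexGaussianDensity a w := by unfold complexGaussianDensity; positivity
    simp only [ENNReal.toReal_ofReal this, smul_eq_mul]
  have hb : 0 < 1 + 1 / a := by positivity
  have hexp : ∀ w : ℂ, Real.exp (-‖w‖ ^ 2 / a) * Real.exp (-‖w‖ ^ 2) =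
      Real.exp (-(1 + 1 / a) * ‖w‖ ^ (2 : ℝ)) := by
    intro w
    rw [← Real.exp_add]
    congr 1
    norm_cast
    ring
  have key := fun (q : ℝ) (hq : -2 < q) =>
    Complex.integral_rpow_mul_exp_neg_mul_rpow (p := 2) (q := q) one_le_two hq hb
  constructor
  · rw [hred (fun w => Real.exp (-‖w‖ ^ 2)) (by fun_prop)]
    have k0 := key 0 (by norm_num)
    simp only [complexGaussianDensity, mul_assoc, hexp, Real.rpow_zero, one_mul] at k0 ⊢
    rw [integral_const_mul, k0]
    norm_num
    rw [Real.rpow_neg_one]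
    field_simp
    ring
  · rw [hred (fun w => Real.exp (-‖w‖ ^ 2) * ‖w‖ ^ 2) (by fun_prop)]
    have k2 := key 2 (by norm_num)
    have : ∀ w : ℂ, complexGaussianDensity a w * (Real.exp (-‖w‖ ^ 2) * ‖w‖ ^ 2) =
        (Real.pi * a)⁻¹ * (‖w‖ ^ (2 : ℝ) * Real.exp (-(1 + 1 / a) * ‖w‖ ^ (2 : ℝ))) := by
      intro w
      rw [complexGaussianDensity, ← hexp]
      norm_cast
      ring
    simp only [this]
    rw [integral_const_mul, k2]
    norm_num
    field_simp
    ring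

theorem integrable_exp_neg_norm_sq_mul {X : Ω → ℂ} {f : Ω → ℂ} (hX : AEMeasurable X P)
    (hf : Integrable f P) : Integrable (fun ω => (Real.exp (-‖X ω‖ ^ 2) : ℂ) * f ω) P := by
  refine hf.bdd_mul (c := 1) ?_ (ae_of_all _ fun ω => ?_)
  · exact (Complex.measurable_ofReal.comp_aemeasurable
      (by fun_prop : AEMeasurable (fun ω => Real.exp (-‖X ω‖ ^ 2)) P)).aestronglyMeasurable
  · rw [Complex.norm_real, Real.norm_of_nonneg (Real.exp_pos _).le]
    exact Real.exp_le_one_iff.2 (by simp)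

/-- Regression again: `Y = β X + Z` with `Z` independent of `X` and centered. The cross terms in
`|Y|²` average to zero, which leaves `E[exp(-|X|²)] E|Z|² + |β|² E[exp(-|X|²) |X|²]`. -/
theorem integral_exp_neg_norm_sq_mul_norm_sq {X Y : Ω → ℂ}
    (h : HasGaussianLaw (fun ω => (X ω, Y ω)) P)
    (hX0 : ∫ ω, X ω ∂P = 0) (hY0 : ∫ ω, Y ω ∂P = 0) (hXX : ∫ ω, X ω * X ω ∂P = 0)
    (hXY : ∫ ω, X ω * Y ω ∂P = 0) :
    ((∫ ω, Real.exp (-‖X ω‖ ^ 2) * ‖Y ω‖ ^ 2 ∂P : ℝ) : ℂ) =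
      (∫ ω, Y ω * conj (Y ω) ∂P) / (1 + ∫ ω, X ω * conj (X ω) ∂P) -
        (∫ ω, Y ω * conj (X ω) ∂P) * (∫ ω, X ω * conj (Y ω) ∂P) /
          (1 + ∫ ω, X ω * conj (X ω) ∂P) ^ 2 := by
  have := h.isProbabilityMeasure
  have hX : HasGaussianLaw X P := h.fst
  have hXm := hX.aemeasurable
  have hX2 := hX.memLp_two
  have hY2 : MemLp Y 2 P := h.snd.memLp_two
  set a := ∫ ω, ‖X ω‖ ^ 2 ∂P with ha
  have hA : ∫ ω, X ω * conj (X ω) ∂P = (a : ℂ) := integral_mul_conj_self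
  set c := ∫ ω, Y ω * conj (Y ω) ∂P with hc
  have ha0 : 0 ≤ a := integral_nonneg fun ω => by positivity
  rw [hA]
  -- If `X` has zero variance the regression coefficient is undefined, but then `X = 0` almost
  -- surely and the formula is immediate.
  rcases ha0.eq_or_lt with ha0 | hapos
  · have hXz : X =ᵐ[P] 0 := by
      have hn : (fun ω => ‖X ω‖ ^ 2) =ᵐ[P] 0 :=
        (integral_eq_zero_iff_of_nonneg (fun ω => by positivity) (hX2.integrable_norm_pow
          (by norm_num))).1 ha0.symm
      filter_upwards [hn] with ω hω
      simpa using hω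
    have e1 : ∫ ω, Y ω * conj (X ω) ∂P = 0 := by
      rw [integral_congr_ae (g := fun _ => 0)]
      · simp
      · filter_upwards [hXz] with ω hω
        simp [hω]
    have e2 : ∫ ω, Real.exp (-‖X ω‖ ^ 2) * ‖Y ω‖ ^ 2 ∂P = ∫ ω, ‖Y ω‖ ^ 2 ∂P := by
      refine integral_congr_ae ?_
      filter_upwards [hXz] with ω hω
      simp [hω]
    rw [e1, e2, ← ha0, hc, integral_mul_conj_self]
    simp
  set b := ∫ ω, Y ω * conj (X ω) ∂P with hb
  have hb' : ∫ ω, X ω * conj (Y ω) ∂P = conj b := by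
    rw [hb, ← integral_conj]
    congr 1 with ω
    simp [mul_comm]
  have haC : (a : ℂ) ≠ 0 := by exact_mod_cast hapos.ne'
  set β : ℂ := b / a with hβ
  let Z : Ω → ℂ := fun ω => Y ω - β * X ω
  have hXZ : HasGaussianLaw (fun ω => (X ω, Z ω)) P :=
    h.map_fun ((ContinuousLinearMap.fst ℝ ℂ ℂ).prod (ContinuousLinearMap.snd ℝ ℂ ℂ -
      (ContinuousLinearMap.mul ℝ ℂ β).comp (ContinuousLinearMap.fst ℝ ℂ ℂ)))
  have hZ2 : MemLp Z 2 P := hXZ.snd.memLp_two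
  have hZ0 : ∫ ω, Z ω ∂P = 0 := by
    simp only [Z]
    rw [integral_sub h.snd.integrable (hX.integrable.const_mul _), integral_const_mul, hX0, hY0]
    simp
  have iXX : Integrable (fun ω => X ω * X ω) P := hX2.integrable_mul hX2
  have iXY : Integrable (fun ω => X ω * Y ω) P := hX2.integrable_mul hY2
  have iXZ' : Integrable (fun ω => X ω * conj (Z ω)) P := integrable_mul_conj hX2 hZ2
  have iXX' := integrable_mul_conj hX2 hX2
  have iXY' := integrable_mul_conj hX2 hY2
  have iYX' := integrable_mul_conj hY2 hX2
  have iYY' := integrable_mul_conj hY2 hY2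
  have iZZ' := integrable_mul_conj hZ2 hZ2
  have iZX' := integrable_mul_conj hZ2 hX2
  have hXZ0 : ∫ ω, X ω * Z ω ∂P = 0 := by
    have : ∀ ω, X ω * Z ω = X ω * Y ω - β * (X ω * X ω) := fun ω => by simp only [Z]; ring
    simp only [this]
    rw [integral_sub iXY (iXX.const_mul _), integral_const_mul, hXX, hXY]
    simp
  have hXZ0' : ∫ ω, X ω * conj (Z ω) ∂P = 0 := by
    have : ∀ ω, X ω * conj (Z ω) = X ω * conj (Y ω) - conj β * (X ω * conj (X ω)) := fun ω => by
      simp only [Z, map_sub, map_mul]; ring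
    simp only [this]
    rw [integral_sub iXY' (iXX'.const_mul _), integral_const_mul, hA, hb', hβ]
    simp only [map_div₀, Complex.conj_ofReal]
    field_simp
    ring
  have hZZ : ∫ ω, Z ω * conj (Z ω) ∂P = c - b * conj b / a := by
    have : ∀ ω, Z ω * conj (Z ω) = Y ω * conj (Y ω) - conj β * (Y ω * conj (X ω))
        - β * (X ω * conj (Z ω)) := fun ω => by
      simp only [Z, map_sub, map_mul]; ring
    have j : Integrable (fun ω => Y ω * conj (Y ω) - conj β * (Y ω * conj (X ω))) P :=
      iYY'.sub (iYX'.const_mul _)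
    simp only [this]
    rw [integral_sub j (iXZ'.const_mul _),
      integral_sub iYY' (iYX'.const_mul _), integral_const_mul, integral_const_mul, hXZ0', hβ,
      ← hc, ← hb]
    simp only [map_div₀, Complex.conj_ofReal]
    field_simp
    ring
  have hind : IndepFun X Z P := indepFun_of_circular hXZ hX0 hXZ0 hXZ0'
  obtain ⟨k1, k2⟩ := integral_exp_neg_norm_sq_of_circular hX hX0 hXX hapos rfl
  have hexpand : ∀ ω, ((Real.exp (-‖X ω‖ ^ 2) * ‖Y ω‖ ^ 2 : ℝ) : ℂ) =
      (Real.exp (-‖X ω‖ ^ 2) : ℂ) * (Z ω * conj (Z ω)) +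
      β * conj β * ((Real.exp (-‖X ω‖ ^ 2) : ℂ) * (X ω * conj (X ω))) +
      conj β * ((Real.exp (-‖X ω‖ ^ 2) : ℂ) * (Z ω * conj (X ω))) +
      β * ((Real.exp (-‖X ω‖ ^ 2) : ℂ) * (X ω * conj (Z ω))) := by
    intro ω
    push_cast
    rw [← Complex.ofReal_pow ‖Y ω‖, ← Complex.normSq_eq_norm_sq (Y ω), ← Complex.mul_conj]
    simp only [Z, map_sub, map_mul]
    ring
  have j1 := integrable_exp_neg_norm_sq_mul hXm iZZ'
  have j2 := (integrable_exp_neg_norm_sq_mul hXm iXX').const_mul (β * conj β)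
  have j3 := (integrable_exp_neg_norm_sq_mul hXm iZX').const_mul (conj β)
  have j4 := (integrable_exp_neg_norm_sq_mul hXm iXZ').const_mul β
  have hmE : Measurable fun x : ℂ => (Real.exp (-‖x‖ ^ 2) : ℂ) :=
    Complex.measurable_ofReal.comp (by fun_prop)
  have r1 : ∫ ω, (Real.exp (-‖X ω‖ ^ 2) : ℂ) * (Z ω * conj (Z ω)) ∂P =
      (1 / (1 + a) : ℝ) * (c - b * conj b / a) := by
    have hi := (hind.comp (φ := fun x : ℂ => (Real.exp (-‖x‖ ^ 2) : ℂ))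
      (ψ := fun z : ℂ => z * conj z) hmE (by fun_prop)).integral_mul_eq_mul_integral
      (hmE.comp_aemeasurable hXm).aestronglyMeasurable iZZ'.aestronglyMeasurable
    simp only [Function.comp_def, Pi.mul_apply, hZZ] at hi
    rw [integral_complex_ofReal, k1] at hi
    exact hi
  have r2 : ∫ ω, (Real.exp (-‖X ω‖ ^ 2) : ℂ) * (X ω * conj (X ω)) ∂P =
      (a / (1 + a) ^ 2 : ℝ) := by
    rw [← k2, ← integral_complex_ofReal]
    congr 1 with ω
    rw [Complex.mul_conj, Complex.normSq_eq_norm_sq]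
    push_cast; ring
  have r3 : ∫ ω, (Real.exp (-‖X ω‖ ^ 2) : ℂ) * (Z ω * conj (X ω)) ∂P = 0 := by
    have hmc : Measurable fun x : ℂ => (Real.exp (-‖x‖ ^ 2) : ℂ) * conj x := by fun_prop
    have hi := (hind.comp (φ := fun x : ℂ => (Real.exp (-‖x‖ ^ 2) : ℂ) * conj x)
      (ψ := fun z : ℂ => z) hmc measurable_id).integral_mul_eq_mul_integral
      (hmc.comp_aemeasurable hXm).aestronglyMeasurable hZ2.aestronglyMeasurable
    simp only [Function.comp_def, Pi.mul_apply, hZ0, mul_zero] at hi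
    rw [← hi]
    congr 1 with ω
    ring
  have r4 : ∫ ω, (Real.exp (-‖X ω‖ ^ 2) : ℂ) * (X ω * conj (Z ω)) ∂P = 0 := by
    have := congrArg conj r3
    rw [map_zero, ← integral_conj] at this
    rw [← this]
    congr 1 with ω
    simp only [map_mul, Complex.conj_ofReal, Complex.conj_conj]
    ring
  have h1a : (1 + a : ℂ) ≠ 0 := by exact_mod_cast (by positivity : 1 + a ≠ 0)
  rw [← integral_complex_ofReal]
  simp only [hexpand]
  rw [integral_add ((j1.fun_add j2).fun_add j3) j4, integral_add (j1.fun_add j2) j3, integral_add j1 j2,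
    integral_const_mul, integral_const_mul, integral_const_mul, r1, r2, r3, r4, hb', hβ]
  simp only [map_div₀, Complex.conj_ofReal]
  push_cast
  field_simp
  ring

end Circular

/-! ### Linear functionals of a circularly symmetric Gaussian sequence -/

theorem ae_summable_of_summable_integral {Ω : Type*} [MeasurableSpace Ω] {P : Measure Ω}
    {f : ℕ → Ω → ℝ} (hf : ∀ k, Integrable (f k) P) (h0 : ∀ k ω, 0 ≤ f k ω)
    (hs : Summable fun k => ∫ ω, f k ω ∂P) :
    (∀ᵐ ω ∂P, Summable fun k => f k ω) ∧ Integrable (fun ω => ∑' k, f k ω) P := by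
  have hnorm : ∀ k, eLpNorm (f k) 1 P = ENNReal.ofReal (∫ ω, f k ω ∂P) := fun k => by
    rw [eLpNorm_one_eq_lintegral_enorm,
      ofReal_integral_eq_lintegral_ofReal (hf k) (ae_of_all _ (h0 k))]
    exact lintegral_congr fun ω => Real.enorm_eq_ofReal (h0 k ω)
  have hne : ∑' k, eLpNorm (f k) 1 P ≠ ∞ := by
    simp only [hnorm]
    rw [← ENNReal.ofReal_tsum_of_nonneg (fun k => integral_nonneg (h0 k)) hs]
    exact ENNReal.ofReal_ne_top
  refine ⟨?_, ?_, ?_⟩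
  · filter_upwards [summable_norm_of_tsum_eLpNorm_ne_top le_rfl
      (fun k => (hf k).aestronglyMeasurable) hne] with ω hω
    exact hω.of_norm
  · exact (AEMeasurable.tsum fun k => (hf k).aemeasurable).aestronglyMeasurable
  · refine lt_of_le_of_lt (lintegral_mono fun ω => enorm_tsum_le_tsum_enorm) ?_
    rw [lintegral_tsum fun k => (hf k).aemeasurable.enorm]
    simpa only [eLpNorm_one_eq_lintegral_enorm] using hne.lt_top

/-- A centered, circularly symmetric Gaussian sequence with covariance matrix `Γ`. -/
structure IsCircularGaussianSeq {Ω : Type*} [MeasurableSpace Ω] (P : Measure Ω)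
    (x : ℕ → Ω → ℂ) (Γ : ℕ → ℕ → ℂ) : Prop where
  gaussian : IsGaussianProcess x P
  centered : ∀ k, ∫ ω, x k ω ∂P = 0
  pseudoCovariance : ∀ k l, ∫ ω, x k ω * x l ω ∂P = 0
  covariance : ∀ k l, ∫ ω, x k ω * conj (x l ω) ∂P = Γ k l

namespace IsCircularGaussianSeq

variable {Ω : Type*} [MeasurableSpace Ω] {P : Measure Ω} {x : ℕ → Ω → ℂ} {Γ : ℕ → ℕ → ℂ} {C : ℝ}
  (hx : IsCircularGaussianSeq P x Γ)

include hx

theorem memLp (k : ℕ) : MemLp (x k) 2 P := (hx.gaussian.hasGaussianLaw_eval k).memLp_two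

theorem aemeasurable (k : ℕ) : AEMeasurable (x k) P := hx.gaussian.aemeasurable k

theorem integral_norm_sq_le (hΓ : ∀ k l, ‖Γ k l‖ ≤ C) (k : ℕ) : ∫ ω, ‖x k ω‖ ^ 2 ∂P ≤ C := by
  have h1 := hx.covariance k k
  rw [integral_mul_conj_self] at h1
  have h2 := hΓ k k
  rw [← h1, Complex.norm_real] at h2
  exact (le_abs_self _).trans h2

/-- The variances are bounded, so this weighted sum has finite mean. It gives convergence of `∑ u k
* x k` through `|x| ≤ 1 + |x|²`, and through Cauchy–Schwarz an integrable majorant of all the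
squared partial sums. -/
theorem summable_weighted_sq (hΓ : ∀ k l, ‖Γ k l‖ ≤ C) {u : ℕ → ℂ} (hu : Summable fun k => ‖u k‖) :
    (∀ᵐ ω ∂P, Summable fun k => ‖u k‖ * ‖x k ω‖ ^ 2) ∧
      Integrable (fun ω => ∑' k, ‖u k‖ * ‖x k ω‖ ^ 2) P := by
  refine ae_summable_of_summable_integral (fun k => ?_) (fun k ω => by positivity) ?_
  · exact ((hx.memLp k).integrable_norm_pow (by norm_num)).const_mul _
  · refine Summable.of_nonneg_of_le (fun k => integral_nonneg fun ω => by positivity)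
      (fun k => ?_) (hu.mul_right C)
    rw [integral_const_mul]
    exact mul_le_mul_of_nonneg_left (hx.integral_norm_sq_le hΓ k) (norm_nonneg _)

theorem ae_summable_mul (hΓ : ∀ k l, ‖Γ k l‖ ≤ C) {u : ℕ → ℂ} (hu : Summable fun k => ‖u k‖) :
    ∀ᵐ ω ∂P, Summable fun k => u k * x k ω := by
  filter_upwards [(hx.summable_weighted_sq hΓ hu).1] with ω hω
  refine Summable.of_norm_bounded (hu.add hω) fun k => ?_
  rw [norm_mul]
  nlinarith [norm_nonneg (u k), mul_nonneg (norm_nonneg (u k)) (sq_nonneg (‖x k ω‖ - 1)),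
    mul_nonneg (norm_nonneg (u k)) (sq_nonneg (‖x k ω‖))]

/-- One null set must serve for all `z`. Convergence at the countably many radii `1 - 1/(n+2)`
suffices, since it is absolute and passes to smaller moduli. -/
theorem ae_summable_pow (hΓ : ∀ k l, ‖Γ k l‖ ≤ C) :
    ∀ᵐ ω ∂P, ∀ z ∈ Metric.ball (0 : ℂ) 1, Summable fun k => x k ω * z ^ k := by
  have hr : ∀ n : ℕ, (1 - 1 / ((n : ℝ) + 2) : ℝ) ∈ Set.Ico (0 : ℝ) 1 := fun n => by
    have : (0 : ℝ) < n + 2 := by positivity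
    constructor
    · rw [sub_nonneg, div_le_one this]
      have : (0 : ℝ) ≤ n := n.cast_nonneg
      linarith
    · have : 0 < 1 / ((n : ℝ) + 2) := by positivity
      linarith
  have h : ∀ᵐ ω ∂P, ∀ n : ℕ, Summable fun k => (((1 - 1 / ((n : ℝ) + 2) : ℝ)) : ℂ) ^ k * x k ω := by
    rw [ae_all_iff]
    intro n
    refine hx.ae_summable_mul hΓ (summable_norm_pow ?_)
    rw [mem_ball_zero_iff, Complex.norm_real, Real.norm_of_nonneg (hr n).1]
    exact (hr n).2
  filter_upwards [h] with ω hω z hz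
  have hz1 : ‖z‖ < 1 := by simpa using hz
  obtain ⟨n, hn⟩ := exists_nat_gt (1 / (1 - ‖z‖))
  have hpos : 0 < 1 - ‖z‖ := by linarith
  have hn2 : (0 : ℝ) < n + 2 := by positivity
  have hle : ‖z‖ ≤ 1 - 1 / ((n : ℝ) + 2) := by
    have : 1 / ((n : ℝ) + 2) ≤ 1 - ‖z‖ := by
      rw [div_le_iff₀ hn2]
      rw [div_lt_iff₀ hpos] at hn
      nlinarith
    linarith
  refine Summable.of_norm_bounded (hω n).norm fun k => ?_
  rw [norm_mul, norm_mul, norm_pow, norm_pow, Complex.norm_real, Real.norm_of_nonneg (hr n).1,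
    mul_comm]
  gcongr

theorem hasGaussianLaw_pair (u v : ℕ → ℂ) (n : ℕ) :
    HasGaussianLaw (fun ω => (∑ k ∈ Finset.range n, u k * x k ω,
      ∑ k ∈ Finset.range n, v k * x k ω)) P := by
  let L : (ℕ → ℂ) → ({k // k ∈ Finset.range n} → ℂ) →L[ℝ] ℂ := fun w =>
    ∑ k : {k // k ∈ Finset.range n}, (ContinuousLinearMap.mul ℝ ℂ (w k)).comp (.proj k)
  have h := (hx.gaussian.hasGaussianLaw (Finset.range n)).map_fun ((L u).prod (L v))
  have hL : ∀ w ω, L w ((Finset.range n).restrict (x · ω)) =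
      ∑ k ∈ Finset.range n, w k * x k ω := fun w ω => by
    rw [← Finset.sum_coe_sort]
    simp [L]
  simpa [hL] using h

theorem integral_sum_mul_conj_sum (u v : ℕ → ℂ) (n : ℕ) :
    ∫ ω, (∑ k ∈ Finset.range n, u k * x k ω) * conj (∑ k ∈ Finset.range n, v k * x k ω) ∂P =
      ∑ p ∈ Finset.range n ×ˢ Finset.range n, u p.1 * conj (v p.2) * Γ p.1 p.2 := by
  have h1 : ∀ ω, (∑ k ∈ Finset.range n, u k * x k ω) *
      conj (∑ k ∈ Finset.range n, v k * x k ω) =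
      ∑ p ∈ Finset.range n ×ˢ Finset.range n,
        u p.1 * conj (v p.2) * (x p.1 ω * conj (x p.2 ω)) := fun ω => by
    rw [map_sum, Finset.sum_mul_sum, ← Finset.sum_product']
    exact Finset.sum_congr rfl fun p _ => by rw [map_mul]; ring
  simp only [h1]
  rw [integral_finsetSum _ fun p _ =>
    (integrable_mul_conj (hx.memLp p.1) (hx.memLp p.2)).const_mul _]
  exact Finset.sum_congr rfl fun p _ => by rw [integral_const_mul, hx.covariance]

theorem integral_sum_mul_sum (u v : ℕ → ℂ) (n : ℕ) :
    ∫ ω, (∑ k ∈ Finset.range n, u k * x k ω) * (∑ k ∈ Finset.range n, v k * x k ω) ∂P = 0 := by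
  have h1 : ∀ ω, (∑ k ∈ Finset.range n, u k * x k ω) *
      (∑ k ∈ Finset.range n, v k * x k ω) =
      ∑ p ∈ Finset.range n ×ˢ Finset.range n, u p.1 * v p.2 * (x p.1 ω * x p.2 ω) := fun ω => by
    rw [Finset.sum_mul_sum, ← Finset.sum_product']
    exact Finset.sum_congr rfl fun p _ => by ring
  simp only [h1]
  rw [integral_finsetSum _ fun p _ =>
    ((hx.memLp p.1).integrable_mul (hx.memLp p.2)).const_mul _]
  exact Finset.sum_eq_zero fun p _ => by
    rw [integral_const_mul]
    exact mul_eq_zero_of_right _ (hx.pseudoCovariance p.1 p.2)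

theorem integral_sum (u : ℕ → ℂ) (n : ℕ) :
    ∫ ω, ∑ k ∈ Finset.range n, u k * x k ω ∂P = 0 := by
  have := hx.gaussian.isProbabilityMeasure
  rw [integral_finsetSum _ fun k _ => ((hx.memLp k).integrable (by norm_num)).const_mul _]
  exact Finset.sum_eq_zero fun k _ => by rw [integral_const_mul, hx.centered, mul_zero]

omit hx in
theorem tendsto_covSum (hΓ : ∀ k l, ‖Γ k l‖ ≤ C) {u v : ℕ → ℂ} (hu : Summable fun k => ‖u k‖)
    (hv : Summable fun k => ‖v k‖) :
    Tendsto (fun n => ∑ p ∈ Finset.range n ×ˢ Finset.range n, u p.1 * conj (v p.2) * Γ p.1 p.2)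
      atTop (𝓝 (covSum Γ u v)) := by
  refine (summable_covSum hΓ hu hv).hasSum.comp (tendsto_atTop_finset_of_monotone ?_ ?_)
  · intro m n hmn
    exact Finset.product_subset_product (Finset.range_mono hmn) (Finset.range_mono hmn)
  · rintro ⟨k, l⟩
    refine ⟨max k l + 1, ?_⟩
    simp only [Finset.mem_product, Finset.mem_range]
    omega

theorem covSum_self_nonneg (hΓ : ∀ k l, ‖Γ k l‖ ≤ C) {u : ℕ → ℂ}
    (hu : Summable fun k => ‖u k‖) : 0 ≤ (covSum Γ u u).re ∧ (covSum Γ u u).im = 0 := by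
  have h : ∀ n, ∃ t : ℝ, 0 ≤ t ∧
      ∑ p ∈ Finset.range n ×ˢ Finset.range n, u p.1 * conj (u p.2) * Γ p.1 p.2 = (t : ℂ) :=
    fun n => ⟨_, integral_nonneg fun ω => sq_nonneg _, by
      rw [← hx.integral_sum_mul_conj_sum u u n, integral_mul_conj_self]⟩
  have ht := tendsto_covSum hΓ hu hu
  constructor
  · refine ge_of_tendsto' ((Complex.continuous_re.tendsto _).comp ht) fun n => ?_
    obtain ⟨t, ht0, ht⟩ := h n
    simpa [ht] using ht0
  · refine tendsto_nhds_unique ((Complex.continuous_im.tendsto _).comp ht) ?_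
    refine tendsto_const_nhds.congr fun n => ?_
    obtain ⟨t, ht0, ht⟩ := h n
    simp [ht]

/-- The pair formula holds for partial sums, which are jointly Gaussian and circular. Both sides
pass to the limit: the left by dominated convergence with the Cauchy–Schwarz majorant, the right
because `1 + covSum Γ u u` has real part at least 1. -/
theorem integral_exp_neg_norm_sq_mul_norm_sq_tsum (hΓ : ∀ k l, ‖Γ k l‖ ≤ C) {u v : ℕ → ℂ}
    (hu : Summable fun k => ‖u k‖) (hv : Summable fun k => ‖v k‖) :
    Integrable (fun ω => Real.exp (-‖∑' k, u k * x k ω‖ ^ 2) * ‖∑' k, v k * x k ω‖ ^ 2) P ∧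
    ((∫ ω, Real.exp (-‖∑' k, u k * x k ω‖ ^ 2) * ‖∑' k, v k * x k ω‖ ^ 2 ∂P : ℝ) : ℂ) =
      covSum Γ v v / (1 + covSum Γ u u) -
        covSum Γ v u * covSum Γ u v / (1 + covSum Γ u u) ^ 2 := by
  let X : ℕ → Ω → ℂ := fun n ω => ∑ k ∈ Finset.range n, u k * x k ω
  let Y : ℕ → Ω → ℂ := fun n ω => ∑ k ∈ Finset.range n, v k * x k ω
  obtain ⟨hsum, hbint⟩ := hx.summable_weighted_sq hΓ hv
  let bound : Ω → ℝ := fun ω => (∑' k, ‖v k‖) * ∑' k, ‖v k‖ * ‖x k ω‖ ^ 2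
  have hbound : Integrable bound P := hbint.const_mul _
  have hXm : ∀ n, AEMeasurable (X n) P := fun n => (hx.hasGaussianLaw_pair u v n).fst.aemeasurable
  have hYm : ∀ n, AEMeasurable (Y n) P := fun n => (hx.hasGaussianLaw_pair u v n).snd.aemeasurable
  have hFm : ∀ n, AEStronglyMeasurable (fun ω => Real.exp (-‖X n ω‖ ^ 2) * ‖Y n ω‖ ^ 2) P :=
    fun n => by
      have := hXm n
      have := hYm n
      exact AEMeasurable.aestronglyMeasurable (by fun_prop)
  have hle : ∀ n, ∀ᵐ ω ∂P, ‖Real.exp (-‖X n ω‖ ^ 2) * ‖Y n ω‖ ^ 2‖ ≤ bound ω := by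
    intro n
    filter_upwards [hsum] with ω hω
    rw [Real.norm_of_nonneg (by positivity)]
    have h1 : Real.exp (-‖X n ω‖ ^ 2) ≤ 1 := Real.exp_le_one_iff.2 (by simp)
    have h2 : ‖Y n ω‖ ≤ ∑ k ∈ Finset.range n, ‖v k‖ * ‖x k ω‖ :=
      (norm_sum_le _ _).trans (le_of_eq (Finset.sum_congr rfl fun k _ => norm_mul _ _))
    have h3 : (∑ k ∈ Finset.range n, ‖v k‖ * ‖x k ω‖) ^ 2 ≤
        (∑ k ∈ Finset.range n, ‖v k‖) * ∑ k ∈ Finset.range n, ‖v k‖ * ‖x k ω‖ ^ 2 :=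
      Finset.sum_sq_le_sum_mul_sum_of_sq_le_mul _ (fun k _ => norm_nonneg _)
        (fun k _ => by positivity) fun k _ => le_of_eq (by ring)
    have h4 : ∑ k ∈ Finset.range n, ‖v k‖ ≤ ∑' k, ‖v k‖ :=
      hv.sum_le_tsum _ fun k _ => norm_nonneg _
    have h5 : ∑ k ∈ Finset.range n, ‖v k‖ * ‖x k ω‖ ^ 2 ≤ ∑' k, ‖v k‖ * ‖x k ω‖ ^ 2 :=
      hω.sum_le_tsum _ fun k _ => by positivity
    calc Real.exp (-‖X n ω‖ ^ 2) * ‖Y n ω‖ ^ 2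
        ≤ 1 * (∑ k ∈ Finset.range n, ‖v k‖ * ‖x k ω‖) ^ 2 := by gcongr
      _ ≤ (∑ k ∈ Finset.range n, ‖v k‖) * ∑ k ∈ Finset.range n, ‖v k‖ * ‖x k ω‖ ^ 2 := by
          rw [one_mul]; exact h3
      _ ≤ bound ω := by
          refine mul_le_mul h4 h5 (Finset.sum_nonneg fun k _ => by positivity) ?_
          exact tsum_nonneg fun k => norm_nonneg _
  have hlim : ∀ᵐ ω ∂P, Tendsto (fun n => Real.exp (-‖X n ω‖ ^ 2) * ‖Y n ω‖ ^ 2) atTop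
      (𝓝 (Real.exp (-‖∑' k, u k * x k ω‖ ^ 2) * ‖∑' k, v k * x k ω‖ ^ 2)) := by
    filter_upwards [hx.ae_summable_mul hΓ hu, hx.ae_summable_mul hΓ hv] with ω h1 h2
    have t1 := h1.hasSum.tendsto_sum_nat
    have t2 := h2.hasSum.tendsto_sum_nat
    exact ((Real.continuous_exp.tendsto _).comp ((t1.norm.pow 2).neg)).mul (t2.norm.pow 2)
  have hlimI := tendsto_integral_of_dominated_convergence bound hFm hbound hle hlim
  refine ⟨?_, ?_⟩
  · refine hbound.mono' (aestronglyMeasurable_of_tendsto_ae _ hFm hlim) ?_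
    filter_upwards [hlim, ae_all_iff.2 hle] with ω h1 h2
    exact le_of_tendsto' h1.norm h2
  have hn : ∀ n, ((∫ ω, Real.exp (-‖X n ω‖ ^ 2) * ‖Y n ω‖ ^ 2 ∂P : ℝ) : ℂ) =
      (∑ p ∈ Finset.range n ×ˢ Finset.range n, v p.1 * conj (v p.2) * Γ p.1 p.2) /
        (1 + ∑ p ∈ Finset.range n ×ˢ Finset.range n, u p.1 * conj (u p.2) * Γ p.1 p.2) -
      (∑ p ∈ Finset.range n ×ˢ Finset.range n, v p.1 * conj (u p.2) * Γ p.1 p.2) *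
        (∑ p ∈ Finset.range n ×ˢ Finset.range n, u p.1 * conj (v p.2) * Γ p.1 p.2) /
        (1 + ∑ p ∈ Finset.range n ×ˢ Finset.range n, u p.1 * conj (u p.2) * Γ p.1 p.2) ^ 2 := by
    intro n
    simp only [← hx.integral_sum_mul_conj_sum]
    exact integral_exp_neg_norm_sq_mul_norm_sq (hx.hasGaussianLaw_pair u v n)
      (hx.integral_sum u n) (hx.integral_sum v n) (hx.integral_sum_mul_sum u u n)
      (hx.integral_sum_mul_sum u v n)
  have hne : 1 + covSum Γ u u ≠ 0 := by
    intro h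
    have := congrArg Complex.re h
    have h2 := (hx.covSum_self_nonneg hΓ hu).1
    simp at this
    linarith
  have hA := (tendsto_covSum hΓ hu hu).const_add 1
  have hR := ((tendsto_covSum hΓ hv hv).div hA hne).sub
    (((tendsto_covSum hΓ hv hu).mul (tendsto_covSum hΓ hu hv)).div (hA.pow 2) (pow_ne_zero 2 hne))
  exact tendsto_nhds_unique ((Complex.continuous_ofReal.tendsto _).comp hlimI)
    (hR.congr fun n => (hn n).symm)

end IsCircularGaussianSeq

/-! ### Measurability of the number of zeros of a random power series -/

section Measurability

variable {Ω : Type*} [MeasurableSpace Ω] {P : Measure Ω} {a : ℕ → Ω → ℂ}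

theorem continuousOn_tsum_mul_pow {a : ℕ → ℂ}
    (ha : ∀ z ∈ Metric.ball (0 : ℂ) 1, Summable fun k => a k * z ^ k) :
    ContinuousOn (fun z => ∑' k, a k * z ^ k) (Metric.ball 0 1) := fun _ hz =>
  (hasDerivAt_tsum_mul_pow ha hz).2.continuousAt.continuousWithinAt

/-- On a compact set a continuous function vanishes somewhere exactly when its modulus is
arbitrarily small on a countable dense subset. This replaces an uncountable union by countable
operations, up to the null set where the series diverges. -/
theorem nullMeasurableSet_exists_zero (ha : ∀ k, AEMeasurable (a k) P)
    (hs : ∀ᵐ ω ∂P, ∀ z ∈ Metric.ball (0 : ℂ) 1, Summable fun k => a k ω * z ^ k) {K : Set ℂ}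
    (hK : IsCompact K) (hKb : K ⊆ Metric.ball 0 1) :
    NullMeasurableSet {ω | ∃ z ∈ K, ∑' k, a k ω * z ^ k = 0} P := by
  obtain ⟨S, hSK, hSc, hSd⟩ := hK.isSeparable.exists_countable_dense_subset
  have hf : ∀ z, AEMeasurable (fun ω => ∑' k, a k ω * z ^ k) P := fun z =>
    AEMeasurable.tsum fun k => (ha k).mul_const _
  have hnull : NullMeasurableSet
      {ω | ∀ m : ℕ, ∃ z ∈ S, ‖∑' k, a k ω * z ^ k‖ < 1 / ((m : ℝ) + 1)} P := by
    have : {ω | ∀ m : ℕ, ∃ z ∈ S, ‖∑' k, a k ω * z ^ k‖ < 1 / ((m : ℝ) + 1)} =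
        ⋂ m : ℕ, ⋃ z ∈ S, {ω | ‖∑' k, a k ω * z ^ k‖ < 1 / ((m : ℝ) + 1)} := by
      ext ω; simp
    rw [this]
    refine NullMeasurableSet.iInter fun m => NullMeasurableSet.biUnion hSc fun z _ => ?_
    exact nullMeasurableSet_lt (hf z).norm aemeasurable_const
  refine hnull.congr ?_
  filter_upwards [hs] with ω hω
  have hcont := (continuousOn_tsum_mul_pow hω).mono hKb
  refine propext ⟨fun h => ?_, fun ⟨z, hz, hz0⟩ m => ?_⟩
  · have hne : K.Nonempty := by
      obtain ⟨z, hz, _⟩ := h 0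
      exact ⟨z, hSK hz⟩
    obtain ⟨z, hz, hmin⟩ := hK.exists_isMinOn hne hcont.norm
    refine ⟨z, hz, ?_⟩
    by_contra hz0
    obtain ⟨m, hm⟩ := exists_nat_one_div_lt (norm_pos_iff.2 hz0)
    obtain ⟨w, hw, hwm⟩ := h m
    have := isMinOn_iff.1 hmin w (hSK hw)
    linarith
  · have h1 : ∀ᶠ w in 𝓝[K] z, ‖∑' k, a k ω * w ^ k‖ < 1 / ((m : ℝ) + 1) := by
      refine (hcont.norm z hz).eventually_lt_const ?_
      simp only [hz0, norm_zero]
      positivity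
    have h2 : ∃ᶠ w in 𝓝 z, w ∈ S := mem_closure_iff_frequently.1 (hSd hz)
    obtain ⟨w, hw, hw'⟩ := (h2.and_eventually (eventually_nhdsWithin_iff.1 h1)).exists
    exact ⟨w, hw, hw' (hSK hw)⟩

/-- The closed balls of radius `1 / (m + 1)` centered at the points of a dense sequence. -/
def densePointBall (p : ℕ × ℕ) : Set ℂ :=
  Metric.closedBall (TopologicalSpace.denseSeq ℂ p.1) (1 / ((p.2 : ℝ) + 1))

/-- With `1/(m+1) < ε`, a closed ball of that radius around a dense point within `1/(m+1)` of `z`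
lies in the ball of radius `2ε` about `z`. So `ε` is taken with these larger balls inside `D` and
with the points of `T` more than `4ε` apart. -/
theorem exists_disjoint_balls {D : Set ℂ} (hD : IsOpen D) (T : Finset ℂ) (hT : ↑T ⊆ D) :
    ∃ i : ℂ → ℕ × ℕ, (∀ z ∈ T, z ∈ densePointBall (i z) ∧ densePointBall (i z) ⊆ D) ∧
      ∀ z ∈ T, ∀ w ∈ T, z ≠ w → Disjoint (densePointBall (i z)) (densePointBall (i w)) := by
  have h1 : ∀ᶠ ε : ℝ in 𝓝[>] 0, ∀ z ∈ T, Metric.ball z (2 * ε) ⊆ D := by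
    refine (Finset.eventually_all T).2 fun z hz => ?_
    obtain ⟨δ, hδ, hδD⟩ := Metric.isOpen_iff.1 hD z (hT hz)
    filter_upwards [Ioo_mem_nhdsGT (show (0 : ℝ) < δ / 2 by positivity)] with ε hε
    exact (Metric.ball_subset_ball (by linarith [hε.2])).trans hδD
  have h2 : ∀ᶠ ε : ℝ in 𝓝[>] 0, ∀ z ∈ T, ∀ w ∈ T, z ≠ w → 4 * ε < dist z w := by
    refine (Finset.eventually_all T).2 fun z _ => (Finset.eventually_all T).2 fun w _ => ?_
    by_cases hzw : z = w
    · exact Eventually.of_forall fun _ h => absurd hzw h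
    · filter_upwards [Ioo_mem_nhdsGT (show (0 : ℝ) < dist z w / 4 by
        have := dist_pos.2 hzw; positivity)] with ε hε _
      linarith [hε.2]
  obtain ⟨ε, ⟨hε1, hε2⟩, hε0⟩ := ((h1.and h2).and self_mem_nhdsWithin).exists
  have hε0' : (0 : ℝ) < ε := hε0
  obtain ⟨m, hm⟩ := exists_nat_one_div_lt hε0'
  have hm0 : (0 : ℝ) < 1 / ((m : ℝ) + 1) := by positivity
  have hc : ∀ z : ℂ, ∃ j, dist z (TopologicalSpace.denseSeq ℂ j) < 1 / ((m : ℝ) + 1) := fun z =>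
    (TopologicalSpace.denseRange_denseSeq ℂ).exists_dist_lt z hm0
  choose j hj using hc
  have hsub : ∀ z, densePointBall (j z, m) ⊆ Metric.ball z (2 * ε) := by
    intro z w hw
    have h3 : dist w (TopologicalSpace.denseSeq ℂ (j z)) ≤ 1 / ((m : ℝ) + 1) := hw
    have h4 := hj z
    rw [dist_comm] at h4
    rw [Metric.mem_ball]
    have := dist_triangle w (TopologicalSpace.denseSeq ℂ (j z)) z
    linarith
  refine ⟨fun z => (j z, m), fun z hz => ⟨(hj z).le, (hsub z).trans (hε1 z hz)⟩, ?_⟩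
  intro z hz w hw hzw
  refine Disjoint.mono (hsub z) (hsub w) (Metric.ball_disjoint_ball ?_)
  linarith [hε2 z hz w hw hzw]

/-- Finitely many points can be separated by disjoint balls from a fixed countable list, and
disjoint balls that are hit contain distinct points. Thus counting becomes a countable supremum of
finite sums. The indicator on `Prop` lets each summand be read as the indicator of an event. -/
theorem encard_eq_iSup_balls {D : Set ℂ} (hD : IsOpen D) (p : ℂ → Prop) :
    ({z ∈ D | p z}.encard : ℝ≥0∞) =
      ⨆ F : {F : Finset (ℕ × ℕ) // (∀ i ∈ F, densePointBall i ⊆ D) ∧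
        ∀ i ∈ F, ∀ j ∈ F, i ≠ j → Disjoint (densePointBall i) (densePointBall j)},
        ∑ i ∈ F.1, {q : Prop | q}.indicator (fun _ => (1 : ℝ≥0∞)) (∃ z ∈ densePointBall i, p z) := by
  classical
  have hlow : ∀ T : Finset ℂ, ↑T ⊆ {z ∈ D | p z} → (T.card : ℝ≥0∞) ≤
      ⨆ F : {F : Finset (ℕ × ℕ) // (∀ i ∈ F, densePointBall i ⊆ D) ∧
        ∀ i ∈ F, ∀ j ∈ F, i ≠ j → Disjoint (densePointBall i) (densePointBall j)},
        ∑ i ∈ F.1, {q : Prop | q}.indicator (fun _ => (1 : ℝ≥0∞))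
          (∃ z ∈ densePointBall i, p z) := by
    intro T hT
    obtain ⟨i, hi1, hi2⟩ := exists_disjoint_balls hD T (hT.trans fun z hz => hz.1)
    have hinj : Set.InjOn i T := by
      intro z hz w hw hzw
      by_contra hne
      exact Set.disjoint_left.1 (hi2 z hz w hw hne) (hi1 z hz).1 (hzw ▸ (hi1 z hz).1)
    refine le_trans (le_of_eq ?_) (le_iSup _ ⟨T.image i, ?_, ?_⟩)
    · rw [Finset.sum_image hinj, Finset.sum_congr rfl (g := fun _ => (1 : ℝ≥0∞))]
      · simp
      · intro z hz
        exact Set.indicator_of_mem (s := {q : Prop | q})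
          (show ∃ w ∈ densePointBall (i z), p w from ⟨z, (hi1 z hz).1, (hT hz).2⟩) _
    · intro k hk
      obtain ⟨z, hz, rfl⟩ := Finset.mem_image.1 hk
      exact (hi1 z hz).2
    · intro k hk l hl hkl
      obtain ⟨z, hz, rfl⟩ := Finset.mem_image.1 hk
      obtain ⟨w, hw, rfl⟩ := Finset.mem_image.1 hl
      exact hi2 z hz w hw fun h => hkl (by rw [h])
  apply le_antisymm
  · by_cases hfin : {z ∈ D | p z}.Finite
    · have := hlow hfin.toFinset (by simp)
      rwa [← ENat.toENNReal_coe, ← Set.encard_coe_eq_coe_finsetCard, hfin.coe_toFinset] at this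
    · refine le_of_le_of_eq le_top (ENNReal.eq_top_of_forall_nnreal_le fun r => ?_).symm
      obtain ⟨n, hn⟩ := exists_nat_ge r
      obtain ⟨T, hT, hTn⟩ := Set.Infinite.exists_subset_card_eq hfin n
      refine le_trans ?_ (hTn ▸ hlow T hT)
      exact_mod_cast hn
  · refine iSup_le fun F => ?_
    obtain ⟨F, hF1, hF2⟩ := F
    let F' := F.filter fun i => ∃ z ∈ densePointBall i, p z
    have hsum : ∑ i ∈ F, {q : Prop | q}.indicator (fun _ => (1 : ℝ≥0∞))
        (∃ z ∈ densePointBall i, p z) = (F'.card : ℝ≥0∞) := by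
      rw [Finset.card_filter, Nat.cast_sum]
      refine Finset.sum_congr rfl fun i _ => ?_
      by_cases h : ∃ z ∈ densePointBall i, p z
      · rw [Set.indicator_of_mem (by exact h), if_pos h, Nat.cast_one]
      · rw [Set.indicator_of_notMem (by exact h), if_neg h, Nat.cast_zero]
    rw [hsum]
    have hex : ∀ i ∈ F', ∃ z ∈ densePointBall i, p z := fun i hi => (Finset.mem_filter.1 hi).2
    choose! z hz using hex
    have hinj : Set.InjOn z F' := by
      intro i hi j hj hij
      by_contra hne
      exact Set.disjoint_left.1 (hF2 i (Finset.mem_filter.1 hi).1 j (Finset.mem_filter.1 hj).1 hne)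
        (hz i hi).1 (hij ▸ (hz j hj).1)
    have hsub : ((F'.image z : Finset ℂ) : Set ℂ) ⊆ {z ∈ D | p z} := by
      intro w hw
      obtain ⟨i, hi, rfl⟩ := Finset.mem_image.1 (Finset.mem_coe.1 hw)
      exact ⟨hF1 i (Finset.mem_filter.1 hi).1 (hz i hi).1, (hz i hi).2⟩
    have := Set.encard_le_encard hsub
    rw [Set.encard_coe_eq_coe_finsetCard, Finset.card_image_of_injOn hinj] at this
    have h2 := ENat.toENNReal_le.2 this
    rwa [ENat.toENNReal_coe] at h2

theorem aemeasurable_encard_zeros (ha : ∀ k, AEMeasurable (a k) P)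
    (hs : ∀ᵐ ω ∂P, ∀ z ∈ Metric.ball (0 : ℂ) 1, Summable fun k => a k ω * z ^ k) {D : Set ℂ}
    (hD : IsOpen D) (hDb : D ⊆ Metric.ball 0 1) :
    AEMeasurable (fun ω => ({z ∈ D | ∑' k, a k ω * z ^ k = 0}.encard : ℝ≥0∞)) P := by
  simp only [encard_eq_iSup_balls hD]
  refine AEMeasurable.iSup fun F => Finset.aemeasurable_fun_sum _ fun i hi => ?_
  have h := nullMeasurableSet_exists_zero ha hs
    (isCompact_closedBall (TopologicalSpace.denseSeq ℂ i.1) (1 / ((i.2 : ℝ) + 1)))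
    ((F.2.1 i hi).trans hDb)
  exact (aemeasurable_const (b := (1 : ℝ≥0∞))).indicator₀ h

end Measurability

/-! ### The area formula for holomorphic functions -/

theorem det_restrictScalars_toSpanSingleton (c : ℂ) :
    ((ContinuousLinearMap.toSpanSingleton ℂ c).restrictScalars ℝ).det = ‖c‖ ^ 2 := by
  rw [← Complex.normSq_eq_norm_sq, ← Algebra.norm_complex_apply, Algebra.norm_apply]
  change LinearMap.det _ = LinearMap.det _
  congr 1
  ext; simp [mul_comm]

/-- The weight `G ∘ h` is constant on each fibre, so its fibre sum is `G w` times the cardinality;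
the real Jacobian of a holomorphic map is `|h'|²`. -/
theorem lintegral_density_mul_encard {D : Set ℂ} (hD : IsOpen D) {h h' : ℂ → ℂ}
    (hm : Measurable h) (hm' : Measurable h') (hd : ∀ z ∈ D, HasDerivAt h (h' z) z)
    {G : ℂ → ℝ≥0∞} (hG : Measurable G) :
    ∫⁻ w, G w * ({z ∈ D | h z = w}.encard : ℝ≥0∞) =
      ∫⁻ z in D, ENNReal.ofReal (‖h' z‖ ^ 2) * G (h z) := by
  have key := (lintegral_abs_det_mul_eq_lintegral_tsum_fiber volume (f := h)
    (f' := fun z => (ContinuousLinearMap.toSpanSingleton ℂ (h' z)).restrictScalars ℝ)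
    hD.measurableSet
    (by
      simp only [det_restrictScalars_toSpanSingleton]
      exact hD.measurableSet.inter
        ((hm'.norm.pow_const 2) (measurableSet_singleton (0 : ℝ)).compl))
    (fun z hz => ((hd z hz).hasFDerivAt.restrictScalars ℝ).hasFDerivWithinAt)
    (hG.comp hm)).2.2
  simp only [det_restrictScalars_toSpanSingleton, abs_of_nonneg (sq_nonneg ‖_‖),
    Function.comp_apply] at key
  rw [key]
  refine lintegral_congr fun w => ?_
  have : ∀ z : {z ∈ D | h z = w}, G (h z) = G w := fun z => by rw [z.2.2]
  simp only [this]
  rw [ENNReal.tsum_set_const, mul_comm]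

/-! ### Stationary sequences and their innovations -/

namespace IsStationaryComplexGaussian

variable {Ω : Type*} [MeasurableSpace Ω] {P : Measure Ω} {ξ : ℤ → Ω → ℂ} {γ : ℤ → ℂ}

theorem isCircularGaussianSeq (hξ : IsStationaryComplexGaussian P ξ γ) :
    IsCircularGaussianSeq P (fun k : ℕ => ξ k) (toeplitz γ) where
  gaussian := hξ.gaussian.comp_right (fun k : ℕ => (k : ℤ))
  centered k := hξ.centered k
  pseudoCovariance k l := hξ.pseudoCovariance k l
  covariance k l := hξ.covariance k l

theorem memLp (hξ : IsStationaryComplexGaussian P ξ γ) (k : ℤ) : MemLp (ξ k) 2 P :=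
  (hξ.gaussian.hasGaussianLaw_eval k).memLp_two

theorem integral_norm_sq (hξ : IsStationaryComplexGaussian P ξ γ) (k : ℤ) :
    ∫ ω, ‖ξ k ω‖ ^ 2 ∂P = 1 := by
  have h := hξ.covariance k k
  rw [integral_mul_conj_self, sub_self, hξ.unitVariance] at h
  exact_mod_cast h

theorem covariance_neg (hξ : IsStationaryComplexGaussian P ξ γ) (k : ℤ) :
    γ (-k) = conj (γ k) := by
  have h1 := hξ.covariance 0 k
  have h2 := hξ.covariance k 0
  rw [sub_zero] at h1
  rw [zero_sub] at h2
  rw [← h1, ← h2, ← integral_conj]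
  exact integral_congr_ae (ae_of_all _ fun ω => by simp [mul_comm])

theorem norm_covariance_le (hξ : IsStationaryComplexGaussian P ξ γ) (k : ℤ) : ‖γ k‖ ≤ 1 := by
  have h := hξ.covariance 0 k
  rw [sub_zero] at h
  have hi : ∀ l, Integrable (fun ω => ‖ξ l ω‖ ^ 2) P := fun l =>
    (hξ.memLp l).integrable_norm_pow (by norm_num)
  calc ‖γ k‖ ≤ ∫ ω, ‖ξ 0 ω * conj (ξ k ω)‖ ∂P := by
        rw [← h]; exact norm_integral_le_integral_norm _
    _ ≤ ∫ ω, (1 / 2 * ‖ξ 0 ω‖ ^ 2 + 1 / 2 * ‖ξ k ω‖ ^ 2) ∂P := by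
        refine integral_mono (integrable_mul_conj (hξ.memLp 0) (hξ.memLp k)).norm
          (((hi 0).const_mul _).fun_add ((hi k).const_mul _)) fun ω => ?_
        simp only [norm_mul, Complex.norm_conj]
        nlinarith [sq_nonneg (‖ξ 0 ω‖ - ‖ξ k ω‖)]
    _ = 1 := by
        rw [integral_add ((hi 0).const_mul _) ((hi k).const_mul _), integral_const_mul,
          integral_const_mul, hξ.integral_norm_sq, hξ.integral_norm_sq]
        norm_num

end IsStationaryComplexGaussian

theorem integral_sub_sub_sub {Ω : Type*} [MeasurableSpace Ω] {P : Measure Ω} {a b c d : Ω → ℂ}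
    (ha : Integrable a P) (hb : Integrable b P) (hc : Integrable c P) (hd : Integrable d P) :
    ∫ ω, a ω - b ω - (c ω - d ω) ∂P =
      ∫ ω, a ω ∂P - ∫ ω, b ω ∂P - (∫ ω, c ω ∂P - ∫ ω, d ω ∂P) := by
  rw [← integral_sub ha hb, ← integral_sub hc hd]
  exact integral_sub (ha.sub hb) (hc.sub hd)

namespace IsCircularGaussianSeq

variable {Ω : Type*} [MeasurableSpace Ω] {P : Measure Ω} {x : ℕ → Ω → ℂ} {Γ : ℕ → ℕ → ℂ}

/-- The residuals of the regression on the zeroth variable. -/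
theorem residual (hx : IsCircularGaussianSeq P x Γ) (h00 : Γ 0 0 = 1)
    (hsym : ∀ k l, conj (Γ k l) = Γ l k) :
    IsCircularGaussianSeq P (fun k ω => x k ω - Γ k 0 * x 0 ω)
      (fun k l => Γ k l - Γ k 0 * conj (Γ l 0)) where
  gaussian := by
    refine hx.gaussian.of_isGaussianProcess fun k => ?_
    let L (i : ↥({k, 0} : Finset ℕ)) : (↥({k, 0} : Finset ℕ) → ℂ) →L[ℝ] ℂ := .proj i
    exact ⟨{k, 0}, L ⟨k, by simp⟩ - (ContinuousLinearMap.mul ℝ ℂ (Γ k 0)).comp (L ⟨0, by simp⟩),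
      fun ω => by simp [L]⟩
  centered k := by
    have := hx.gaussian.isProbabilityMeasure
    have hi : ∀ k, Integrable (x k) P := fun k => (hx.memLp k).integrable (by norm_num)
    rw [integral_sub (hi k) ((hi 0).const_mul _), integral_const_mul, hx.centered, hx.centered,
      mul_zero, sub_zero]
  pseudoCovariance k l := by
    have hi : ∀ k l, Integrable (fun ω => x k ω * x l ω) P := fun k l =>
      (hx.memLp k).integrable_mul (hx.memLp l)
    have : ∀ ω, (x k ω - Γ k 0 * x 0 ω) * (x l ω - Γ l 0 * x 0 ω) =
        (x k ω * x l ω - Γ l 0 * (x k ω * x 0 ω)) -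
          (Γ k 0 * (x 0 ω * x l ω) - Γ k 0 * Γ l 0 * (x 0 ω * x 0 ω)) := fun ω => by ring
    simp only [this]
    rw [integral_sub_sub_sub (hi k l) ((hi k 0).const_mul _) ((hi 0 l).const_mul _)
      ((hi 0 0).const_mul _)]
    simp only [integral_const_mul, hx.pseudoCovariance]
    simp
  covariance k l := by
    have hi : ∀ k l, Integrable (fun ω => x k ω * conj (x l ω)) P := fun k l =>
      integrable_mul_conj (hx.memLp k) (hx.memLp l)
    have : ∀ ω, (x k ω - Γ k 0 * x 0 ω) * conj (x l ω - Γ l 0 * x 0 ω) =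
        (x k ω * conj (x l ω) - conj (Γ l 0) * (x k ω * conj (x 0 ω))) -
          (Γ k 0 * (x 0 ω * conj (x l ω)) -
            Γ k 0 * conj (Γ l 0) * (x 0 ω * conj (x 0 ω))) := fun ω => by
      simp only [map_sub, map_mul]; ring
    simp only [this]
    rw [integral_sub_sub_sub (hi k l) ((hi k 0).const_mul _) ((hi 0 l).const_mul _)
      ((hi 0 0).const_mul _)]
    simp only [integral_const_mul, hx.covariance, h00, hsym]
    ring

/-- The zeroth variable has zero covariance and zero pseudo-covariance with each residual. Adjoining
it to the residuals under an extra index gives a single Gaussian process, so it is independent of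
the whole residual sequence and not only of each term. -/
theorem indepFun_residual (hx : IsCircularGaussianSeq P x Γ) (h00 : Γ 0 0 = 1)
    (hsym : ∀ k l, conj (Γ k l) = Γ l k) :
    IndepFun (x 0) (fun ω k => x k ω - Γ k 0 * x 0 ω) P := by
  have := hx.gaussian.isProbabilityMeasure
  have hr := hx.residual h00 hsym
  have hproc : IsGaussianProcess (Sum.elim (fun _ : Unit => x 0)
      (fun k ω => x k ω - Γ k 0 * x 0 ω)) P := by
    refine hx.gaussian.of_isGaussianProcess fun s => ?_
    cases s with
    | inl _ =>
      let i : ↥({0} : Finset ℕ) := ⟨0, by simp⟩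
      exact ⟨{0}, ContinuousLinearMap.proj i, fun ω => by simp [i]⟩
    | inr k =>
      let L (i : ↥({k, 0} : Finset ℕ)) : (↥({k, 0} : Finset ℕ) → ℂ) →L[ℝ] ℂ := .proj i
      exact ⟨{k, 0}, L ⟨k, by simp⟩ - (ContinuousLinearMap.mul ℝ ℂ (Γ k 0)).comp (L ⟨0, by simp⟩),
        fun ω => by simp [L]⟩
  have hind := hproc.indepFun_of_covariance_inner (fun _ => hx.aemeasurable 0) hr.aemeasurable
    fun _ k u v => by
      refine covariance_inner_eq_zero (hx.memLp 0) (hr.memLp k) (hx.centered 0) ?_ ?_ u v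
      · have hi : ∀ l, Integrable (fun ω => x 0 ω * x l ω) P := fun l =>
          (hx.memLp 0).integrable_mul (hx.memLp l)
        have : ∀ ω, x 0 ω * (x k ω - Γ k 0 * x 0 ω) =
          x 0 ω * x k ω - Γ k 0 * (x 0 ω * x 0 ω) := fun ω => by ring
        simp only [this]
        rw [integral_sub (hi k) ((hi 0).const_mul _), integral_const_mul, hx.pseudoCovariance,
          hx.pseudoCovariance, mul_zero, sub_zero]
      · have hi : ∀ l, Integrable (fun ω => x 0 ω * conj (x l ω)) P := fun l =>
          integrable_mul_conj (hx.memLp 0) (hx.memLp l)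
        have : ∀ ω, x 0 ω * conj (x k ω - Γ k 0 * x 0 ω) =
          x 0 ω * conj (x k ω) - conj (Γ k 0) * (x 0 ω * conj (x 0 ω)) := fun ω => by
            simp only [map_sub, map_mul]; ring
        simp only [this]
        rw [integral_sub (hi k) ((hi 0).const_mul _), integral_const_mul, hx.covariance,
          hx.covariance, h00, hsym, mul_one, sub_self]
  exact hind.comp (measurable_pi_apply ()) measurable_id

/-- The coordinate process under the law of a circularly symmetric Gaussian sequence. -/
theorem map (hx : IsCircularGaussianSeq P x Γ) :
    IsCircularGaussianSeq (P.map fun ω k => x k ω) (fun k s => s k) Γ := by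
  have hm : AEMeasurable (fun ω k => x k ω) P := aemeasurable_pi_iff.2 hx.aemeasurable
  refine ⟨⟨fun I => ⟨?_⟩⟩, fun k => ?_, fun k l => ?_, fun k l => ?_⟩
  · rw [AEMeasurable.map_map_of_aemeasurable (by fun_prop) hm]
    exact (hx.gaussian.hasGaussianLaw I).isGaussian_map
  · rw [integral_map hm (measurable_pi_apply k).aestronglyMeasurable]
    exact hx.centered k
  · rw [integral_map hm (Measurable.aestronglyMeasurable (by fun_prop))]
    exact hx.pseudoCovariance k l
  · rw [integral_map hm (Measurable.aestronglyMeasurable (by fun_prop))]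
    exact hx.covariance k l

end IsCircularGaussianSeq

/-! ### Positivity of `G₂` -/

theorem covG_zero (γ : ℤ → ℂ) : covG γ 0 = 0 := by simp [covG]

theorem covG₂_self_eq (γ : ℤ → ℂ) (z : ℂ) : covG₂ γ z z = ((1 + 2 * (covG γ z).re : ℝ) : ℂ) := by
  rw [covG₂, add_assoc, Complex.add_conj]
  push_cast
  rfl

namespace IsStationaryComplexGaussian

variable {Ω : Type*} [MeasurableSpace Ω] {P : Measure Ω} {ξ : ℤ → Ω → ℂ} {γ : ℤ → ℂ}

/-- Nonnegativity holds because the quantity is `(1 - |z|²)` times a variance. So `1 + 2 G` maps the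
disk into the closed right half-plane: either it is constant, equal to its value 1 at the origin, or
its image is open and lies in the open half-plane. -/
theorem one_add_two_mul_re_covG_pos (hξ : IsStationaryComplexGaussian P ξ γ) {z : ℂ}
    (hz : z ∈ Metric.ball (0 : ℂ) 1) : 0 < 1 + 2 * (covG γ z).re := by
  have hnonneg : ∀ w ∈ Metric.ball (0 : ℂ) 1, 0 ≤ 1 + 2 * (covG γ w).re := by
    intro w hw
    have h := (hξ.isCircularGaussianSeq.covSum_self_nonneg (C := 1)
      (fun k l => hξ.norm_covariance_le _) (summable_norm_pow hw)).1
    have hw1 : ‖w‖ < 1 := by simpa using hw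
    have hq : 0 < 1 - ‖w‖ ^ 2 := by nlinarith [norm_nonneg w]
    rw [covSum_toeplitz_pow_pow hξ.unitVariance hξ.norm_covariance_le hξ.covariance_neg hw hw,
      covG₂_self_eq, Complex.mul_conj, Complex.normSq_eq_norm_sq, ← Complex.ofReal_one,
      ← Complex.ofReal_sub, ← Complex.ofReal_div, Complex.ofReal_re] at h
    by_contra hneg
    exact absurd h (not_le.2 (div_neg_of_neg_of_pos (not_le.1 hneg) hq))
  have hd : DifferentiableOn ℂ (fun z => 1 + 2 * covG γ z) (Metric.ball 0 1) :=
    ((differentiableOn_covG hξ.unitVariance hξ.norm_covariance_le).const_mul 2).const_add 1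
  have h0 : (0 : ℂ) ∈ Metric.ball (0 : ℂ) 1 := Metric.mem_ball_self one_pos
  rcases (hd.analyticOnNhd Metric.isOpen_ball).is_constant_or_isOpen
    (convex_ball 0 1).isPreconnected with ⟨c, hc⟩ | hopen
  · have h1 := hc z hz
    rw [← hc 0 h0, covG_zero] at h1
    have h2 := congrArg Complex.re h1
    simp at h2
    rw [h2]
    norm_num
  · have himg := hopen _ subset_rfl Metric.isOpen_ball
    have hmem : (1 + 2 * covG γ z) ∈ interior {w : ℂ | 0 ≤ w.re} := by
      refine interior_mono ?_ (himg.interior_eq.symm ▸ Set.mem_image_of_mem _ hz)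
      rintro _ ⟨w, hw, rfl⟩
      simpa using hnonneg w hw
    rw [Complex.interior_setOfPred_le_re] at hmem
    simpa using hmem

theorem covG₂_ne_zero (hξ : IsStationaryComplexGaussian P ξ γ) {z : ℂ}
    (hz : z ∈ Metric.ball (0 : ℂ) 1) : covG₂ γ z z ≠ 0 := by
  rw [covG₂_self_eq, Complex.ofReal_ne_zero]
  exact (hξ.one_add_two_mul_re_covG_pos hz).ne'

theorem one_add_covG_ne_zero (hξ : IsStationaryComplexGaussian P ξ γ) {z : ℂ}
    (hz : z ∈ Metric.ball (0 : ℂ) 1) : 1 + covG γ z ≠ 0 := by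
  intro h
  have h1 := congrArg Complex.re h
  have h2 := hξ.one_add_two_mul_re_covG_pos hz
  simp at h1
  linarith

end IsStationaryComplexGaussian

/-! ### The mean number of zeros as an area integral -/

/-- `π` times the density of the mean number of zeros. -/
noncomputable def zeroDensity (γ : ℤ → ℂ) (z : ℂ) : ℝ :=
  1 / (1 - ‖z‖ ^ 2) ^ 2 - (‖deriv (covG γ) z‖ / (1 + 2 * (covG γ z).re)) ^ 2

/-- Here `q = 1 - |z|²`, `S = G₂(z,z)`, `A = G'(z)`, `a = 1/(1+G)`, `b = a'`, and primed letters
stand for conjugates. The left side is `∂∂̄ log (|a|² S/q)` written out, and `log |a|²` is harmonic,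
which is why `a` and `b` cancel. -/
theorem gaussian_jacobian_identity {a a' b b' q S A A' z z' : ℂ} (ha : a ≠ 0) (ha' : a' ≠ 0)
    (hq : q ≠ 0) (hS : S ≠ 0) (hz : z * z' = 1 - q) :
    (a * a' * ((z' * A' + z * A + S) / q ^ 2 + 2 * z * z' * S / q ^ 3) +
      a * b' * (A / q + z' * S / q ^ 2) + b * a' * (A' / q + z * S / q ^ 2) +
      b * b' * (S / q)) / (a * a' * (S / q)) -
    (a * a' * (A / q + z' * S / q ^ 2) + b * a' * (S / q)) *
      (a * a' * (A' / q + z * S / q ^ 2) + a * b' * (S / q)) / (a * a' * (S / q)) ^ 2 =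
    1 / q ^ 2 - A * A' / S ^ 2 := by
  have h : 1 / q ^ 2 - A * A' / S ^ 2 = 1 / q + z * z' / q ^ 2 - A * A' / S ^ 2 := by
    rw [hz]
    field_simp
    ring
  rw [h]
  field_simp
  ring

namespace IsStationaryComplexGaussian

variable {Ω : Type*} [MeasurableSpace Ω] {P : Measure Ω} {ξ : ℤ → Ω → ℂ} {γ : ℤ → ℂ}

/-- The integral over the residuals of the Gaussian density along `h = F / (1 + G)`, where `F` is
the power series of the residuals, times the Jacobian `‖h'‖ ^ 2`. -/
theorem integral_exp_neg_norm_sq_residual (hξ : IsStationaryComplexGaussian P ξ γ) {z : ℂ}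
    (hz : z ∈ Metric.ball (0 : ℂ) 1) {Ω' : Type*} [MeasurableSpace Ω'] {Q : Measure Ω'}
    {x : ℕ → Ω' → ℂ} (hx : IsCircularGaussianSeq Q x
      (fun k l => toeplitz γ k l - conj (γ k) * conj (conj (γ l)))) {a b : ℂ}
    (ha : a = (1 + covG γ z)⁻¹) (hb : b = -deriv (covG γ) z / (1 + covG γ z) ^ 2) :
    Integrable (fun ω => Real.exp (-‖∑' k : ℕ, a * z ^ k * x k ω‖ ^ 2) *
      ‖∑' k : ℕ, (a * (k * z ^ (k - 1)) + b * z ^ k) * x k ω‖ ^ 2) Q ∧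
    ∫ ω, Real.exp (-‖∑' k : ℕ, a * z ^ k * x k ω‖ ^ 2) *
      ‖∑' k : ℕ, (a * (k * z ^ (k - 1)) + b * z ^ k) * x k ω‖ ^ 2 ∂Q = zeroDensity γ z := by
  have h0 := hξ.unitVariance
  have hγ := hξ.norm_covariance_le
  have hsym := hξ.covariance_neg
  have hT : ∀ k l, ‖toeplitz γ k l‖ ≤ 1 := fun k l => hγ _
  have hc : ∀ k : ℕ, ‖conj (γ k)‖ ≤ 1 := fun k => by simpa using hγ k
  have hΓ : ∀ k l : ℕ, ‖toeplitz γ k l - conj (γ k) * conj (conj (γ l))‖ ≤ 1 + 1 * 1 := fun k l =>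
    (norm_sub_le _ _).trans (add_le_add (hT k l) (by
      rw [norm_mul]
      exact mul_le_mul (hc k) (by simpa using hγ l) (norm_nonneg _) zero_le_one))
  have hg := hξ.one_add_covG_ne_zero hz
  have sp := summable_norm_pow hz
  have sd := summable_norm_deriv_pow hz
  have su : Summable fun k : ℕ => ‖a * z ^ k‖ := by
    simpa only [norm_mul] using sp.mul_left ‖a‖
  have sv : Summable fun k : ℕ => ‖a * (k * z ^ (k - 1)) + b * z ^ k‖ :=
    Summable.of_nonneg_of_le (fun _ => norm_nonneg _)
      (fun k => (norm_add_le _ _).trans_eq (by rw [norm_mul a, norm_mul b]))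
      ((sd.mul_left ‖a‖).add (sp.mul_left ‖b‖))
  obtain ⟨hint, hval⟩ := hx.integral_exp_neg_norm_sq_mul_norm_sq_tsum hΓ su sv
  refine ⟨hint, ?_⟩
  have scp : Summable fun k : ℕ => conj (γ k) * z ^ k := summable_mul_pow_of_bounded hc hz
  have scd : Summable fun k : ℕ => conj (γ k) * (k * z ^ (k - 1)) :=
    (hasDerivAt_tsum_mul_pow (fun w hw => summable_mul_pow_of_bounded hc hw) hz).1
  -- The residual covariance is the Toeplitz one minus a rank one term. Its defining functional
  -- takes the value 1 on the coefficients of `h` and 0 on those of `h'`, because `a (1 + G) = 1`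
  -- identically. So `1 +` the residual variance of `h` is the unreduced variance, and the
  -- covariances involving `h'` are unchanged.
  have hcu : ∑' k : ℕ, conj (γ k) * (a * z ^ k) = 1 := by
    have : ∀ k : ℕ, conj (γ k) * (a * z ^ k) = a * (conj (γ k) * z ^ k) := fun k => by ring
    simp only [this]
    rw [tsum_mul_left, ← one_add_covG_eq_tsum h0 hγ hz, ha, inv_mul_cancel₀ hg]
  have hcv : ∑' k : ℕ, conj (γ k) * (a * (k * z ^ (k - 1)) + b * z ^ k) = 0 := by
    have : ∀ k : ℕ, conj (γ k) * (a * (k * z ^ (k - 1)) + b * z ^ k) =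
      a * (conj (γ k) * (k * z ^ (k - 1))) + b * (conj (γ k) * z ^ k) := fun k => by ring
    simp only [this]
    rw [(scd.mul_left a).tsum_add (scp.mul_left b), tsum_mul_left, tsum_mul_left,
      ← one_add_covG_eq_tsum h0 hγ hz, ← deriv_covG_eq_tsum h0 hγ hz, ha, hb]
    field_simp
    ring
  -- A vacuous second term, so that the two-term linearity lemmas apply.
  have hu' : (fun k : ℕ => a * z ^ k) = fun k : ℕ => a * z ^ k + 0 * z ^ k := by
    ext k; ring
  rw [covSum_sub_rankOne hT hc su su, covSum_sub_rankOne hT hc sv sv,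
    covSum_sub_rankOne hT hc su sv, covSum_sub_rankOne hT hc sv su, hcu, hcv] at hval
  simp only [map_one, map_zero, mul_zero, mul_one, sub_zero, add_sub_cancel] at hval
  have hzz := covSum_toeplitz_pow_pow h0 hγ hsym hz hz
  have hdz := covSum_toeplitz_deriv_pow h0 hγ hsym hz hz
  have hdd := covSum_toeplitz_deriv_deriv h0 hγ hsym hz
  have hTs : ∀ k l, conj (toeplitz γ k l) = toeplitz γ l k := fun k l => by
    rw [toeplitz, toeplitz, ← hsym, neg_sub]
  have hzd := covSum_conj_symm hTs (fun k : ℕ => (k : ℂ) * z ^ (k - 1)) (fun k : ℕ => z ^ k)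
  rw [hdz] at hzd
  have hS : conj (covG₂ γ z z) = covG₂ γ z z := by rw [covG₂_self_eq, Complex.conj_ofReal]
  simp only [map_add, map_div₀, map_mul, map_sub, map_one, map_pow, Complex.conj_conj, hS] at hzd
  have hq := one_sub_mul_conj_ne_zero hz hz
  have hSne := hξ.covG₂_ne_zero hz
  rw [mul_comm (conj z) z] at hzd
  have hane : a ≠ 0 := ha ▸ inv_ne_zero hg
  have hane' : conj a ≠ 0 := (map_ne_zero _).2 hane
  have huu : covSum (toeplitz γ) (fun k : ℕ => a * z ^ k) (fun k : ℕ => a * z ^ k) =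
      a * conj a * (covG₂ γ z z / (1 - z * conj z)) := by
    rw [hu', covSum_linear_left hT sp sp (by simpa using su),
      covSum_linear_right hT sp sp sp, hzz, map_zero]
    ring
  have hvu : covSum (toeplitz γ) (fun k : ℕ => a * (k * z ^ (k - 1)) + b * z ^ k)
      (fun k : ℕ => a * z ^ k) =
      a * conj a * (deriv (covG γ) z / (1 - z * conj z) +
        conj z * covG₂ γ z z / (1 - z * conj z) ^ 2) +
      b * conj a * (covG₂ γ z z / (1 - z * conj z)) := by
    rw [hu', covSum_linear_left hT sd sp (by simpa using su),
      covSum_linear_right hT sp sp sp, covSum_linear_right hT sp sp sd, hzz, hdz, map_zero]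
    ring
  have huv : covSum (toeplitz γ) (fun k : ℕ => a * z ^ k)
      (fun k : ℕ => a * (k * z ^ (k - 1)) + b * z ^ k) =
      a * conj a * (conj (deriv (covG γ) z) / (1 - z * conj z) +
        z * covG₂ γ z z / (1 - z * conj z) ^ 2) +
      a * conj b * (covG₂ γ z z / (1 - z * conj z)) := by
    rw [hu', covSum_linear_left hT sp sp sv, covSum_linear_right hT sd sp sp, hzz, ← hzd]
    ring
  have hvv : covSum (toeplitz γ) (fun k : ℕ => a * (k * z ^ (k - 1)) + b * z ^ k)
      (fun k : ℕ => a * (k * z ^ (k - 1)) + b * z ^ k) =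
      a * conj a * ((conj z * conj (deriv (covG γ) z) + z * deriv (covG γ) z + covG₂ γ z z) /
        (1 - z * conj z) ^ 2 + 2 * z * conj z * covG₂ γ z z / (1 - z * conj z) ^ 3) +
      a * conj b * (deriv (covG γ) z / (1 - z * conj z) +
        conj z * covG₂ γ z z / (1 - z * conj z) ^ 2) +
      b * conj a * (conj (deriv (covG γ) z) / (1 - z * conj z) +
        z * covG₂ γ z z / (1 - z * conj z) ^ 2) +
      b * conj b * (covG₂ γ z z / (1 - z * conj z)) := by
    rw [covSum_linear_left hT sd sp sv, covSum_linear_right hT sd sp sp,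
      covSum_linear_right hT sd sp sd, hzz, hdz, hdd, ← hzd]
    ring
  have key : (((∫ ω, Real.exp (-‖∑' k : ℕ, a * z ^ k * x k ω‖ ^ 2) *
      ‖∑' k : ℕ, (a * (k * z ^ (k - 1)) + b * z ^ k) * x k ω‖ ^ 2 ∂Q) : ℝ) : ℂ) =
      1 / (1 - z * conj z) ^ 2 -
        deriv (covG γ) z * conj (deriv (covG γ) z) / covG₂ γ z z ^ 2 := by
    rw [hval, huv, hvu, hvv, huu]
    exact gaussian_jacobian_identity hane hane' hq hSne (by ring)
  have hfin : ((zeroDensity γ z : ℝ) : ℂ) = 1 / (1 - z * conj z) ^ 2 -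
        deriv (covG γ) z * conj (deriv (covG γ) z) / covG₂ γ z z ^ 2 := by
    rw [covG₂_self_eq, Complex.mul_conj, Complex.mul_conj, Complex.normSq_eq_norm_sq,
      Complex.normSq_eq_norm_sq, zeroDensity, div_pow]
    push_cast
    ring
  exact_mod_cast key.trans hfin.symm

end IsStationaryComplexGaussian

namespace IsStationaryComplexGaussian

variable {Ω : Type*} [MeasurableSpace Ω] {P : Measure Ω} {ξ : ℤ → Ω → ℂ} {γ : ℤ → ℂ}

theorem ae_summable (hξ : IsStationaryComplexGaussian P ξ γ) :
    ∀ᵐ ω ∂P, ∀ z ∈ Metric.ball (0 : ℂ) 1, Summable fun k : ℕ => ξ k ω * z ^ k :=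
  hξ.isCircularGaussianSeq.ae_summable_pow (C := 1) fun _ _ => hξ.norm_covariance_le _

theorem aemeasurable_zeroCount (hξ : IsStationaryComplexGaussian P ξ γ) {D : Set ℂ}
    (hD : IsOpen D) (hDb : D ⊆ Metric.ball 0 1) : AEMeasurable (zeroCount ξ D) P :=
  aemeasurable_encard_zeros hξ.isCircularGaussianSeq.aemeasurable hξ.ae_summable hD hDb

/-- Integration over the first coefficient, for fixed residuals `s`. -/
theorem lintegral_encard_zeros_residual (hξ : IsStationaryComplexGaussian P ξ γ) {D : Set ℂ}
    (hD : IsOpen D) (hDb : D ⊆ Metric.ball 0 1) {s : ℕ → ℂ}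
    (hs : ∀ z ∈ Metric.ball (0 : ℂ) 1, Summable fun k => s k * z ^ k) {G : ℂ → ℝ≥0∞}
    (hG : Measurable G) {g g' : ℂ → ℂ} (hg : g = fun z => ∑' k : ℕ, conj (γ k) * z ^ k)
    (hg' : g' = fun z => ∑' k : ℕ, conj (γ k) * (k * z ^ (k - 1))) :
    ∫⁻ w, G w * ({z ∈ D | ∑' k : ℕ, (w * conj (γ k) + s k) * z ^ k = 0}.encard : ℝ≥0∞) =
      ∫⁻ z in D, ENNReal.ofReal
        (‖∑' k : ℕ, ((g z)⁻¹ * (k * z ^ (k - 1)) + -g' z / g z ^ 2 * z ^ k) * s k‖ ^ 2) *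
        G (-∑' k : ℕ, (g z)⁻¹ * z ^ k * s k) := by
  have hγ := hξ.norm_covariance_le
  have h0 := hξ.unitVariance
  have hc : ∀ k : ℕ, ‖conj (γ k)‖ ≤ 1 := fun k => by simpa using hγ k
  have hgm : Measurable g := by subst hg; exact Measurable.tsum fun k => by fun_prop
  have hgm' : Measurable g' := by subst hg'; exact Measurable.tsum fun k => by fun_prop
  have hgc : ∀ z ∈ Metric.ball (0 : ℂ) 1, g z ≠ 0 := fun z hz => by
    rw [hg]
    simp only
    rw [← one_add_covG_eq_tsum h0 hγ hz]
    exact hξ.one_add_covG_ne_zero hz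
  have hcs : ∀ z ∈ Metric.ball (0 : ℂ) 1, Summable fun k : ℕ => conj (γ k) * z ^ k :=
    fun z hz => summable_mul_pow_of_bounded hc hz
  have hgd : ∀ z ∈ Metric.ball (0 : ℂ) 1, HasDerivAt g (g' z) z := fun z hz => by
    subst hg hg'
    exact (hasDerivAt_tsum_mul_pow hcs hz).2
  -- Dividing `w (1 + G) + F = 0` by the nonvanishing `1 + G` turns the zeros into the fibre of `h =
  -- -F / (1 + G)` over `w`.
  let h : ℂ → ℂ := fun z => -∑' k : ℕ, (g z)⁻¹ * z ^ k * s k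
  let h' : ℂ → ℂ := fun z =>
    -∑' k : ℕ, ((g z)⁻¹ * (k * z ^ (k - 1)) + -g' z / g z ^ 2 * z ^ k) * s k
  have hh : h = fun z => -((∑' k : ℕ, s k * z ^ k) / g z) := by
    funext z
    have : ∀ k : ℕ, (g z)⁻¹ * z ^ k * s k = (g z)⁻¹ * (s k * z ^ k) := fun k => by ring
    simp only [h, this]
    rw [tsum_mul_left, div_eq_inv_mul]
  have hd : ∀ z ∈ D, HasDerivAt h (h' z) z := fun z hz => by
    have hz := hDb hz
    obtain ⟨hss, hsd⟩ := hasDerivAt_tsum_mul_pow hs hz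
    rw [hh]
    refine HasDerivAt.congr_deriv (hsd.div (hgd z hz) (hgc z hz)).neg ?_
    have : ∀ k : ℕ, ((g z)⁻¹ * (k * z ^ (k - 1)) + -g' z / g z ^ 2 * z ^ k) * s k =
      (g z)⁻¹ * (s k * (k * z ^ (k - 1))) + -g' z / g z ^ 2 * (s k * z ^ k) := fun k => by ring
    simp only [h', this]
    rw [(hss.mul_left _).tsum_add ((hs z hz).mul_left _), tsum_mul_left, tsum_mul_left]
    have := hgc z hz
    field_simp
    ring
  have hset : ∀ w, {z ∈ D | ∑' k : ℕ, (w * conj (γ k) + s k) * z ^ k = 0} = {z ∈ D | h z = w} := by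
    intro w
    ext z
    refine and_congr_right fun hz => ?_
    have hz := hDb hz
    have : ∀ k : ℕ, (w * conj (γ k) + s k) * z ^ k = w * (conj (γ k) * z ^ k) + s k * z ^ k :=
      fun k => by ring
    simp only [this]
    rw [((hcs z hz).mul_left w).tsum_add (hs z hz), tsum_mul_left, hh]
    have h1 := hgc z hz
    have h2 : ∑' k : ℕ, conj (γ k) * z ^ k = g z := by rw [hg]
    simp only
    rw [h2, ← neg_div, div_eq_iff h1]
    constructor
    · intro h; linear_combination -h
    · intro h; linear_combination -h
  have key := lintegral_density_mul_encard hD (h := h) (h' := h')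
    (Measurable.neg (Measurable.tsum fun k => by fun_prop))
    (Measurable.neg (Measurable.tsum fun k => by fun_prop)) hd hG
  simp only [hset, key, h', norm_neg]
  rfl

/-- The mean number of zeros is the integral of its density. -/
theorem lintegral_zeroCount (hξ : IsStationaryComplexGaussian P ξ γ) {D : Set ℂ}
    (hD : IsOpen D) (hDb : D ⊆ Metric.ball 0 1) :
    (∀ z ∈ D, 0 ≤ zeroDensity γ z) ∧
      ∫⁻ ω, zeroCount ξ D ω ∂P = ∫⁻ z in D, ENNReal.ofReal (Real.pi⁻¹ * zeroDensity γ z) := by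
  have hprob := hξ.gaussian.isProbabilityMeasure
  have hγ := hξ.norm_covariance_le
  have h0 := hξ.unitVariance
  have hsym := hξ.covariance_neg
  have hY := hξ.isCircularGaussianSeq
  have h00 : toeplitz γ 0 0 = 1 := by simp [toeplitz, h0]
  have hTs : ∀ k l, conj (toeplitz γ k l) = toeplitz γ l k := fun k l => by
    rw [toeplitz, toeplitz, ← hsym, neg_sub]
  have hT0 : ∀ k : ℕ, toeplitz γ k 0 = conj (γ k) := fun k => by
    rw [toeplitz, ← hsym, Nat.cast_zero, zero_sub]
  have hX := hY.residual h00 hTs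
  have hind := hY.indepFun_residual h00 hTs
  simp only [hT0] at hX hind
  set X : Ω → ℕ → ℂ := fun ω k => ξ k ω - conj (γ k) * ξ (0 : ℕ) ω with hXdef
  have hXm : AEMeasurable X P := aemeasurable_pi_iff.2 hX.aemeasurable
  have h0m : AEMeasurable (ξ (0 : ℕ)) P := hY.aemeasurable 0
  have hQ := hX.map
  change IsCircularGaussianSeq (P.map X) _ _ at hQ
  set Q := P.map X with hQdef
  have hQp : IsProbabilityMeasure Q := Measure.isProbabilityMeasure_map hXm
  have hμp : IsProbabilityMeasure (P.map (ξ (0 : ℕ))) := Measure.isProbabilityMeasure_map h0m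
  have hΓ : ∀ k l : ℕ, ‖toeplitz γ k l - conj (γ k) * conj (conj (γ l))‖ ≤ 1 + 1 * 1 := fun k l =>
    (norm_sub_le _ _).trans (add_le_add (hγ _) (by
      rw [norm_mul]
      exact mul_le_mul (by simpa using hγ k) (by simpa using hγ l) (norm_nonneg _) zero_le_one))
  have hgood := hQ.ae_summable_pow hΓ
  have hjoint : P.map (fun ω => (ξ (0 : ℕ) ω, X ω)) = (P.map (ξ (0 : ℕ))).prod Q :=
    (indepFun_iff_map_prod_eq_prod_map_map h0m hXm).1 hind
  -- The zero count as a function of the first coefficient and of the residual sequence.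
  let N : ℂ × (ℕ → ℂ) → ℝ≥0∞ := fun p =>
    ({z ∈ D | ∑' k : ℕ, (p.1 * conj (γ k) + p.2 k) * z ^ k = 0}.encard : ℝ≥0∞)
  have hN : AEMeasurable N ((P.map (ξ (0 : ℕ))).prod Q) := by
    refine aemeasurable_encard_zeros (a := fun k (p : ℂ × (ℕ → ℂ)) => p.1 * conj (γ k) + p.2 k)
      (fun k => Measurable.aemeasurable (by fun_prop)) ?_ hD hDb
    filter_upwards [Measure.quasiMeasurePreserving_snd.ae hgood] with p hp z hz
    have h1 : Summable fun k : ℕ => conj (γ k) * z ^ k :=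
      summable_mul_pow_of_bounded (C := 1) (fun k => by simpa using hγ k) hz
    refine ((h1.mul_left p.1).add (hp z hz)).congr fun k => ?_
    ring
  have hlaw : P.map (ξ (0 : ℕ)) =
      volume.withDensity fun w => ENNReal.ofReal (complexGaussianDensity 1 w) :=
    map_eq_withDensity_of_circular (hY.gaussian.hasGaussianLaw_eval 0) (hY.centered 0)
      (hY.pseudoCovariance 0 0) one_pos (hξ.integral_norm_sq _)
  have hGm : Measurable fun w => ENNReal.ofReal (complexGaussianDensity 1 w) := by
    unfold complexGaussianDensity
    fun_prop
  let g : ℂ → ℂ := fun z => ∑' k : ℕ, conj (γ k) * z ^ k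
  let g' : ℂ → ℂ := fun z => ∑' k : ℕ, conj (γ k) * (k * z ^ (k - 1))
  have hgm : Measurable g := Measurable.tsum fun k => by fun_prop
  have hgm' : Measurable g' := Measurable.tsum fun k => by fun_prop
  let A : (ℕ → ℂ) × ℂ → ℂ := fun p => ∑' k : ℕ, (g p.2)⁻¹ * p.2 ^ k * p.1 k
  let B : (ℕ → ℂ) × ℂ → ℂ := fun p =>
    ∑' k : ℕ, ((g p.2)⁻¹ * (k * p.2 ^ (k - 1)) + -g' p.2 / g p.2 ^ 2 * p.2 ^ k) * p.1 k
  -- The sums are taken at every `z` and every `s`, convergent or not, so that joint measurability,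
  -- needed for Tonelli, is immediate.
  have hA : Measurable A := Measurable.tsum fun k => by fun_prop
  have hB : Measurable B := Measurable.tsum fun k => by fun_prop
  have hval : ∀ z ∈ D, 0 ≤ zeroDensity γ z ∧ ∫⁻ s, ENNReal.ofReal (‖B (s, z)‖ ^ 2) *
      ENNReal.ofReal (complexGaussianDensity 1 (-A (s, z))) ∂Q =
        ENNReal.ofReal (Real.pi⁻¹ * zeroDensity γ z) := by
    intro z hz
    have hz := hDb hz
    obtain ⟨h1, h2⟩ := hξ.integral_exp_neg_norm_sq_residual hz hQ (a := (g z)⁻¹)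
      (b := -g' z / g z ^ 2) (by rw [one_add_covG_eq_tsum h0 hγ hz])
      (by rw [one_add_covG_eq_tsum h0 hγ hz, deriv_covG_eq_tsum h0 hγ hz])
    refine ⟨h2 ▸ integral_nonneg fun _ => by positivity, ?_⟩
    rw [← h2, ← integral_const_mul, ofReal_integral_eq_lintegral_ofReal (h1.const_mul _)
      (ae_of_all _ fun _ => by positivity)]
    refine lintegral_congr fun s => ?_
    rw [← ENNReal.ofReal_mul (by positivity), complexGaussianDensity, norm_neg, mul_one, div_one]
    congr 1
    simp only [A, B]
    ring
  refine ⟨fun z hz => (hval z hz).1, ?_⟩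
  calc ∫⁻ ω, zeroCount ξ D ω ∂P = ∫⁻ ω, N (ξ (0 : ℕ) ω, X ω) ∂P := by
        refine lintegral_congr fun ω => ?_
        simp only [N, zeroCount, randomSeries, hXdef]
        congr 3
        ext z
        refine and_congr_right fun _ => ?_
        refine Eq.congr_left (tsum_congr fun k => ?_)
        ring
    _ = ∫⁻ p, N p ∂((P.map (ξ (0 : ℕ))).prod Q) := by
        rw [← hjoint] at hN ⊢
        exact (lintegral_map' hN (h0m.prodMk hXm)).symm
    _ = ∫⁻ s, ∫⁻ w, N (w, s) ∂(P.map (ξ (0 : ℕ))) ∂Q := lintegral_prod_symm _ hN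
    _ = ∫⁻ s, (∫⁻ z in D, ENNReal.ofReal (‖B (s, z)‖ ^ 2) *
          ENNReal.ofReal (complexGaussianDensity 1 (-A (s, z)))) ∂Q := by
        refine lintegral_congr_ae ?_
        filter_upwards [hgood] with s hs
        -- `N` is only almost everywhere measurable on the product, so its section at a given `s`
        -- may fail to be measurable; finiteness of the density makes this harmless.
        rw [hlaw, lintegral_withDensity_eq_lintegral_mul_non_measurable _ hGm
          (ae_of_all _ fun _ => ENNReal.ofReal_lt_top)]
        exact hξ.lintegral_encard_zeros_residual hD hDb hs hGm rfl rfl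
    _ = ∫⁻ z in D, (∫⁻ s, ENNReal.ofReal (‖B (s, z)‖ ^ 2) *
          ENNReal.ofReal (complexGaussianDensity 1 (-A (s, z))) ∂Q) := by
        refine lintegral_lintegral_swap (Measurable.aemeasurable ?_)
        exact (hB.norm.pow_const 2).ennreal_ofReal.mul (hGm.comp hA.neg)
    _ = _ := setLIntegral_congr_fun hD.measurableSet fun z hz => (hval z hz).2

end IsStationaryComplexGaussian

/-! ### The contour integrals -/

theorem hasFDerivAt_conj (z : ℂ) :
    HasFDerivAt (fun w : ℂ => conj w) Complex.conjCLE.toContinuousLinearMap z :=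
  Complex.conjCLE.hasFDerivAt

theorem one_sub_norm_sq_eq (z : ℂ) : 1 - (‖z‖ : ℂ) ^ 2 = 1 - z * conj z := by
  rw [Complex.mul_conj, Complex.normSq_eq_norm_sq]
  push_cast
  rfl

theorem contDiffOn_conj_div :
    ContDiffOn ℝ 1 (fun z : ℂ => conj z / (1 - (‖z‖ : ℂ) ^ 2)) (Metric.ball 0 1) := by
  simp only [one_sub_norm_sq_eq, div_eq_mul_inv]
  have hc : ContDiff ℝ 1 fun z : ℂ => conj z := Complex.conjCLE.contDiff
  exact hc.contDiffOn.mul ((contDiff_const.sub (contDiff_id.mul hc)).contDiffOn.inv fun z hz =>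
    one_sub_mul_conj_ne_zero hz hz)

/-- The operator `I ∂_x - ∂_y` from Green's theorem is `2i ∂̄`, and `∂̄ (conj z / (1 - z conj z)) =
1 / (1 - z conj z)²`. -/
theorem fderiv_conj_div {z : ℂ} (hz : z ∈ Metric.ball (0 : ℂ) 1) :
    Complex.I * fderiv ℝ (fun z : ℂ => conj z / (1 - (‖z‖ : ℂ) ^ 2)) z 1 -
      fderiv ℝ (fun z : ℂ => conj z / (1 - (‖z‖ : ℂ) ^ 2)) z Complex.I =
      2 * Complex.I * (1 / (1 - (‖z‖ : ℂ) ^ 2) ^ 2) := by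
  simp only [one_sub_norm_sq_eq, div_eq_mul_inv (conj _)]
  have hq := one_sub_mul_conj_ne_zero hz hz
  have h1 : HasFDerivAt (fun z : ℂ => 1 - z * conj z) _ z :=
    ((hasFDerivAt_id z).mul (hasFDerivAt_conj z)).const_sub (1 : ℂ)
  have h2 := HasFDerivAt.comp (f := fun z : ℂ => 1 - z * conj z) z
    ((hasDerivAt_inv hq).hasFDerivAt.restrictScalars ℝ) h1
  have h3 : HasFDerivAt (fun z : ℂ => conj z * (1 - z * conj z)⁻¹) _ z :=
    (hasFDerivAt_conj z).mul h2
  rw [h3.fderiv]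
  simp
  field_simp
  ring

namespace IsStationaryComplexGaussian

variable {Ω : Type*} [MeasurableSpace Ω] {P : Measure Ω} {ξ : ℤ → Ω → ℂ} {γ : ℤ → ℂ}

theorem differentiableOn_deriv_covG (hξ : IsStationaryComplexGaussian P ξ γ) :
    DifferentiableOn ℂ (deriv (covG γ)) (Metric.ball 0 1) :=
  (differentiableOn_covG hξ.unitVariance hξ.norm_covariance_le).deriv Metric.isOpen_ball

theorem contDiffOn_covG₂_self (hξ : IsStationaryComplexGaussian P ξ γ) :
    ContDiffOn ℝ 1 (fun z => covG₂ γ z z) (Metric.ball 0 1) := by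
  have h : ContDiffOn ℝ 1 (covG γ) (Metric.ball 0 1) :=
    ((differentiableOn_covG hξ.unitVariance hξ.norm_covariance_le).contDiffOn
      Metric.isOpen_ball).restrict_scalars ℝ
  exact (contDiffOn_const.add h).add (Complex.conjCLE.contDiff.comp_contDiffOn h)

theorem contDiffOn_deriv_div (hξ : IsStationaryComplexGaussian P ξ γ) :
    ContDiffOn ℝ 1 (fun z => deriv (covG γ) z / covG₂ γ z z) (Metric.ball 0 1) := by
  simp only [div_eq_mul_inv]
  exact ((hξ.differentiableOn_deriv_covG.contDiffOn Metric.isOpen_ball).restrict_scalars ℝ).mul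
    (hξ.contDiffOn_covG₂_self.inv fun _ hz => hξ.covG₂_ne_zero hz)

/-- Since `G` and `G'` are holomorphic, `∂̄` acts only on the summand `conj G` of `G₂`, which
produces `-G' conj(G') / G₂²`. -/
theorem fderiv_deriv_div (hξ : IsStationaryComplexGaussian P ξ γ) {z : ℂ}
    (hz : z ∈ Metric.ball (0 : ℂ) 1) :
    Complex.I * fderiv ℝ (fun z => deriv (covG γ) z / covG₂ γ z z) z 1 -
      fderiv ℝ (fun z => deriv (covG γ) z / covG₂ γ z z) z Complex.I =
      -(2 * Complex.I * ((‖deriv (covG γ) z‖ : ℂ) / covG₂ γ z z) ^ 2) := by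
  have hS := hξ.covG₂_ne_zero hz
  simp only [div_eq_mul_inv (deriv _ _)]
  have hG : HasFDerivAt (covG γ) _ z :=
    ((hasDerivAt_covG hξ.unitVariance hξ.norm_covariance_le hz).hasFDerivAt).restrictScalars ℝ
  have hG' : HasFDerivAt (deriv (covG γ)) _ z :=
    ((hξ.differentiableOn_deriv_covG.differentiableAt
      (Metric.isOpen_ball.mem_nhds hz)).hasDerivAt.hasFDerivAt).restrictScalars ℝ
  have h1 : HasFDerivAt (fun z => covG₂ γ z z) _ z :=
    (hG.const_add 1).add ((hasFDerivAt_conj _).comp z hG)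
  have h2 := HasFDerivAt.comp (f := fun z => covG₂ γ z z) z
    ((hasDerivAt_inv hS).hasFDerivAt.restrictScalars ℝ) h1
  have hn : (‖deriv (covG γ) z‖ : ℂ) ^ 2 = deriv (covG γ) z * conj (deriv (covG γ) z) := by
    rw [Complex.mul_conj, Complex.normSq_eq_norm_sq]
    push_cast
    rfl
  have h3 : HasFDerivAt (fun z => deriv (covG γ) z * (covG₂ γ z z)⁻¹) _ z := hG'.mul h2
  rw [h3.fderiv, div_pow, hn]
  simp
  field_simp
  ring_nf

theorem integrableOn_of_continuousOn_ball {D : Set ℂ} (hcl : closure D ⊆ Metric.ball 0 1)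
    {F : ℂ → ℂ} (hF : ContinuousOn F (Metric.ball 0 1)) : IntegrableOn F D := by
  have hb : Bornology.IsBounded (closure D) := Metric.isBounded_ball.subset hcl
  have hK : IsCompact (closure D) := Metric.isCompact_of_isClosed_isBounded isClosed_closure hb
  exact ((hF.mono hcl).integrableOn_compact hK).mono_set subset_closure

theorem continuousOn_norm_deriv_div_sq (hξ : IsStationaryComplexGaussian P ξ γ) :
    ContinuousOn (fun z => ((‖deriv (covG γ) z‖ : ℂ) / covG₂ γ z z) ^ 2) (Metric.ball 0 1) :=
  ((Complex.continuous_ofReal.comp_continuousOn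
    hξ.differentiableOn_deriv_covG.continuousOn.norm).div hξ.contDiffOn_covG₂_self.continuousOn
      fun _ hz => hξ.covG₂_ne_zero hz).pow 2

theorem continuousOn_one_div_sq :
    ContinuousOn (fun z : ℂ => 1 / (1 - (‖z‖ : ℂ) ^ 2) ^ 2) (Metric.ball 0 1) := by
  refine continuousOn_const.div (by fun_prop) fun z hz => ?_
  rw [one_sub_norm_sq_eq]
  exact pow_ne_zero 2 (one_sub_mul_conj_ne_zero hz hz)

/-- The mean number of zeros in a domain with smooth boundary. -/
theorem mean_zeroCount (hξ : IsStationaryComplexGaussian P ξ γ) {D : Set ℂ} (hD : IsOpen D)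
    (hcl : closure D ⊆ Metric.ball 0 1) (b : SmoothBoundary D) :
    AEMeasurable (zeroCount ξ D) P ∧
    ∫⁻ ω, zeroCount ξ D ω ∂P ≠ ∞ ∧
    ((∫⁻ ω, zeroCount ξ D ω ∂P).toReal : ℂ) =
      1 / (2 * Real.pi * Complex.I) *
          b.contourIntegral (fun z => conj z / (1 - (‖z‖ : ℂ) ^ 2)) +
        1 / (2 * Real.pi * Complex.I) *
          b.contourIntegral (fun z => deriv (covG γ) z / covG₂ γ z z) ∧
    IntegrableOn (fun z => ((‖deriv (covG γ) z‖ : ℂ) / covG₂ γ z z) ^ 2) D ∧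
    1 / (2 * Real.pi * Complex.I) *
        b.contourIntegral (fun z => deriv (covG γ) z / covG₂ γ z z) =
      -(1 / Real.pi) * ∫ z in D, ((‖deriv (covG γ) z‖ : ℂ) / covG₂ γ z z) ^ 2 := by
  have hDb : D ⊆ Metric.ball 0 1 := subset_closure.trans hcl
  have i1 := integrableOn_of_continuousOn_ball hcl continuousOn_one_div_sq
  have i2 := integrableOn_of_continuousOn_ball hcl hξ.continuousOn_norm_deriv_div_sq
  have hpi : (Real.pi : ℂ) ≠ 0 := Complex.ofReal_ne_zero.2 Real.pi_ne_zero
  have c1 : 1 / (2 * Real.pi * Complex.I) *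
      b.contourIntegral (fun z => conj z / (1 - (‖z‖ : ℂ) ^ 2)) =
      1 / Real.pi * ∫ z in D, 1 / (1 - (‖z‖ : ℂ) ^ 2) ^ 2 := by
    rw [b.contourIntegral_eq hD hcl contDiffOn_conj_div,
      setIntegral_congr_fun hD.measurableSet fun z hz => fderiv_conj_div (hDb hz),
      integral_const_mul]
    field_simp
  have c2 : 1 / (2 * Real.pi * Complex.I) *
      b.contourIntegral (fun z => deriv (covG γ) z / covG₂ γ z z) =
      -(1 / Real.pi) * ∫ z in D, ((‖deriv (covG γ) z‖ : ℂ) / covG₂ γ z z) ^ 2 := by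
    rw [b.contourIntegral_eq hD hcl hξ.contDiffOn_deriv_div,
      setIntegral_congr_fun hD.measurableSet fun z hz => hξ.fderiv_deriv_div (hDb hz),
      integral_neg, integral_const_mul]
    field_simp
  obtain ⟨hnn, hlint⟩ := hξ.lintegral_zeroCount hD hDb
  have hρ : ∀ z, ((zeroDensity γ z : ℝ) : ℂ) = 1 / (1 - (‖z‖ : ℂ) ^ 2) ^ 2 -
      ((‖deriv (covG γ) z‖ : ℂ) / covG₂ γ z z) ^ 2 := fun z => by
    rw [zeroDensity, covG₂_self_eq]
    push_cast
    rfl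
  have iρ : IntegrableOn (fun z => ((Real.pi⁻¹ * zeroDensity γ z : ℝ) : ℂ)) D := by
    refine ((i1.sub i2).const_mul (Real.pi⁻¹ : ℂ)).congr (ae_of_all _ fun z => ?_)
    simp only [Pi.sub_apply, Complex.ofReal_mul, hρ, Complex.ofReal_inv]
  have iρ' : IntegrableOn (fun z => Real.pi⁻¹ * zeroDensity γ z) D := by
    rw [IntegrableOn]
    simpa using Integrable.re iρ
  have hnn' : 0 ≤ᵐ[volume.restrict D] fun z => Real.pi⁻¹ * zeroDensity γ z := by
    filter_upwards [ae_restrict_mem hD.measurableSet] with z hz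
    have := hnn z hz
    positivity
  have hE : ∫⁻ ω, zeroCount ξ D ω ∂P =
      ENNReal.ofReal (∫ z in D, Real.pi⁻¹ * zeroDensity γ z) := by
    rw [hlint, ofReal_integral_eq_lintegral_ofReal iρ' hnn']
  refine ⟨hξ.aemeasurable_zeroCount hD hDb, hE ▸ ENNReal.ofReal_ne_top, ?_, i2, c2⟩
  rw [c1, c2, hE, ENNReal.toReal_ofReal (integral_nonneg_of_ae hnn'), ← integral_complex_ofReal]
  simp only [Complex.ofReal_mul, hρ, Complex.ofReal_inv]
  rw [integral_const_mul, integral_sub i1 i2]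
  ring

end IsStationaryComplexGaussian

/-! ### Disks -/

theorem hasDerivAt_circleParam (r t : ℝ) :
    HasDerivAt (fun t : ℝ => circleMap 0 r (2 * Real.pi * t))
      (2 * Real.pi * Complex.I * circleMap 0 r (2 * Real.pi * t)) t := by
  have h := (hasDerivAt_circleMap 0 r (2 * Real.pi * t)).scomp t
    ((hasDerivAt_id t).const_mul (2 * Real.pi))
  refine h.congr_deriv ?_
  simp
  ring

/-- The counterclockwise boundary of a disk. -/
noncomputable def ballBoundary {r : ℝ} (hr : 0 < r) : SmoothBoundary (Metric.ball (0 : ℂ) r) where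
  n := 1
  curve _ t := circleMap 0 r (2 * Real.pi * t)
  smooth _ := (contDiff_circleMap 0 r).comp (contDiff_const.mul contDiff_id)
  periodic _ t := by
    have := periodic_circleMap 0 r (2 * Real.pi * t)
    simpa only [mul_add, mul_one] using this
  regular _ t := by
    rw [(hasDerivAt_circleParam r t).deriv]
    simp [hr.ne', Real.pi_ne_zero]
  simple _ := by
    intro s hs t ht hst
    have hpi := Real.pi_pos
    have h := injOn_circleMap_of_abs_sub_le' (a := 0) (b := 2 * Real.pi) (c := 0) hr.ne'
      (by simp) (show 2 * Real.pi * s ∈ _ from ⟨by have := hs.1; positivity, by nlinarith [hs.2]⟩)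
      (show 2 * Real.pi * t ∈ _ from ⟨by have := ht.1; positivity, by nlinarith [ht.2]⟩) hst
    exact mul_left_cancel₀ (by positivity) h
  disjoint i j hij := absurd (Subsingleton.elim i j) hij
  frontier_eq := by
    rw [frontier_ball (0 : ℂ) hr.ne', Set.iUnion_const, ← abs_of_pos hr, ← range_circleMap,
      abs_of_pos hr]
    have : Function.Surjective fun t : ℝ => 2 * Real.pi * t :=
      mul_left_surjective₀ (by positivity)
    exact (this.range_comp (circleMap 0 r)).symm
  left_mem _ t := by
    have hpi := Real.pi_pos
    filter_upwards [Ioo_mem_nhdsGT (show (0 : ℝ) < 1 / (2 * Real.pi) by positivity)] with ε hε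
    rw [(hasDerivAt_circleParam r t).deriv, mem_ball_zero_iff]
    have : circleMap 0 r (2 * Real.pi * t) +
        ε * (Complex.I * (2 * Real.pi * Complex.I * circleMap 0 r (2 * Real.pi * t))) =
        ((1 - 2 * Real.pi * ε : ℝ) : ℂ) * circleMap 0 r (2 * Real.pi * t) := by
      push_cast
      linear_combination (2 * Real.pi * ε * circleMap 0 r (2 * Real.pi * t)) * Complex.I_sq
    have h1 := (lt_div_iff₀ (by positivity)).1 hε.2
    have h2 := hε.1
    rw [this, norm_mul, norm_circleMap_zero, abs_of_pos hr, Complex.norm_real,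
      Real.norm_of_nonneg (by linarith)]
    have : 0 < 2 * Real.pi * ε * r := by positivity
    nlinarith
  right_notMem _ t := by
    have hpi := Real.pi_pos
    filter_upwards [self_mem_nhdsWithin] with ε hε
    have hε : 0 < ε := hε
    rw [(hasDerivAt_circleParam r t).deriv, mem_ball_zero_iff]
    have : circleMap 0 r (2 * Real.pi * t) -
        ε * (Complex.I * (2 * Real.pi * Complex.I * circleMap 0 r (2 * Real.pi * t))) =
        ((1 + 2 * Real.pi * ε : ℝ) : ℂ) * circleMap 0 r (2 * Real.pi * t) := by
      push_cast
      linear_combination -(2 * Real.pi * ε * circleMap 0 r (2 * Real.pi * t)) * Complex.I_sq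
    rw [this, norm_mul, norm_circleMap_zero, abs_of_pos hr, Complex.norm_real,
      Real.norm_of_nonneg (by positivity), not_lt]
    have : 0 < 2 * Real.pi * ε * r := by positivity
    nlinarith

theorem contourIntegral_ballBoundary {r : ℝ} (hr : 0 < r) (F : ℂ → ℂ) :
    (ballBoundary hr).contourIntegral F = ∮ z in C(0, r), F z := by
  have h : (ballBoundary hr).contourIntegral F = ∫ t in (0 : ℝ)..1,
      F (circleMap 0 r (2 * Real.pi * t)) * deriv (fun t : ℝ => circleMap 0 r (2 * Real.pi * t)) t :=
    Fin.sum_univ_one _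
  have h2 := intervalIntegral.smul_integral_comp_mul_left (a := 0) (b := 1)
    (fun θ => deriv (circleMap 0 r) θ • F (circleMap 0 r θ)) (2 * Real.pi)
  rw [mul_zero, mul_one] at h2
  rw [h, circleIntegral, ← h2, ← intervalIntegral.integral_smul]
  refine intervalIntegral.integral_congr fun t _ => ?_
  simp only [(hasDerivAt_circleParam r t).deriv, deriv_circleMap, smul_eq_mul, Complex.real_smul]
  push_cast
  ring

/-- On the circle `z conj z = r²` and `dz` is a constant multiple of `z dt`, so the integrand is
constant. -/
theorem contourIntegral_ballBoundary_conj_div {r : ℝ} (hr : 0 < r) :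
    1 / (2 * Real.pi * Complex.I) *
      (ballBoundary hr).contourIntegral (fun z => conj z / (1 - (‖z‖ : ℂ) ^ 2)) =
      (r : ℂ) ^ 2 / (1 - (r : ℂ) ^ 2) := by
  have h : (ballBoundary hr).contourIntegral (fun z => conj z / (1 - (‖z‖ : ℂ) ^ 2)) =
      ∫ t in (0 : ℝ)..1, 2 * Real.pi * Complex.I * ((r : ℂ) ^ 2 / (1 - (r : ℂ) ^ 2)) := by
    refine (Fin.sum_univ_one _).trans (intervalIntegral.integral_congr fun t _ => ?_)
    have hz : circleMap 0 r (2 * Real.pi * t) * conj (circleMap 0 r (2 * Real.pi * t)) =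
        (r : ℂ) ^ 2 := by
      rw [Complex.mul_conj, Complex.normSq_eq_norm_sq, norm_circleMap_zero, sq_abs]
      push_cast
      rfl
    simp only [ballBoundary, (hasDerivAt_circleParam r t).deriv, norm_circleMap_zero,
      abs_of_pos hr, ← hz]
    ring
  have hpi : (Real.pi : ℂ) ≠ 0 := Complex.ofReal_ne_zero.2 Real.pi_ne_zero
  rw [h, intervalIntegral.integral_const, sub_zero, one_smul, ← mul_assoc,
    one_div_mul_cancel (by simp [hpi]), one_mul]

/-! ### Mean number of zeros in smooth domains and in centered disks -/

theorem corollary2p2 {Ω : Type*} [MeasurableSpace Ω] (P : Measure Ω) [IsProbabilityMeasure P]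
    (ξ : ℤ → Ω → ℂ) (γ : ℤ → ℂ) (hξ : IsStationaryComplexGaussian P ξ γ) :
    -- the power series converges almost surely in the unit disk
    (∀ᵐ ω ∂P, ∀ z ∈ Metric.ball (0 : ℂ) 1, Summable (fun k : ℕ => ξ (k : ℤ) ω * z ^ k)) ∧
    -- the denominators below do not vanish
    (∀ z ∈ Metric.ball (0 : ℂ) 1, covG₂ γ z z ≠ 0) ∧
    -- relatively compact domains of the unit disk with smooth boundary
    (∀ D : Set ℂ, IsOpen D → IsConnected D → closure D ⊆ Metric.ball 0 1 →
      ∀ b : SmoothBoundary D,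
        AEMeasurable (zeroCount ξ D) P ∧
        ∫⁻ ω, zeroCount ξ D ω ∂P ≠ ∞ ∧
        ((∫⁻ ω, zeroCount ξ D ω ∂P).toReal : ℂ) =
          1 / (2 * Real.pi * Complex.I) *
              b.contourIntegral (fun z => conj z / (1 - (‖z‖ : ℂ) ^ 2)) +
            1 / (2 * Real.pi * Complex.I) *
              b.contourIntegral (fun z => deriv (covG γ) z / covG₂ γ z z) ∧
        IntegrableOn (fun z => ((‖deriv (covG γ) z‖ : ℂ) / covG₂ γ z z) ^ 2) D ∧
        1 / (2 * Real.pi * Complex.I) *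
            b.contourIntegral (fun z => deriv (covG γ) z / covG₂ γ z z) =
          -(1 / Real.pi) * ∫ z in D, ((‖deriv (covG γ) z‖ : ℂ) / covG₂ γ z z) ^ 2) ∧
    -- disks centered at the origin
    (∀ r : ℝ, 0 < r → r < 1 →
      AEMeasurable (zeroCount ξ (Metric.ball 0 r)) P ∧
      ∫⁻ ω, zeroCount ξ (Metric.ball 0 r) ω ∂P ≠ ∞ ∧
      ((∫⁻ ω, zeroCount ξ (Metric.ball 0 r) ω ∂P).toReal : ℂ) =
        (r : ℂ) ^ 2 / (1 - (r : ℂ) ^ 2) +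
          1 / (2 * Real.pi * Complex.I) *
            ∮ z in C(0, r), deriv (covG γ) z / covG₂ γ z z ∧
      IntegrableOn (fun z => ((‖deriv (covG γ) z‖ : ℂ) / covG₂ γ z z) ^ 2) (Metric.ball 0 r) ∧
      1 / (2 * Real.pi * Complex.I) * (∮ z in C(0, r), deriv (covG γ) z / covG₂ γ z z) =
        -(1 / Real.pi) *
          ∫ z in Metric.ball 0 r, ((‖deriv (covG γ) z‖ : ℂ) / covG₂ γ z z) ^ 2) := by
  refine ⟨hξ.ae_summable, fun z hz => hξ.covG₂_ne_zero hz,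
    fun D hD _ hcl b => hξ.mean_zeroCount hD hcl b, fun r hr hr1 => ?_⟩
  have h := hξ.mean_zeroCount Metric.isOpen_ball
    ((Metric.closure_ball_subset_closedBall).trans (Metric.closedBall_subset_ball hr1))
    (ballBoundary hr)
  rwa [contourIntegral_ballBoundary_conj_div, contourIntegral_ballBoundary] at h
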